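/- Let $q\in\{0,1\}$ and let $L$ be meromorphic on $\mathbb C$, with no pole except, when $q=1$, a simple pole at $x=1$ (so $L$ has order $-q$ at $1$), nonvanishing for $\operatorname{Re}x>1$, and with $(\log L)^{(n)}(x)=O(x^{-N})$ as $x\to+\infty$ for all integers $n,N\ge0$. Assume $(x-1)^qL(x)=\mathbf G(x)\,\Xi(x)$, where $\mathbf G,\Xi$ are entire of order $1$, $\Xi(x)=\Xi(1-x)$, all zeros $x_k$ of $\mathbf G$ satisfy $\operatorname{Re}x_k\le0$, and all zeros $\rho$ of $\Xi$ are non-real with $0<\operatorname{Re}\rho<1$. Assume that, as $x\to+\infty$, $$-\log\mathbf G(x)\sim\tilde a_1x(\log x-1)+b_1x+\tilde a_0\log x+b_0+\sum_{n\ge1}a_{-n}x^{-n},$$ indefinitely differentiable term by term. Zeros are counted with multiplicity, powers are principal. For $\operatorname{Re}s>1$ put $$\mathcal Z(s,x)=\sum_\rho(x-\rho)^{-s}\quad(x\in U),\qquad \mathbf Z(s,x)=\sum_k(x-x_k)^{-s}\quad(x\in V),$$ where $U$ (resp. $V$) is the set of $x\in\mathbb C$ with $x-\rho\notin(-\infty,0]$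 for all $\rho$ (resp. $x-x_k\notin(-\infty,0]$ for all $k$). Let $\log\Xi$, $\log\mathbf G$, $\log[(x-1)^qL]$ be the holomorphic branches on $U$, $V$, $U\cap V$ such that, as $x\to+\infty$, $\log\mathbf G$ satisfies the above expansion, $\log[(x-1)^qL(x)]=q\log(x-1)+o(1)$, and $\log\Xi(x)=\tilde a_1x(\log x-1)+b_1x+(\tilde a_0+q)\log x+b_0+o(1)$. Let $\mathcal Z(1,x)$ denote $\sum_\rho(x-\rho)^{-1}$ summed over pairs $\{\rho,1-\rho\}$; FP denotes the finite part at a pole and $'$ on $\mathcal Z$ is $\partial/\partial s$. Then these branches exist, the sums converge absolutely for $\operatorname{Re}s>1$, and $\mathcal Z(\cdot,x)$ ($x\in U$) and $\mathbf Z(\cdot,x)$ ($x\in V$) extend meromorphically to $\mathbb C$ with at most one pole, $s=1$, simple, of residue $-\tilde a_1$ and $\tilde a_1$ respectively. Moreover: 1. For integers $n\ge0$ and $x\in V$, $\mathbf Z(-n,x)=P_n(x)$, where $$P_n(x)=-\frac{\tilde a_1}{n+1}x^{n+1}-\tilde a_0x^n+n\sum_{j=1}^n(-1)^j\binom{n-1}{j-1}a_{-j}x^{n-j};$$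 in particular $\mathbf Z(0,x)=-\tilde a_1x-\tilde a_0$. 2. For integers $n\ge0$ and $x\in U$, $\mathcal Z(-n,x)=-P_n(x)+q(x-1)^n$, which equals $-\mathbf Z(-n,x)+q(x-1)^n$ if also $x\in V$; in particular $\mathcal Z(0,x)=\tilde a_1x+\tilde a_0+q$. 3. For $x\in U$, $\mathcal Z'(0,x)=b_1x+b_0-\log\Xi(x)$, which for $x\in U\cap V$ equals $b_1x+b_0+\log\mathbf G(x)-\log[(x-1)^qL(x)]$. 4. For $x\in U$, $\mathrm{FP}_{s=1}\mathcal Z(s,x)=-b_1+(\log\Xi)'(x)$, which for $x\in U\cap V$ equals $-b_1-(\log\mathbf G)'(x)+(\log[(x-1)^qL])'(x)$, the last term being $\frac q{x-1}+\frac{L'}L(x)$ if $x\ne1$. 5. For integers $n\ge1$ and $x\in U$, $\mathcal Z(n,x)=\frac{(-1)^{n-1}}{(n-1)!}(\log\Xi)^{(n)}(x)$ (for $n=1$ the paired sum converges absolutely). For $n\ge2$ and $x\in U\cap V$ this equals $-\mathbf Z(n,x)+\frac{(-1)^{n-1}}{(n-1)!}(\log[(x-1)^qL])^{(n)}(x)$,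 the last term being $\frac q{(x-1)^n}+\frac{(-1)^{n-1}}{(n-1)!}\bigl(\frac{L'}L\bigr)^{(n-1)}(x)$ if $x\ne1$; here $(L'/L)^{(n-1)}(x)=(\log|L|)^{(n)}(x)$ if $x$ is real and $L$ is real on the real axis. 6. For $x\in U$, with $\mathcal D(x)=e^{-\mathcal Z'(0,x)}$, $\mathcal Z(1,x)-\mathrm{FP}_{s=1}\mathcal Z(s,x)=(\log[\Xi/\mathcal D])'(x)=b_1$. -/

import Mathlib

open Filter Topology Asymptotics

/-- The function `f` on `ℂ` has order of growth exactly `μ`: `μ` is the infimum of the exponents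
`a` for which `f z = O(exp (|z| ^ a))` as `|z| → ∞`. -/
def HasGrowthOrder (f : ℂ → ℂ) (μ : ℝ) : Prop :=
  (∀ a : ℝ, μ < a → f =O[Bornology.cobounded ℂ] fun z : ℂ => Real.exp (‖z‖ ^ a)) ∧
  (∀ a : ℝ, a < μ → ¬ f =O[Bornology.cobounded ℂ] fun z : ℂ => Real.exp (‖z‖ ^ a))

/-- `L` is a primary function with pole order `q` at `1`, trivial factor `G` and completed
function `Ξ = G⁻¹ (x - 1) ^ q L`. The zeros of `G` are the trivial zeros, those of `Ξ` the
nontrivial ones. -/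
structure IsPrimary (L G Ξ : ℂ → ℂ) (q : ℕ) : Prop where
  q_le_one : q ≤ 1
  /-- `L` is holomorphic, except for the pole at `1` when `q = 1`. -/
  differentiableAt : ∀ z : ℂ, (z ≠ 1 ∨ q = 0) → DifferentiableAt ℂ L z
  order_one : meromorphicOrderAt L 1 = ((-(q : ℤ) : ℤ) : WithTop ℤ)
  ne_zero : ∀ z : ℂ, 1 < z.re → L z ≠ 0
  /-- All derivatives of `log L`, including the zeroth one, are `O(x ^ (-∞))` as `x → +∞`; the
  case `n = 0` forces `log L` to be the branch that tends to `0`, which for large `x` is the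
  principal one. -/
  log_decay : ∀ n N : ℕ,
    (fun x : ℝ => iteratedDeriv n (fun z : ℂ => Complex.log (L z)) (x : ℂ))
      =O[atTop] fun x : ℝ => (x ^ N)⁻¹
  G_entire : Differentiable ℂ G
  G_order : HasGrowthOrder G 1
  G_zeros : ∀ z : ℂ, G z = 0 → z.re ≤ 0
  Xi_entire : Differentiable ℂ Ξ
  Xi_order : HasGrowthOrder Ξ 1
  factorization : ∀ z : ℂ, z ≠ 1 → G z * Ξ z = (z - 1) ^ q * L z
  functional_equation : ∀ z : ℂ, Ξ z = Ξ (1 - z)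
  Xi_zeros : ∀ z : ℂ, Ξ z = 0 → 0 < z.re ∧ z.re < 1 ∧ z.im ≠ 0

/-- The generalized Stirling expansion
`-log G(x) ∼ α₁ x (log x - 1) + b₁ x + α₀ log x + b₀ + ∑_{n ≥ 1} a n x ^ (-n)`, `x → +∞`,
differentiable term by term any number of times, for a holomorphic branch of `log G` in the
right half-plane. -/
def HasStirlingExpansion (G : ℂ → ℂ) (α₁ b₁ α₀ b₀ : ℂ) (a : ℕ → ℂ) : Prop :=
  ∃ ℓ : ℂ → ℂ, AnalyticOnNhd ℂ ℓ {z | 0 < z.re} ∧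
    (∀ z : ℂ, 0 < z.re → Complex.exp (ℓ z) = G z) ∧
    ∀ m N : ℕ,
      (fun x : ℝ => iteratedDeriv m
        (fun z : ℂ => -ℓ z - (α₁ * z * (Complex.log z - 1) + b₁ * z + α₀ * Complex.log z + b₀
          + ∑ n ∈ Finset.Icc 1 N, a n * (z ^ n)⁻¹)) (x : ℂ))
        =O[atTop] fun x : ℝ => (x ^ (N + 1 + m))⁻¹

/-- The values of `x` for which `x - ρ` avoids `(-∞, 0]` for every zero `ρ` of `f`. -/
def eligible (f : ℂ → ℂ) : Set ℂ :=
  {x | ∀ ρ : ℂ, f ρ = 0 → x - ρ ∈ Complex.slitPlane}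

/-- The term of the zero `ρ` of `f` in `∑ (x - ρ) ^ (-s)`, with its multiplicity. -/
noncomputable def zetaTerm (f : ℂ → ℂ) (s x : ℂ) (ρ : {ρ : ℂ // f ρ = 0}) : ℂ :=
  (analyticOrderNatAt f ρ : ℂ) * (x - ρ) ^ (-s)

/-- For every eligible `x`, `s ↦ Z s x` is the meromorphic continuation to `ℂ` of the zeta
function `∑ (x - ρ) ^ (-s)` (`1 < re s`) over the zeros `ρ` of `f`, counted with multiplicity;
its only pole is a simple one at `s = 1`, of residue `r`. The value `Z 1 x` carries no meaning. -/
structure IsZetaOverZeros (f : ℂ → ℂ) (Z : ℂ → ℂ → ℂ) (r : ℂ) : Prop where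
  summable : ∀ x ∈ eligible f, ∀ s : ℂ, 1 < s.re → Summable (zetaTerm f s x)
  eq_tsum : ∀ x ∈ eligible f, ∀ s : ℂ, 1 < s.re → Z s x = ∑' ρ, zetaTerm f s x ρ
  differentiableOn : ∀ x ∈ eligible f, DifferentiableOn ℂ (fun s => Z s x) {1}ᶜ
  residue : ∀ x ∈ eligible f, Tendsto (fun s => (s - 1) * Z s x) (𝓝[≠] 1) (𝓝 r)

/-- `c` is the finite part of `F` at the (at most simple) pole `s₀`. -/
def HasFinitePart (F : ℂ → ℂ) (s₀ c : ℂ) : Prop :=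
  ∃ r : ℂ, Tendsto (fun s => F s - r / (s - s₀)) (𝓝[≠] s₀) (𝓝 c)

/-- The contribution to `∑ (x - ρ)⁻¹` of the pair of zeros `ρ`, `1 - ρ` of `Ξ`, `0 < im ρ`. -/
noncomputable def pairTerm (Ξ : ℂ → ℂ) (x : ℂ) (ρ : {ρ : ℂ // Ξ ρ = 0 ∧ 0 < ρ.im}) : ℂ :=
  (analyticOrderNatAt Ξ ρ : ℂ) * ((x - ρ)⁻¹ + (x - (1 - ρ))⁻¹)

/-- The number `𝒵(1, x) = ∑ (x - ρ)⁻¹`, the zeros being taken in pairs `ρ`, `1 - ρ`. -/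
noncomputable def zetaAtOne (Ξ : ℂ → ℂ) (x : ℂ) : ℂ := ∑' ρ, pairTerm Ξ x ρ

/-- `ℓ` is the holomorphic branch of `log f` on `D` with `ℓ(t) = A(t) + o(1)` as `t → +∞`. -/
structure IsLogBranch (f : ℂ → ℂ) (D : Set ℂ) (A : ℝ → ℂ) (ℓ : ℂ → ℂ) : Prop where
  analytic : AnalyticOnNhd ℂ ℓ D
  exp_eq : ∀ z ∈ D, Complex.exp (ℓ z) = f z
  asymptotic : Tendsto (fun t : ℝ => ℓ (t : ℂ) - A t) atTop (𝓝 0)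

/-- The polynomial in `x` giving the value at `s = -n` of the zeta function over the trivial
zeros. -/
noncomputable def shadowPoly (α₁ α₀ : ℂ) (a : ℕ → ℂ) (n : ℕ) (x : ℂ) : ℂ :=
  -(α₁ / ((n : ℂ) + 1)) * x ^ (n + 1) - α₀ * x ^ n
    + (n : ℂ) * ∑ j ∈ Finset.Icc 1 n,
        (-1 : ℂ) ^ j * ((n - 1).choose (j - 1) : ℂ) * a j * x ^ (n - j)

/-! ### Counting and dividing out the zeros of entire functions of order at most one. -/

section EntireZeros
open Complex Set Metric

/-! The two zeta functions come from one construction, applied to an entire `f` of order at most one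
whose zeros have real part at most one. Write `ℓ` for a branch of `log f` on the set where no `x -
ρ` lies on the cut, and suppose that `ℓ` has a Stirling expansion with coefficients `α, b, β, b₀,
a`.

Two derivatives of `log f` leave only the zeros: `-ℓ''(z) = ∑ (z - ρ)⁻²`
(`deriv_logDeriv_eq_neg_zeroPowSum`). This replaces the Hadamard product, whose exponential factor
the second derivative would kill. Since `∫ y^(1 - s) (y + w)⁻² dy = Γ(2 - s) Γ(s) w⁻ˢ` on `(0, ∞)`
for `0 < re s < 2` (`mellin_inv_add_sq`), the Mellin transform of `y ↦ -ℓ''(x + y)` at `2 - s` is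
`Γ(2 - s) Γ(s) ∑ (x - ρ)⁻ˢ` for `1 < re s < 2` (`mellin_zeroPowSum`). By the reflection formula, `(s
- 1) ∑ (x - ρ)⁻ˢ` is `-sin(π s) / π` times that transform.

The Stirling expansion, carried from the real axis to horizontal lines (`exists_strip_bound`), gives
`-ℓ''(x + y) ∼ ∑ cₙ(x) y⁻ⁿ`. Hence the Mellin transform continues to `re s < 2` with at most simple
poles at `s = 2 - n`, `n ≥ 1`, and the sine removes them. So `H(s) = (s - 1) Z(s, x)` is entire, and
`H(-n)` is read off from the single coefficient `c_{n+2}(x)`; this is where the polynomials come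
from (`shiftCoeff_eq_shadowPoly`). At `s = 1` and `s = 0` the derivative of `H` needs only a
regularized integral of `-ℓ''` against `1` or `y`. These have the primitives `-ℓ'` and `ℓ - y ℓ'`,
and their constants at infinity are made of the Stirling coefficients; this produces `b` and `b₀`.

For `f = G` the expansion is the hypothesis with signs reversed. For `f = Ξ`, `log Ξ = -log G + q
log(x - 1) + log L` with negligible `log L`, so `β` gains `q` and `aₙ` loses `q / n`; the binomial
theorem turns these into `q (x - 1)ⁿ`. The paired sum at `s = 1` has the same derivative as `(log
Ξ)'`, and both vanish at `1/2` by the functional equation, so they agree (`zetaAtOne_eq`). -/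

theorem analyticOrderAt_ne_top_of_entire {f : ℂ → ℂ} (hf : Differentiable ℂ f) {c : ℂ}
    (hc : f c ≠ 0) (z : ℂ) : analyticOrderAt f z ≠ ⊤ := by
  have hA : AnalyticOnNhd ℂ f univ := fun w _ => hf.analyticAt w
  refine hA.analyticOrderAt_ne_top_of_isPreconnected isPreconnected_univ (mem_univ c)
    (mem_univ z) ?_
  rw [(hf.analyticAt c).analyticOrderAt_eq_zero.mpr hc]
  simp

theorem finite_zeros_closedBall {f : ℂ → ℂ} (hf : Differentiable ℂ f) {c : ℂ}
    (hc : f c ≠ 0) (x : ℂ) (R : ℝ) : {ρ : ℂ | f ρ = 0 ∧ ‖ρ - x‖ ≤ R}.Finite := by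
  have hA : AnalyticOnNhd ℂ f univ := fun w _ => hf.analyticAt w
  have h1 := hA.preimage_zero_mem_codiscrete hc
  have h2 : f ⁻¹' {0}ᶜ ∈ codiscreteWithin (closedBall x R) :=
    codiscreteWithin_mono (subset_univ _) h1
  have h3 := (isCompact_closedBall x R).finite_sdiff_of_mem_codiscreteWithin h2
  refine h3.subset fun ρ hρ => ⟨?_, ?_⟩
  · simpa [mem_closedBall, dist_eq_norm] using hρ.2
  · simpa using hρ.1

/-- Zeros can be divided out of an entire function. -/
theorem exists_entire_factorization {f : ℂ → ℂ} (hf : Differentiable ℂ f) {c : ℂ}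
    (hc : f c ≠ 0) (s : Finset ℂ) :
    ∃ g : ℂ → ℂ, Differentiable ℂ g ∧
      (∀ z, f z = (∏ ρ ∈ s, (z - ρ) ^ analyticOrderNatAt f ρ) * g z) ∧ ∀ ρ ∈ s, g ρ ≠ 0 := by
  classical
  induction s using Finset.induction_on with
  | empty => exact ⟨f, hf, by simp, by simp⟩
  | insert ρ₀ s hρ₀ ih =>
    obtain ⟨g, hg, hfg, hgs⟩ := ih
    set m := analyticOrderNatAt f ρ₀ with hm
    set P : ℂ → ℂ := fun z => ∏ ρ ∈ s, (z - ρ) ^ analyticOrderNatAt f ρ with hP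
    have hPd : Differentiable ℂ P := by
      rw [hP]; fun_prop
    have hP0 : P ρ₀ ≠ 0 := by
      rw [hP]
      refine Finset.prod_ne_zero_iff.mpr fun ρ hρ => pow_ne_zero _ (sub_ne_zero.mpr ?_)
      rintro rfl; exact hρ₀ hρ
    have hfP : f = P * g := by ext z; exact hfg z
    have hord : analyticOrderAt g ρ₀ = m := by
      have h1 : analyticOrderAt f ρ₀ = analyticOrderAt P ρ₀ + analyticOrderAt g ρ₀ := by
        rw [hfP]; exact analyticOrderAt_mul (hPd.analyticAt _) (hg.analyticAt _)
      rw [(hPd.analyticAt _).analyticOrderAt_eq_zero.mpr hP0, zero_add] at h1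
      rw [← h1, hm, Nat.cast_analyticOrderNatAt (analyticOrderAt_ne_top_of_entire hf hc _)]
    obtain ⟨h, hha, hh0, hgh⟩ := (hg.analyticAt ρ₀).analyticOrderAt_eq_natCast.mp hord
    simp only [smul_eq_mul] at hgh
    have hne : ∀ {z : ℂ}, z ≠ ρ₀ → (z - ρ₀) ^ m ≠ 0 := fun hz => pow_ne_zero _ (sub_ne_zero.mpr hz)
    -- The quotient is given the value of the local cofactor `h` at `ρ₀`, which fills the removable
    -- singularity.
    set g' : ℂ → ℂ := Function.update (fun z => g z / (z - ρ₀) ^ m) ρ₀ (h ρ₀) with hg'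
    have hg'ne : ∀ z, z ≠ ρ₀ → g' z = g z / (z - ρ₀) ^ m := fun z hz => by
      rw [hg', Function.update_of_ne hz]
    have hg'0 : g' ρ₀ = h ρ₀ := by rw [hg', Function.update_self]
    have hmul : ∀ z, g z = (z - ρ₀) ^ m * g' z := by
      intro z
      by_cases hz : z = ρ₀
      · subst hz
        rw [hg'0, hgh.self_of_nhds]
      · rw [hg'ne z hz, mul_div_cancel₀ _ (hne hz)]
    refine ⟨g', ?_, ?_, ?_⟩
    · intro z
      by_cases hz : z = ρ₀
      · subst hz
        refine hha.differentiableAt.congr_of_eventuallyEq ?_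
        filter_upwards [hgh] with w hw
        by_cases hwz : w = z
        · rw [hwz, hg'0]
        · rw [hg'ne w hwz, hw, mul_div_cancel_left₀ _ (hne hwz)]
      · have : DifferentiableAt ℂ (fun w => g w / (w - ρ₀) ^ m) z :=
          (hg z).div (by fun_prop) (hne hz)
        refine this.congr_of_eventuallyEq ?_
        filter_upwards [isOpen_ne.mem_nhds hz] with w hw using hg'ne w hw
    · intro z
      rw [Finset.prod_insert hρ₀, hfg z, hmul z]
      ring
    · intro ρ hρ
      rcases Finset.mem_insert.mp hρ with rfl | hρs
      · rw [hg'0]; exact hh0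
      · have : ρ ≠ ρ₀ := by rintro rfl; exact hρ₀ hρs
        rw [hg'ne ρ this]
        exact div_ne_zero (hgs ρ hρs) (hne this)

/-- The quotient of an entire function by the product over some of its zeros in a ball of radius
`R` is bounded on the ball of radius `3 R`. -/
theorem norm_quotient_le {f g : ℂ → ℂ} (hg : Differentiable ℂ g) {c : ℂ} {s : Finset ℂ}
    {m : ℂ → ℕ} (hfg : ∀ z, f z = (∏ ρ ∈ s, (z - ρ) ^ m ρ) * g z) {R M : ℝ} (hR : 0 < R)
    (hs : ∀ ρ ∈ s, ‖ρ - c‖ ≤ R) (hM : ∀ z ∈ sphere c (3 * R), ‖f z‖ ≤ M) {z : ℂ}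
    (hz : z ∈ closedBall c (3 * R)) :
    ‖g z‖ * ((∏ ρ ∈ s, ‖c - ρ‖ ^ m ρ) * 2 ^ (∑ ρ ∈ s, m ρ)) ≤ M := by
  have h3R : (3 * R) ≠ 0 := by positivity
  set A : ℝ := (∏ ρ ∈ s, ‖c - ρ‖ ^ m ρ) * 2 ^ (∑ ρ ∈ s, m ρ) with hA
  have hA0 : 0 ≤ A := by positivity
  -- On the sphere `‖w - ρ‖ ≥ 3R - R ≥ 2‖c - ρ‖`. The maximum principle then carries the factor `2`
  -- per zero inside, as a substitute for Jensen's formula.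
  have hsph : ∀ w ∈ sphere c (3 * R), A ≤ ‖∏ ρ ∈ s, (w - ρ) ^ m ρ‖ := by
    intro w hw
    rw [hA, ← Finset.prod_pow_eq_pow_sum, ← Finset.prod_mul_distrib, norm_prod]
    refine Finset.prod_le_prod (fun ρ _ => by positivity) fun ρ hρ => ?_
    rw [norm_pow, ← mul_pow]
    refine pow_le_pow_left₀ (by positivity) ?_ _
    have h1 : ‖w - c‖ = 3 * R := by simpa [dist_eq_norm] using hw
    have h2 := hs ρ hρ
    have h3 : ‖w - c‖ ≤ ‖w - ρ‖ + ‖ρ - c‖ := norm_sub_le_norm_sub_add_norm_sub _ _ _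
    rw [norm_sub_rev c ρ]
    linarith
  have key : ∀ w ∈ sphere c (3 * R), ‖(A : ℂ) * g w‖ ≤ M := by
    intro w hw
    rw [norm_mul, norm_real, Real.norm_of_nonneg hA0]
    calc A * ‖g w‖ ≤ ‖∏ ρ ∈ s, (w - ρ) ^ m ρ‖ * ‖g w‖ := by gcongr; exact hsph w hw
      _ = ‖f w‖ := by rw [hfg w, norm_mul]
      _ ≤ M := hM w hw
  have := Complex.norm_le_of_forall_mem_frontier_norm_le (f := fun w => (A : ℂ) * g w)
    (U := ball c (3 * R)) isBounded_ball ((hg.const_mul _).diffContOnCl)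
    (fun w hw => key w (by rwa [frontier_ball c h3R] at hw))
    (by rwa [closure_ball c h3R])
  rw [norm_mul, norm_real, Real.norm_of_nonneg hA0] at this
  linarith [mul_comm A ‖g z‖]

/-- At most exponential growth of every order above one, with respect to a base point. -/
def GrowthLE (f : ℂ → ℂ) (c : ℂ) : Prop :=
  ∀ a : ℝ, 1 < a → ∃ A : ℝ, 0 < A ∧ ∀ z, ‖f z‖ ≤ Real.exp (A * (1 + ‖z - c‖) ^ a)

theorem HasGrowthOrder.growthLE {f : ℂ → ℂ} (hf : Differentiable ℂ f) (h : HasGrowthOrder f 1)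
    (c : ℂ) : GrowthLE f c := by
  intro a ha
  obtain ⟨C, hC⟩ := (h.1 a ha).bound
  have hb : ∀ᶠ z in cocompact ℂ, ‖f z‖ ≤ C * ‖Real.exp (‖z‖ ^ a)‖ := by
    rwa [← Metric.cobounded_eq_cocompact]
  obtain ⟨K, hK, hKC⟩ := mem_cocompact.mp hb
  obtain ⟨C', hC'⟩ := hK.exists_bound_of_continuousOn hf.continuous.continuousOn
  set C₀ := max 2 (max C C') with hC₀
  have h1 : ∀ z, ‖f z‖ ≤ C₀ * Real.exp (‖z‖ ^ a) := by
    intro z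
    have he : 1 ≤ Real.exp (‖z‖ ^ a) := Real.one_le_exp (by positivity)
    by_cases hz : z ∈ K
    · calc ‖f z‖ ≤ C' := hC' z hz
        _ ≤ C₀ := (le_max_right _ _).trans (le_max_right _ _)
        _ ≤ C₀ * Real.exp (‖z‖ ^ a) := le_mul_of_one_le_right (by positivity) he
    · calc ‖f z‖ ≤ C * ‖Real.exp (‖z‖ ^ a)‖ := hKC hz
        _ = C * Real.exp (‖z‖ ^ a) := by rw [Real.norm_of_nonneg (Real.exp_pos _).le]
        _ ≤ _ := by gcongr; exact (le_max_left _ _).trans (le_max_right _ _)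
  have hC2 : 1 < C₀ := lt_of_lt_of_le one_lt_two (le_max_left _ _)
  have hl : 0 < Real.log C₀ := Real.log_pos hC2
  -- `‖z‖ ≤ (1 + ‖c‖)(1 + ‖z - c‖)` moves the base point; the factor `C₀` is absorbed because `(1 +
  -- ‖z - c‖) ^ a ≥ 1`.
  refine ⟨Real.log C₀ + (1 + ‖c‖) ^ a, by positivity, fun z => (h1 z).trans ?_⟩
  rw [← Real.exp_log (zero_lt_one.trans hC2), ← Real.exp_add, Real.exp_log (zero_lt_one.trans hC2)]
  refine Real.exp_le_exp.mpr ?_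
  have h2 : 1 ≤ (1 + ‖z - c‖) ^ a := Real.one_le_rpow (by linarith [norm_nonneg (z - c)]) (by linarith)
  have h3 : ‖z‖ ^ a ≤ (1 + ‖c‖) ^ a * (1 + ‖z - c‖) ^ a := by
    rw [← Real.mul_rpow (by positivity) (by positivity)]
    refine Real.rpow_le_rpow (norm_nonneg _) ?_ (by linarith)
    have h4 : ‖z‖ ≤ ‖c‖ + ‖z - c‖ := by
      calc ‖z‖ = ‖c + (z - c)‖ := by congr 1; ring
        _ ≤ _ := norm_add_le _ _
    nlinarith [norm_nonneg c, norm_nonneg (z - c), mul_nonneg (norm_nonneg c) (norm_nonneg (z - c))]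
  nlinarith

/-- A bound for the number of zeros in a ball. -/
theorem exists_sum_order_le {f : ℂ → ℂ} (hf : Differentiable ℂ f) {c : ℂ} (hc : f c ≠ 0)
    (hgr : GrowthLE f c) {a : ℝ} (ha : 1 < a) :
    ∃ B : ℝ, 0 < B ∧ ∀ R : ℝ, 1 ≤ R → ∀ s : Finset ℂ, (∀ ρ ∈ s, f ρ = 0 ∧ ‖ρ - c‖ ≤ R) →
      ((∑ ρ ∈ s, analyticOrderNatAt f ρ : ℕ) : ℝ) ≤ B * R ^ a := by
  obtain ⟨A, hA, hfA⟩ := hgr a ha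
  have hl2 : 0 < Real.log 2 := Real.log_pos one_lt_two
  refine ⟨(A * 4 ^ a + |Real.log ‖f c‖|) / Real.log 2, by positivity, fun R hR s hs => ?_⟩
  obtain ⟨g, hg, hfg, -⟩ := exists_entire_factorization hf hc s
  have hR0 : 0 < R := by linarith
  have hM : ∀ z ∈ sphere c (3 * R), ‖f z‖ ≤ Real.exp (A * (4 * R) ^ a) := by
    intro z hz
    have hz' : ‖z - c‖ = 3 * R := by simpa [dist_eq_norm] using hz
    refine (hfA z).trans (Real.exp_le_exp.mpr ?_)
    gcongr
    linarith
  -- At the centre the zero factors recombine with `g c` to `f c`, so that `‖f c‖ 2^count` is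
  -- bounded; logarithms give the count.
  have h1 := norm_quotient_le hg hfg hR0 (fun ρ hρ => (hs ρ hρ).2) hM
    (mem_closedBall_self (by positivity))
  have h2 : ‖g c‖ * (∏ ρ ∈ s, ‖c - ρ‖ ^ analyticOrderNatAt f ρ) = ‖f c‖ := by
    rw [hfg c, norm_mul, norm_prod, mul_comm]
    simp only [norm_pow]
  rw [← mul_assoc, h2] at h1
  have hfc : 0 < ‖f c‖ := norm_pos_iff.mpr hc
  have h3 := Real.log_le_log (by positivity) h1
  rw [Real.log_exp, Real.log_mul hfc.ne' (by positivity), Real.log_pow,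
    Real.mul_rpow (by norm_num) hR0.le] at h3
  rw [div_mul_eq_mul_div, le_div_iff₀ hl2]
  have h4 : 1 ≤ R ^ a := Real.one_le_rpow hR (by linarith)
  nlinarith [neg_abs_le (Real.log ‖f c‖), abs_nonneg (Real.log ‖f c‖)]

/-- Dyadic shells: for `1 < a < σ`, the shell `2^k ≤ 1 + ‖ρ - c‖ ≤ 2^(k+1)` holds `O(2^(k a))`
zeros, each of weight at most `2^(-k σ)`, so the sum is dominated by a geometric series of ratio
`2^(a - σ)`. -/
theorem summable_order_mul_rpow {f : ℂ → ℂ} (hf : Differentiable ℂ f) {c : ℂ} (hc : f c ≠ 0)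
    (hgr : GrowthLE f c) {σ : ℝ} (hσ : 1 < σ) :
    Summable fun ρ : {ρ : ℂ // f ρ = 0} =>
      (analyticOrderNatAt f ρ : ℝ) * (1 + ‖(ρ : ℂ) - c‖) ^ (-σ) := by
  classical
  set a := (1 + σ) / 2 with ha
  have ha1 : 1 < a := by linarith
  have haσ : a - σ < 0 := by linarith
  obtain ⟨B, hB, hBs⟩ := exists_sum_order_le hf hc hgr ha1
  set r : ℝ := 2 ^ (a - σ) with hr
  have hr0 : 0 < r := by positivity
  have hr1 : r < 1 := Real.rpow_lt_one_of_one_lt_of_neg one_lt_two haσ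
  have hgeo : Summable fun k : ℕ => B * 2 ^ a * r ^ k :=
    (summable_geometric_of_lt_one hr0.le hr1).mul_left _
  refine summable_of_sum_le (c := ∑' k : ℕ, B * 2 ^ a * r ^ k) (fun ρ => by positivity) fun u => ?_
  -- The index of the dyadic shell that contains the zero.
  set κ : {ρ : ℂ // f ρ = 0} → ℕ := fun ρ => Nat.log 2 ⌊1 + ‖(ρ : ℂ) - c‖⌋₊ with hκ
  have hlow : ∀ ρ : {ρ : ℂ // f ρ = 0}, (2 : ℝ) ^ κ ρ ≤ 1 + ‖(ρ : ℂ) - c‖ := by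
    intro ρ
    have h0 : ⌊1 + ‖(ρ : ℂ) - c‖⌋₊ ≠ 0 := by
      refine (Nat.floor_pos.mpr ?_).ne'; linarith [norm_nonneg ((ρ : ℂ) - c)]
    have h1 : ((2 ^ κ ρ : ℕ) : ℝ) ≤ (⌊1 + ‖(ρ : ℂ) - c‖⌋₊ : ℝ) := by
      exact_mod_cast Nat.pow_log_le_self 2 h0
    push_cast at h1
    exact h1.trans (Nat.floor_le (by positivity))
  have hup : ∀ ρ : {ρ : ℂ // f ρ = 0}, 1 + ‖(ρ : ℂ) - c‖ ≤ (2 : ℝ) ^ (κ ρ + 1) := by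
    intro ρ
    have h1 : ⌊1 + ‖(ρ : ℂ) - c‖⌋₊ + 1 ≤ 2 ^ (κ ρ + 1) :=
      Nat.lt_pow_succ_log_self one_lt_two _
    have h2 : ((⌊1 + ‖(ρ : ℂ) - c‖⌋₊ + 1 : ℕ) : ℝ) ≤ ((2 ^ (κ ρ + 1) : ℕ) : ℝ) := by
      exact_mod_cast h1
    push_cast at h2
    exact (Nat.lt_floor_add_one _).le.trans h2
  rw [← Finset.sum_fiberwise_of_maps_to (t := u.image κ) (g := κ)
    (fun ρ hρ => Finset.mem_image_of_mem κ hρ)]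
  refine le_trans (Finset.sum_le_sum fun k _ => ?_)
    (hgeo.sum_le_tsum (u.image κ) fun k _ => by positivity)
  set v := u.filter fun ρ => κ ρ = k with hv
  have h1 := hBs ((2 : ℝ) ^ (k + 1)) (one_le_pow₀ one_le_two) (v.map ⟨Subtype.val, Subtype.val_injective⟩)
    (by
      intro ρ hρ
      simp only [Finset.mem_map, Function.Embedding.coeFn_mk] at hρ
      obtain ⟨ρ', hρ', rfl⟩ := hρ
      have hk : κ ρ' = k := (Finset.mem_filter.mp hρ').2
      have := hup ρ'
      rw [hk] at this
      exact ⟨ρ'.2, by linarith⟩)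
  rw [Finset.sum_map] at h1
  simp only [Function.Embedding.coeFn_mk] at h1
  push_cast at h1
  calc ∑ ρ ∈ v, (analyticOrderNatAt f ρ : ℝ) * (1 + ‖(ρ : ℂ) - c‖) ^ (-σ)
      ≤ ∑ ρ ∈ v, (analyticOrderNatAt f ρ : ℝ) * ((2 : ℝ) ^ k) ^ (-σ) := by
        refine Finset.sum_le_sum fun ρ hρ => ?_
        have hk : κ ρ = k := (Finset.mem_filter.mp hρ).2
        have := hlow ρ
        rw [hk] at this
        exact mul_le_mul_of_nonneg_left
          (Real.rpow_le_rpow_of_nonpos (by positivity) this (by linarith)) (by positivity)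
    _ = (∑ ρ ∈ v, (analyticOrderNatAt f ρ : ℝ)) * ((2 : ℝ) ^ k) ^ (-σ) := by
        rw [Finset.sum_mul]
    _ ≤ (B * ((2 : ℝ) ^ (k + 1)) ^ a) * ((2 : ℝ) ^ k) ^ (-σ) := by gcongr
    _ = B * 2 ^ a * r ^ k := by
        rw [hr, ← Real.rpow_natCast (2 ^ (a - σ)) k, ← Real.rpow_natCast 2 (k + 1),
          ← Real.rpow_natCast 2 k, ← Real.rpow_mul, ← Real.rpow_mul, ← Real.rpow_mul, mul_assoc,
          mul_assoc, ← Real.rpow_add, ← Real.rpow_add]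
        · congr 2; push_cast; ring
        all_goals norm_num

end EntireZeros

/-! ### Holomorphic logarithms and simply connected domains. -/

section Branches
open Complex Set Metric

/-- A continuous logarithm of an analytic function is analytic. -/
theorem analyticAt_of_exp_eq {f ℓ : ℂ → ℂ} {z : ℂ} (hf : AnalyticAt ℂ f z)
    (hℓ : ContinuousAt ℓ z) (h : ∀ᶠ w in 𝓝 z, exp (ℓ w) = f w) : AnalyticAt ℂ ℓ z := by
  have hz : f z = exp (ℓ z) := h.self_of_nhds.symm
  have h1 : AnalyticAt ℂ (fun w => ℓ z + log (f w / f z)) z := by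
    refine analyticAt_const.add ((hf.div_const).clog ?_)
    rw [div_self (by rw [hz]; exact exp_ne_zero _)]
    exact one_mem_slitPlane
  refine h1.congr ?_
  -- Within distance `1 < π` of `ℓ z` the principal logarithm inverts the exponential, so `ℓ` is
  -- locally a constant plus a principal logarithm.
  have h2 : ∀ᶠ w in 𝓝 z, dist (ℓ w) (ℓ z) < 1 := hℓ (ball_mem_nhds _ one_pos)
  filter_upwards [h, h2] with w hw hw2
  rw [← hw, hz, ← exp_sub, log_exp]
  · ring
  all_goals
    have h3 : |(ℓ w - ℓ z).im| < 1 := (abs_im_le_norm _).trans_lt (by rwa [← dist_eq_norm])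
    rw [abs_lt] at h3
    linarith [Real.pi_gt_three]

theorem exists_analytic_log {D : Set ℂ} (hD : IsSimplyConnected D) (hDo : IsOpen D) {f : ℂ → ℂ}
    (hf : AnalyticOnNhd ℂ f D) (h0 : ∀ z ∈ D, f z ≠ 0) :
    ∃ ℓ : ℂ → ℂ, AnalyticOnNhd ℂ ℓ D ∧ ∀ z ∈ D, exp (ℓ z) = f z := by
  obtain ⟨ℓ, hℓc, hℓ⟩ := exists_continuousOn_eqOn_exp_comp hD hDo hf.continuousOn
    (by rintro ⟨z, hz, hz0⟩; exact h0 z hz hz0)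
  refine ⟨ℓ, fun z hz => ?_, hℓ⟩
  refine analyticAt_of_exp_eq (hf z hz) (hℓc.continuousAt (hDo.mem_nhds hz)) ?_
  filter_upwards [hDo.mem_nhds hz] with w hw using hℓ hw

theorem Convex.isSimplyConnected {D : Set ℂ} (hD : Convex ℝ D) (hne : D.Nonempty) :
    IsSimplyConnected D := by
  have : ContractibleSpace D := hD.contractibleSpace hne
  exact SimplyConnectedSpace.ofContractible D

/-- A domain that is invariant under `x ↦ x + t`, `t ≥ 0`, and contains a right half-plane is
simply connected. -/
theorem isSimplyConnected_of_add_mem {D : Set ℂ} (hadd : ∀ z ∈ D, ∀ t : ℝ, 0 ≤ t → z + t ∈ D)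
    {σ : ℝ} (hσ : {z : ℂ | σ < z.re} ⊆ D) : IsSimplyConnected D := by
  have hHc : Convex ℝ {z : ℂ | σ < z.re} := convex_halfSpace_re_gt σ
  have hHn : {z : ℂ | σ < z.re}.Nonempty := ⟨((σ + 1 : ℝ) : ℂ), by simp⟩
  have : ContractibleSpace {z : ℂ | σ < z.re} := hHc.contractibleSpace hHn
  have : ContractibleSpace D := by
    rw [contractible_iff_id_nullhomotopic]
    -- A shift by `τ z` puts every point into the half-plane. The homotopy `z + t τ(z)` stays in `D`
    -- and joins the identity to a map that factors through a contractible set.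
    set τ : ℂ → ℝ := fun z => |σ| + 1 + |z.re| with hτ
    have hτc : Continuous τ := by rw [hτ]; fun_prop
    have hτ0 : ∀ z, 0 ≤ τ z := fun z => by positivity
    let g : C(D, {z : ℂ | σ < z.re}) := ⟨fun z => ⟨(z : ℂ) + τ z, by
        simp only [mem_ofPred_eq, add_re, ofReal_re, hτ]
        linarith [neg_abs_le (z : ℂ).re, le_abs_self σ]⟩, by fun_prop⟩
    let i : C({z : ℂ | σ < z.re}, D) := ⟨inclusion hσ, continuous_inclusion hσ⟩
    obtain ⟨y, hy⟩ := ((id_nullhomotopic {z : ℂ | σ < z.re}).comp_left g).comp_right i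
    let H : (ContinuousMap.id D).Homotopy (i.comp ((ContinuousMap.id _).comp g)) :=
      { toFun := fun p => ⟨(p.2 : ℂ) + ((p.1 : ℝ) * τ p.2 : ℝ),
          hadd _ p.2.2 _ (mul_nonneg p.1.2.1 (hτ0 _))⟩
        continuous_toFun := by fun_prop
        map_zero_left := fun z => by ext; simp
        map_one_left := fun z => by ext; simp [i, g] }
    exact ⟨y, ContinuousMap.Homotopic.trans ⟨H⟩ hy⟩
  exact SimplyConnectedSpace.ofContractible D

/-- Two logarithms of the same function on a preconnected set differ by a constant. -/
theorem exists_eq_add_of_exp_eq {X : Type*} [TopologicalSpace X] {S : Set X}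
    (hS : IsPreconnected S) {u v : X → ℂ} (hu : ContinuousOn u S) (hv : ContinuousOn v S)
    (h : ∀ x ∈ S, exp (u x) = exp (v x)) : ∃ k : ℂ, exp k = 1 ∧ ∀ x ∈ S, u x = v x + k := by
  rcases S.eq_empty_or_nonempty with rfl | ⟨x₀, hx₀⟩
  · exact ⟨0, by simp⟩
  refine ⟨u x₀ - v x₀, by rw [exp_sub, h x₀ hx₀, div_self (exp_ne_zero _)], fun x hx => ?_⟩
  -- The difference divided by `2πi` is a continuous integer-valued function.
  choose! n hn using fun x hx => exp_eq_exp_iff_exists_int.mp (h x hx)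
  have hpi : (2 * Real.pi : ℝ) ≠ 0 := by positivity
  have hnc : ∀ x ∈ S, ((n x : ℤ) : ℝ) = ((u x - v x).im) / (2 * Real.pi) := by
    intro x hx
    rw [hn x hx]
    simp
  have h1 : ContinuousOn (fun x => ((n x : ℤ) : ℝ)) S := by
    refine ContinuousOn.congr (f := fun x => ((u x - v x).im) / (2 * Real.pi)) ?_ hnc
    exact (continuous_im.comp_continuousOn (hu.sub hv)).div_const _
  have h2 : ContinuousOn n S := by
    rw [Int.isClosedEmbedding_coe_real.isInducing.continuousOn_iff]
    exact h1
  have h3 := hS.constant h2 hx hx₀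
  rw [hn x hx, hn x₀ hx₀, h3]
  ring

end Branches

/-! ### The second logarithmic derivative as a sum over zeros. -/

section LogDeriv
open Complex Set Metric

/-- The second logarithmic derivative of an entire function of order at most one, up to a small
error, in terms of the zeros in a large ball. -/
theorem exists_deriv_logDeriv_approx {f : ℂ → ℂ} (hf : Differentiable ℂ f) {c : ℂ} (hc : f c ≠ 0)
    (hgr : GrowthLE f c) {z : ℂ} (hz : f z ≠ 0) :
    ∃ C : ℝ, ∀ R : ℝ, 1 ≤ R → 4 * ‖z - c‖ ≤ R → ∀ s : Finset ℂ,
      (∀ ρ, ρ ∈ s ↔ f ρ = 0 ∧ ‖ρ - c‖ ≤ R) →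
      ‖deriv (logDeriv f) z + ∑ ρ ∈ s, (analyticOrderNatAt f ρ : ℂ) * ((z - ρ) ^ 2)⁻¹‖
        ≤ C * R ^ (-(1 / 2 : ℝ)) := by
  -- The growth exponent must exceed `1`, and it must stay below `2` for the factor `R⁻²` in
  -- Cauchy's estimate of a second derivative to win.
  obtain ⟨A, hA, hfA⟩ := hgr (3 / 2) (by norm_num)
  set A' : ℝ := A * 4 ^ (3 / 2 : ℝ) + |Real.log ‖f c‖| with hA'
  have hA'0 : 0 < A' := by positivity
  refine ⟨64 * A', fun R hR hzR s hs => ?_⟩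
  have hR0 : 0 < R := by linarith
  obtain ⟨g, hg, hfg, hgs⟩ := exists_entire_factorization hf hc s
  have hg0 : ∀ w ∈ ball c R, g w ≠ 0 := by
    intro w hw h0
    have hw' : ‖w - c‖ ≤ R := by simpa [dist_eq_norm] using (ball_subset_closedBall hw)
    have hfw : f w = 0 := by rw [hfg w, h0, mul_zero]
    exact hgs w ((hs w).mpr ⟨hfw, hw'⟩) h0
  obtain ⟨h, hh, hhe⟩ := exists_analytic_log
    ((convex_ball c R).isSimplyConnected ⟨c, mem_ball_self hR0⟩) isOpen_ball
    (fun w _ => hg.analyticAt w) hg0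
  have hM : ∀ w ∈ sphere c (3 * R), ‖f w‖ ≤ Real.exp (A * (4 * R) ^ (3 / 2 : ℝ)) := by
    intro w hw
    have hw' : ‖w - c‖ = 3 * R := by simpa [dist_eq_norm] using hw
    refine (hfA w).trans (Real.exp_le_exp.mpr ?_)
    gcongr
    linarith
  set P : ℝ := ∏ ρ ∈ s, ‖c - ρ‖ ^ analyticOrderNatAt f ρ with hP
  have hP0 : 0 < P := by
    refine Finset.prod_pos fun ρ hρ => pow_pos (norm_pos_iff.mpr (sub_ne_zero.mpr ?_)) _
    rintro rfl
    exact hc ((hs _).mp hρ).1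
  have hfc : 0 < ‖f c‖ := norm_pos_iff.mpr hc
  have hgc : ‖f c‖ = ‖g c‖ * P := by
    rw [hfg c, norm_mul, norm_prod, mul_comm]
    simp only [norm_pow, hP]
  have hR32 : (1 : ℝ) ≤ R ^ (3 / 2 : ℝ) := Real.one_le_rpow hR (by norm_num)
  set T := A' * R ^ (3 / 2 : ℝ) with hT
  have hT0 : 0 < T := by positivity
  -- `g` has no zeros in the ball, so `h = log g`; the maximum principle on the ball of radius `3R`
  -- bounds the real part of `h - h c` by a multiple of `R^(3/2)`.
  have hre : ∀ w ∈ ball c R, (h w - h c).re ≤ T := by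
    intro w hw
    have h1 := norm_quotient_le hg hfg hR0 (fun ρ hρ => ((hs ρ).mp hρ).2) hM
      (closedBall_subset_closedBall (by linarith) (ball_subset_closedBall hw) :
        w ∈ closedBall c (3 * R))
    have h2 : ‖g w‖ * P ≤ Real.exp (A * (4 * R) ^ (3 / 2 : ℝ)) := by
      refine le_trans ?_ h1
      gcongr
      exact le_mul_of_one_le_right hP0.le (one_le_pow₀ one_le_two)
    have h3 : Real.exp ((h w - h c).re) * ‖f c‖ ≤ Real.exp (A * (4 * R) ^ (3 / 2 : ℝ)) := by
      rw [← norm_exp, exp_sub, hhe w hw, hhe c (mem_ball_self hR0), norm_div, hgc]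
      have : ‖g c‖ ≠ 0 := norm_ne_zero_iff.mpr (hg0 c (mem_ball_self hR0))
      field_simp
      exact h2
    have h4 := Real.log_le_log (by positivity) h3
    rw [Real.log_exp, Real.log_mul (Real.exp_pos _).ne' hfc.ne', Real.log_exp,
      Real.mul_rpow (by norm_num) hR0.le] at h4
    rw [hT, hA']
    nlinarith [neg_abs_le (Real.log ‖f c‖), abs_nonneg (Real.log ‖f c‖)]
  -- Borel–Carathéodory turns the one-sided bound on the real part into a bound on the modulus on
  -- the half ball.
  have hH : ∀ w : ℂ, ‖w‖ ≤ R / 2 → ‖h (c + w) - h c‖ ≤ 2 * T := by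
    intro w hw
    have hmem : ∀ v ∈ ball (0 : ℂ) R, c + v ∈ ball c R := fun v hv => by
      simpa [mem_ball, dist_eq_norm] using hv
    have := borelCaratheodory_zero (f := fun v => h (c + v) - h c) (z := w) hT0
      (fun v hv => by
        have := (hh (c + v) (hmem v hv)).differentiableAt
        have h2 : DifferentiableAt ℂ (fun v => h (c + v)) v := by
          exact DifferentiableAt.comp v this (by fun_prop)
        exact (h2.sub_const _).differentiableWithinAt)
      (fun v hv => hre (c + v) (hmem v hv)) hR0 (by simp; linarith) (by simp)
    refine this.trans ?_
    rw [div_le_iff₀ (by linarith)]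
    nlinarith [norm_nonneg w]
  have hzb : ∀ {v : ℂ}, v ∈ closedBall z (R / 4) → ‖v - c‖ ≤ R / 2 := by
    intro v hv
    have h1 : ‖v - z‖ ≤ R / 4 := by simpa [dist_eq_norm] using hv
    calc ‖v - c‖ ≤ ‖v - z‖ + ‖z - c‖ := norm_sub_le_norm_sub_add_norm_sub _ _ _
      _ ≤ R / 2 := by linarith
  have hcb : ∀ {v : ℂ}, v ∈ closedBall z (R / 4) → v ∈ ball c R := fun hv => by
    rw [mem_ball, dist_eq_norm]; linarith [hzb hv]
  -- Cauchy's estimate on a disc of radius `R / 4`: `2! · 2T / (R/4)² = 64 T / R²`, whence the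
  -- constant `64 * A'`.
  have hCau := norm_iteratedDeriv_le_of_forall_mem_sphere_norm_le (f := fun v => h v - h c)
    (c := z) (R := R / 4) (C := 2 * T) 2 (by positivity)
    (DifferentiableOn.diffContOnCl (by
      rw [closure_ball _ (by positivity)]
      exact fun v hv => ((hh v (hcb hv)).differentiableAt.sub_const _).differentiableWithinAt))
    (fun v hv => by
      have := hH (v - c) (hzb (sphere_subset_closedBall hv))
      simpa using this)
  have hzz : z ∈ ball c R := hcb (mem_closedBall_self (by positivity))
  have hlog : ∀ᶠ w in 𝓝 z, logDeriv f w =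
      ∑ ρ ∈ s, (analyticOrderNatAt f ρ : ℂ) * (w - ρ)⁻¹ + deriv h w := by
    filter_upwards [isOpen_ball.mem_nhds hzz, hf.continuous.continuousAt.eventually_ne hz]
      with w hw hfw
    have hne : ∀ ρ ∈ s, w - ρ ≠ 0 := by
      intro ρ hρ h0
      rw [sub_eq_zero] at h0
      exact hfw (h0 ▸ ((hs ρ).mp hρ).1)
    have hgh : logDeriv g w = deriv h w := by
      have h1 : g =ᶠ[𝓝 w] fun v => exp (h v) := by
        filter_upwards [isOpen_ball.mem_nhds hw] with v hv using (hhe v hv).symm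
      rw [logDeriv_apply, h1.deriv_eq, ← hhe w hw,
        ((hh w hw).differentiableAt.hasDerivAt.cexp).deriv, mul_div_cancel_left₀ _ (exp_ne_zero _)]
    have hfe : f = fun w => (∏ ρ ∈ s, (w - ρ) ^ analyticOrderNatAt f ρ) * g w := funext hfg
    rw [hfe, logDeriv_mul (f := fun w => ∏ ρ ∈ s, (w - ρ) ^ analyticOrderNatAt f ρ) (g := g) w
      (Finset.prod_ne_zero_iff.mpr fun ρ hρ => pow_ne_zero _ (hne ρ hρ)) (hg0 w hw)
      (by fun_prop) (hg w), hgh, ← hfe]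
    congr 1
    rw [logDeriv_prod (f := fun ρ (w : ℂ) => (w - ρ) ^ analyticOrderNatAt f ρ)
      (fun ρ hρ => pow_ne_zero _ (hne ρ hρ)) (fun ρ _ => by fun_prop)]
    refine Finset.sum_congr rfl fun ρ hρ => ?_
    rw [logDeriv_fun_pow (by fun_prop)]
    congr 1
    rw [logDeriv_apply]
    simp
  have hne : ∀ ρ ∈ s, z - ρ ≠ 0 := by
    intro ρ hρ h0
    rw [sub_eq_zero] at h0
    exact hz (h0 ▸ ((hs ρ).mp hρ).1)
  have hd : deriv (logDeriv f) z =
      - ∑ ρ ∈ s, (analyticOrderNatAt f ρ : ℂ) * ((z - ρ) ^ 2)⁻¹ + iteratedDeriv 2 h z := by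
    rw [EventuallyEq.deriv_eq hlog, iteratedDeriv_succ, iteratedDeriv_one]
    have h1 : HasDerivAt (fun w => ∑ ρ ∈ s, (analyticOrderNatAt f ρ : ℂ) * (w - ρ)⁻¹)
        (∑ ρ ∈ s, (analyticOrderNatAt f ρ : ℂ) * (-1 / (z - ρ) ^ 2)) z := by
      refine HasDerivAt.fun_sum fun ρ hρ => HasDerivAt.const_mul _ ?_
      exact ((hasDerivAt_id z).sub_const ρ).fun_inv (hne ρ hρ)
    rw [(h1.fun_add (hh z hzz).deriv.differentiableAt.hasDerivAt).deriv]
    congr 1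
    rw [← Finset.sum_neg_distrib]
    refine Finset.sum_congr rfl fun ρ _ => ?_
    rw [div_eq_mul_inv]
    ring
  have hit : iteratedDeriv 2 (fun v => h v - h c) z = iteratedDeriv 2 h z := by
    rw [iteratedDeriv_succ, iteratedDeriv_one, iteratedDeriv_succ, iteratedDeriv_one]
    congr 1
    ext v
    rw [deriv_sub_const]
  rw [hd, neg_add_cancel_comm, ← hit]
  refine hCau.trans (le_of_eq ?_)
  rw [hT, show (3 / 2 : ℝ) = 2 + -(1 / 2) by norm_num, Real.rpow_add hR0, Real.rpow_two]
  simp [Nat.factorial]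
  field_simp
  ring

/-- The sum of the `-n`-th powers of the differences to the zeros. -/
noncomputable def zeroPowSum (f : ℂ → ℂ) (n : ℕ) (z : ℂ) : ℂ :=
  ∑' ρ : {ρ : ℂ // f ρ = 0}, (analyticOrderNatAt f ρ : ℂ) * ((z - ρ) ^ n)⁻¹

/-- As the radius runs through the integers, the finite sums over balls exhaust the zeros and the
error `O(R^(-1/2))` vanishes. -/
theorem deriv_logDeriv_eq_neg_zeroPowSum {f : ℂ → ℂ} (hf : Differentiable ℂ f) {c : ℂ}
    (hc : f c ≠ 0) (hgr : GrowthLE f c) {z : ℂ} (hz : f z ≠ 0)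
    (hs : Summable fun ρ : {ρ : ℂ // f ρ = 0} =>
      (analyticOrderNatAt f ρ : ℂ) * ((z - ρ) ^ 2)⁻¹) :
    deriv (logDeriv f) z = - zeroPowSum f 2 z := by
  classical
  obtain ⟨C, hC⟩ := exists_deriv_logDeriv_approx hf hc hgr hz
  set u : ℕ → Finset {ρ : ℂ // f ρ = 0} := fun n =>
    (finite_zeros_closedBall hf hc c n).toFinset.subtype (fun ρ => f ρ = 0) with hu
  have hmem : ∀ n ρ, ρ ∈ u n ↔ ‖(ρ : ℂ) - c‖ ≤ n := by
    intro n ρ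
    simp [hu, ρ.2]
  have hmono : Monotone u := by
    intro m n hmn ρ hρ
    rw [hmem] at hρ ⊢
    exact hρ.trans (by exact_mod_cast hmn)
  have hu' : Tendsto u atTop atTop := tendsto_atTop_finset_of_monotone hmono fun ρ => by
    obtain ⟨n, hn⟩ := exists_nat_ge ‖(ρ : ℂ) - c‖
    exact ⟨n, (hmem n ρ).mpr hn⟩
  have h1 := hs.hasSum.comp hu'
  have h2 : Tendsto (fun n => deriv (logDeriv f) z + ∑ ρ ∈ u n,
      (analyticOrderNatAt f ρ : ℂ) * ((z - ρ) ^ 2)⁻¹) atTop (𝓝 0) := by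
    have h3 : Tendsto (fun n : ℕ => C * (n : ℝ) ^ (-(1 / 2 : ℝ))) atTop (𝓝 0) := by
      rw [← mul_zero C]
      exact ((tendsto_rpow_neg_atTop (by norm_num)).comp tendsto_natCast_atTop_atTop).const_mul C
    refine squeeze_zero_norm' ?_ h3
    filter_upwards [tendsto_natCast_atTop_atTop.eventually_ge_atTop (1 : ℝ),
      tendsto_natCast_atTop_atTop.eventually_ge_atTop (4 * ‖z - c‖)] with n hn1 hn2
    have := hC n hn1 hn2 (finite_zeros_closedBall hf hc c n).toFinset (by simp)
    have h4 : ∑ ρ ∈ u n, (analyticOrderNatAt f ρ : ℂ) * ((z - ρ) ^ 2)⁻¹ =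
        ∑ ρ ∈ (finite_zeros_closedBall hf hc c n).toFinset,
          (analyticOrderNatAt f ρ : ℂ) * ((z - ρ) ^ 2)⁻¹ := by
      rw [hu, Finset.sum_subtype_eq_sum_filter
        (f := fun ρ : ℂ => (analyticOrderNatAt f ρ : ℂ) * ((z - ρ) ^ 2)⁻¹)]
      refine Finset.sum_congr ?_ fun _ _ => rfl
      ext ρ
      simp +contextual
    rw [h4]
    exact this
  have h4 := (tendsto_const_nhds (x := deriv (logDeriv f) z)).add h1
  have h5 := tendsto_nhds_unique h2 h4
  rw [zeroPowSum]
  linear_combination -h5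

end LogDeriv

/-! ### Zeros to the left: separation, eligible points, and termwise differentiation of the sums
over zeros. -/

section Eligible
open Complex Set Metric

/-- Entire functions of order at most one, all of whose zeros have real part at most one. -/
structure IsOrderOneLeft (f : ℂ → ℂ) : Prop where
  differentiable : Differentiable ℂ f
  growth : GrowthLE f 2
  re_le_one : ∀ ρ, f ρ = 0 → ρ.re ≤ 1

variable {f : ℂ → ℂ}

theorem add_mem_slitPlane {w : ℂ} (hw : w ∈ slitPlane) {y : ℝ} (hy : 0 ≤ y) :
    w + y ∈ slitPlane := by
  rw [mem_slitPlane_iff] at hw ⊢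
  simp only [add_re, ofReal_re, add_im, ofReal_im, add_zero]
  rcases hw with h | h
  · left; linarith
  · right; exact h

theorem add_mem_eligible {x : ℂ} (hx : x ∈ eligible f) {y : ℝ} (hy : 0 ≤ y) :
    x + y ∈ eligible f := by
  intro ρ hρ
  have := add_mem_slitPlane (hx ρ hρ) hy
  rwa [show x + y - ρ = x - ρ + y by ring]

theorem ne_zero_of_mem_eligible {x : ℂ} (hx : x ∈ eligible f) : f x ≠ 0 := by
  intro h
  have := hx x h
  simp [mem_slitPlane_iff] at this

namespace IsOrderOneLeft

theorem mem_eligible (hf : IsOrderOneLeft f) {x : ℂ} (hx : 1 < x.re) : x ∈ eligible f := by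
  intro ρ hρ
  rw [mem_slitPlane_iff]
  left
  rw [sub_re]
  linarith [hf.re_le_one ρ hρ]

/-- The base point `2` of all weights lies to the right of every zero. -/
theorem two_ne_zero (hf : IsOrderOneLeft f) : f 2 ≠ 0 :=
  ne_zero_of_mem_eligible (hf.mem_eligible (by norm_num))

theorem summable_weight (hf : IsOrderOneLeft f) {σ : ℝ} (hσ : 1 < σ) :
    Summable fun ρ : {ρ : ℂ // f ρ = 0} =>
      (analyticOrderNatAt f ρ : ℝ) * (1 + ‖(ρ : ℂ) - 2‖) ^ (-σ) :=
  summable_order_mul_rpow hf.differentiable hf.two_ne_zero hf.growth hσ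

/-- Distances from the zeros to the points of a horizontal half-line are bounded below. -/
theorem exists_separation (hf : IsOrderOneLeft f) {x : ℂ} (hx : x ∈ eligible f) :
    ∃ c : ℝ, 0 < c ∧ ∀ ρ, f ρ = 0 → ∀ y : ℝ, 0 ≤ y →
      c * (1 + ‖ρ - 2‖ + y) ≤ ‖x + y - ρ‖ := by
  -- Finitely many zeros lie within `B` of `2` and are treated one by one. For the others, `‖2 - ρ +
  -- y‖` dominates `‖ρ - 2‖`, `y` and `1`, and replacing `2` by `x` costs at most a quarter of it.
  set B := 4 * ‖x - 2‖ with hB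
  have hfin := finite_zeros_closedBall hf.differentiable hf.two_ne_zero 2 B
  have hloc : ∀ ρ : ℂ, ∃ c : ℝ, 0 < c ∧ (f ρ = 0 → ∀ y : ℝ, 0 ≤ y →
      c * (1 + ‖ρ - 2‖ + y) ≤ ‖x + y - ρ‖) := by
    intro ρ
    by_cases hρ : f ρ = 0
    swap
    · exact ⟨1, one_pos, fun h => absurd h hρ⟩
    have hw := hx ρ hρ
    set w := x - ρ with hwdef
    -- A half-line going right from a point of the slit plane keeps a positive distance from `0`.
    obtain ⟨d, hd, hdw⟩ : ∃ d : ℝ, 0 < d ∧ ∀ y : ℝ, 0 ≤ y → d ≤ ‖w + y‖ := by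
      rcases mem_slitPlane_iff.mp hw with h | h
      · refine ⟨w.re, h, fun y hy => le_trans ?_ (re_le_norm _)⟩
        simp [hy]
      · refine ⟨|w.im|, abs_pos.mpr h, fun y hy => le_trans ?_ (abs_im_le_norm _)⟩
        simp
    set K := 1 + ‖ρ - 2‖ + ‖w‖ with hK
    have hK0 : 0 < K := by positivity
    refine ⟨(K / d + 1)⁻¹, by positivity, fun _ y hy => ?_⟩
    rw [show x + y - ρ = w + y by rw [hwdef]; ring, inv_mul_le_iff₀ (by positivity)]
    have h1 : y ≤ ‖w + y‖ + ‖w‖ := by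
      calc y = ‖(w + y) - w‖ := by simp [abs_of_nonneg hy]
        _ ≤ _ := norm_sub_le _ _
    have h2 : K ≤ K / d * ‖w + y‖ := by
      rw [div_mul_eq_mul_div, le_div_iff₀ hd]
      exact mul_le_mul_of_nonneg_left (hdw y hy) hK0.le
    linarith
  choose c hc0 hc using hloc
  obtain ⟨c₀, hc₀, hc₀'⟩ : ∃ c₀ : ℝ, 0 < c₀ ∧ ∀ ρ, f ρ = 0 ∧ ‖ρ - 2‖ ≤ B → c₀ ≤ c ρ := by
    rcases hfin.toFinset.eq_empty_or_nonempty with he | hne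
    · refine ⟨1, one_pos, fun ρ hρ => ?_⟩
      have : ρ ∈ hfin.toFinset := hfin.mem_toFinset.mpr hρ
      simp [he] at this
    · obtain ⟨ρ₀, -, hmin⟩ := hfin.toFinset.exists_min_image c hne
      exact ⟨c ρ₀, hc0 ρ₀, fun ρ hρ => hmin ρ (hfin.mem_toFinset.mpr hρ)⟩
  refine ⟨min c₀ (1 / 8), by positivity, fun ρ hρ y hy => ?_⟩
  by_cases hρB : ‖ρ - 2‖ ≤ B
  · refine le_trans ?_ (hc ρ hρ y hy)
    gcongr
    exact (min_le_left _ _).trans (hc₀' ρ ⟨hρ, hρB⟩)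
  · push Not at hρB
    have hre : 1 ≤ (2 - ρ).re := by simp; linarith [hf.re_le_one ρ hρ]
    have h1 : 1 ≤ ‖ρ - 2‖ := by rw [norm_sub_rev]; exact hre.trans (re_le_norm _)
    have h2 : ‖ρ - 2‖ ≤ ‖2 - ρ + y‖ := by
      rw [norm_sub_rev, ← sq_le_sq₀ (norm_nonneg _) (norm_nonneg _), ← normSq_eq_norm_sq,
        ← normSq_eq_norm_sq, normSq_apply, normSq_apply]
      simp only [add_re, ofReal_re, add_im, ofReal_im, add_zero]
      nlinarith
    have h3 : y ≤ ‖2 - ρ + y‖ := by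
      refine le_trans ?_ (re_le_norm _)
      simp only [add_re, ofReal_re]
      linarith
    have h4 : ‖2 - ρ + y‖ ≤ ‖x + y - ρ‖ + ‖x - 2‖ := by
      calc ‖2 - ρ + y‖ = ‖(x + y - ρ) - (x - 2)‖ := by congr 1; ring
        _ ≤ _ := norm_sub_le _ _
    calc min c₀ (1 / 8) * (1 + ‖ρ - 2‖ + y) ≤ 1 / 8 * (1 + ‖ρ - 2‖ + y) := by
          gcongr; exact min_le_right _ _
      _ ≤ _ := by linarith

/-- Moving `x` by less than half of the constant costs at most half of the bound, because the weight
`1 + ‖ρ - 2‖ + y` is at least `1`. Uniformity on a ball is what openness and differentiation in `x`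
require. -/
theorem exists_separation_ball (hf : IsOrderOneLeft f) {x : ℂ} (hx : x ∈ eligible f) :
    ∃ c : ℝ, 0 < c ∧ ∀ z ∈ ball x c, ∀ ρ, f ρ = 0 → ∀ y : ℝ, 0 ≤ y →
      c * (1 + ‖ρ - 2‖ + y) ≤ ‖z + y - ρ‖ := by
  obtain ⟨c, hc, h⟩ := hf.exists_separation hx
  refine ⟨c / 2, by positivity, fun z hz ρ hρ y hy => ?_⟩
  have h1 := h ρ hρ y hy
  have h2 : ‖x - z‖ < c / 2 := by rwa [mem_ball, dist_comm, dist_eq_norm] at hz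
  have h3 : ‖x + y - ρ‖ ≤ ‖z + y - ρ‖ + ‖x - z‖ := by
    calc ‖x + y - ρ‖ = ‖(z + y - ρ) + (x - z)‖ := by congr 1; ring
      _ ≤ _ := norm_add_le _ _
  nlinarith [norm_nonneg (ρ - 2)]

theorem isOpen_eligible (hf : IsOrderOneLeft f) : IsOpen (eligible f) := by
  rw [Metric.isOpen_iff]
  intro x hx
  obtain ⟨c, hc, h⟩ := hf.exists_separation_ball hx
  refine ⟨c, hc, fun z hz ρ hρ => ?_⟩
  by_contra hcon
  rw [mem_slitPlane_iff, not_or, not_lt, not_not] at hcon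
  -- This shift would bring `z` onto `ρ`, against the lower bound along the half-line.
  have h1 := h z hz ρ hρ (-(z - ρ).re) (by linarith [hcon.1])
  have h2 : z + ((-(z - ρ).re : ℝ) : ℂ) - ρ = 0 := by
    apply Complex.ext
    · simp
    · simpa using hcon.2
  rw [h2, norm_zero] at h1
  nlinarith [norm_nonneg (ρ - 2), hcon.1]

theorem isSimplyConnected_eligible (hf : IsOrderOneLeft f) : IsSimplyConnected (eligible f) :=
  isSimplyConnected_of_add_mem (σ := 1) (fun _ hz _ ht => add_mem_eligible hz ht)
    fun _ hz => hf.mem_eligible hz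

theorem isPreconnected_eligible (hf : IsOrderOneLeft f) : IsPreconnected (eligible f) :=
  hf.isSimplyConnected_eligible.isPathConnected.isConnected.isPreconnected

/-- Terms dominated by a power larger than one of the distance to the zeros are summable. -/
theorem summable_of_norm_le (hf : IsOrderOneLeft f) {σ : ℝ} (hσ : 1 < σ) {C : ℝ}
    {u : {ρ : ℂ // f ρ = 0} → ℂ}
    (hu : ∀ ρ : {ρ : ℂ // f ρ = 0}, ‖u ρ‖ ≤ C * (1 + ‖(ρ : ℂ) - 2‖) ^ (-σ)) :
    Summable fun ρ : {ρ : ℂ // f ρ = 0} => (analyticOrderNatAt f ρ : ℂ) * u ρ := by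
  refine Summable.of_norm_bounded ((hf.summable_weight hσ).mul_left C) fun ρ => ?_
  rw [norm_mul, norm_natCast]
  calc _ ≤ (analyticOrderNatAt f ρ : ℝ) * (C * (1 + ‖(ρ : ℂ) - 2‖) ^ (-σ)) := by
        gcongr; exact hu ρ
    _ = _ := by ring

theorem norm_inv_pow_le {c r t : ℝ} {w : ℂ} (hc : 0 < c) (hr : 0 ≤ r) (ht : 0 ≤ t)
    (h : c * (1 + r + t) ≤ ‖w‖) (n : ℕ) : ‖(w ^ n)⁻¹‖ ≤ (c⁻¹) ^ n * (1 + r) ^ (-(n : ℝ)) := by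
  rw [norm_inv, norm_pow, Real.rpow_neg (by positivity), Real.rpow_natCast, ← inv_pow, ← inv_pow,
    ← mul_pow, ← mul_inv]
  gcongr
  nlinarith

theorem summable_zeroPowSum (hf : IsOrderOneLeft f) {n : ℕ} (hn : 2 ≤ n) {x : ℂ}
    (hx : x ∈ eligible f) :
    Summable fun ρ : {ρ : ℂ // f ρ = 0} => (analyticOrderNatAt f ρ : ℂ) * ((x - ρ) ^ n)⁻¹ := by
  obtain ⟨c, hc, h⟩ := hf.exists_separation hx
  refine hf.summable_of_norm_le (σ := n) (by exact_mod_cast hn) (C := (c⁻¹) ^ n) fun ρ => ?_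
  have := h ρ ρ.2 0 le_rfl
  rw [ofReal_zero, add_zero] at this
  exact norm_inv_pow_le hc (norm_nonneg _) le_rfl (by simpa using this) n

theorem hasDerivAt_inv_pow (n : ℕ) {z ρ : ℂ} (h : z - ρ ≠ 0) :
    HasDerivAt (fun w => ((w - ρ) ^ n)⁻¹) (-n * ((z - ρ) ^ (n + 1))⁻¹) z := by
  have h1 := (((hasDerivAt_id z).sub_const ρ).fun_pow n).fun_inv (pow_ne_zero n h)
  refine h1.congr_deriv ?_
  simp only [id]
  rcases n with _ | n
  · simp
  · simp only [Nat.add_sub_cancel]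
    field_simp
    ring

theorem hasDerivAt_zeroPowSum (hf : IsOrderOneLeft f) {n : ℕ} (hn : 2 ≤ n) {x : ℂ}
    (hx : x ∈ eligible f) : HasDerivAt (zeroPowSum f n) (-n * zeroPowSum f (n + 1) x) x := by
  obtain ⟨c, hc, h⟩ := hf.exists_separation_ball hx
  have hs := (hf.summable_weight (σ := (n + 1 : ℕ)) (by norm_cast; lia)).mul_left
    (n * (c⁻¹) ^ (n + 1))
  have key : ∀ z ∈ ball x c, ∀ ρ : {ρ : ℂ // f ρ = 0},
      c * (1 + ‖(ρ : ℂ) - 2‖ + 0) ≤ ‖z - ρ‖ := fun z hz ρ => by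
    simpa using h z hz ρ ρ.2 0 le_rfl
  have hne : ∀ z ∈ ball x c, ∀ ρ : {ρ : ℂ // f ρ = 0}, z - ρ ≠ 0 := fun z hz ρ h0 => by
    have := key z hz ρ
    rw [h0, norm_zero] at this
    have h2 : 0 < c * (1 + ‖(ρ : ℂ) - 2‖ + 0) := by positivity
    linarith
  have hd : ∀ (ρ : {ρ : ℂ // f ρ = 0}), ∀ z ∈ ball x c,
      HasDerivAt (fun z : ℂ => (analyticOrderNatAt f ρ : ℂ) * ((z - ρ) ^ n)⁻¹)
        ((analyticOrderNatAt f ρ : ℂ) * (-n * ((z - ρ) ^ (n + 1))⁻¹)) z :=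
    fun ρ z hz => (hasDerivAt_inv_pow n (hne z hz ρ)).const_mul _
  have hb : ∀ (ρ : {ρ : ℂ // f ρ = 0}), ∀ z ∈ ball x c,
      ‖(analyticOrderNatAt f ρ : ℂ) * (-n * ((z - ρ) ^ (n + 1))⁻¹)‖ ≤
        n * (c⁻¹) ^ (n + 1) * ((analyticOrderNatAt f ρ : ℝ) *
          (1 + ‖(ρ : ℂ) - 2‖) ^ (-((n + 1 : ℕ) : ℝ))) := by
    intro ρ z hz
    have := norm_inv_pow_le hc (norm_nonneg _) le_rfl (key z hz ρ) (n + 1)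
    rw [norm_mul, norm_mul, norm_natCast, norm_neg, norm_natCast]
    calc (analyticOrderNatAt f ρ : ℝ) * (n * ‖((z - ρ) ^ (n + 1))⁻¹‖)
        ≤ (analyticOrderNatAt f ρ : ℝ) * (n * ((c⁻¹) ^ (n + 1) *
          (1 + ‖(ρ : ℂ) - 2‖) ^ (-((n + 1 : ℕ) : ℝ)))) :=
          mul_le_mul_of_nonneg_left (mul_le_mul_of_nonneg_left this (Nat.cast_nonneg _))
            (Nat.cast_nonneg _)
      _ = _ := by ring
  have h1 : HasDerivAt (fun z : ℂ => ∑' ρ : {ρ : ℂ // f ρ = 0},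
      (analyticOrderNatAt f ρ : ℂ) * ((z - ρ) ^ n)⁻¹)
      (∑' ρ : {ρ : ℂ // f ρ = 0},
        (analyticOrderNatAt f ρ : ℂ) * (-n * ((x - ρ) ^ (n + 1))⁻¹)) x :=
    hasDerivAt_tsum_of_isPreconnected hs isOpen_ball (convex_ball x c).isPreconnected hd hb
      (mem_ball_self hc) (hf.summable_zeroPowSum hn hx) (mem_ball_self hc)
  refine h1.congr_deriv ?_
  rw [zeroPowSum, ← tsum_mul_left]
  exact tsum_congr fun ρ => by ring

theorem zetaTerm_natCast (n : ℕ) (x : ℂ) (ρ : {ρ : ℂ // f ρ = 0}) :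
    zetaTerm f n x ρ = (analyticOrderNatAt f ρ : ℂ) * ((x - ρ) ^ n)⁻¹ := by
  rw [zetaTerm, cpow_neg, cpow_natCast]

theorem norm_cpow_neg_le {w : ℂ} (hw : w ≠ 0) (s : ℂ) :
    ‖w ^ (-s)‖ ≤ Real.exp (Real.pi * |s.im|) * ‖w‖ ^ (-s.re) := by
  rw [norm_cpow_of_ne_zero hw, div_eq_mul_inv, ← Real.exp_neg, mul_comm, neg_re]
  gcongr
  rw [neg_im, mul_neg, neg_neg]
  calc arg w * s.im ≤ |arg w * s.im| := le_abs_self _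
    _ = |arg w| * |s.im| := abs_mul _ _
    _ ≤ _ := by gcongr; exact abs_arg_le_pi w

theorem summable_zetaTerm (hf : IsOrderOneLeft f) {x : ℂ} (hx : x ∈ eligible f) {s : ℂ}
    (hs : 1 < s.re) : Summable (zetaTerm f s x) := by
  obtain ⟨c, hc, h⟩ := hf.exists_separation hx
  refine hf.summable_of_norm_le hs (C := Real.exp (Real.pi * |s.im|) * c ^ (-s.re)) fun ρ => ?_
  have h1 : c * (1 + ‖(ρ : ℂ) - 2‖) ≤ ‖x - ρ‖ := by simpa using h ρ ρ.2 0 le_rfl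
  refine (norm_cpow_neg_le (slitPlane_ne_zero (hx ρ ρ.2)) s).trans ?_
  rw [mul_assoc, ← Real.mul_rpow hc.le (by positivity)]
  exact mul_le_mul_of_nonneg_left
    (Real.rpow_le_rpow_of_nonpos (by positivity) h1 (by linarith)) (Real.exp_pos _).le

theorem differentiableOn_tsum_zetaTerm (hf : IsOrderOneLeft f) {x : ℂ} (hx : x ∈ eligible f) :
    DifferentiableOn ℂ (fun s => ∑' ρ, zetaTerm f s x ρ) {s | 1 < s.re} := by
  obtain ⟨c, hc, h⟩ := hf.exists_separation hx
  intro s₀ hs₀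
  have hs₀ : 1 < s₀.re := hs₀
  set σ := (1 + s₀.re) / 2 with hσ
  have hσ1 : 1 < σ := by linarith
  set T := |s₀.im| + 1 with hT
  -- On a bounded box `exp (π |im s|)` and `c ^ (-re s)` are bounded, and the weight with exponent
  -- `σ > 1` majorizes all terms.
  set V : Set ℂ := {s | σ < s.re ∧ s.re < s₀.re + 1 ∧ |s.im| < T} with hV
  have hVo : IsOpen V := by
    refine (isOpen_lt continuous_const continuous_re).inter
      ((isOpen_lt continuous_re continuous_const).inter
        (isOpen_lt (continuous_abs.comp continuous_im) continuous_const))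
  have hsV : s₀ ∈ V := ⟨by linarith, by linarith, by linarith⟩
  set C := Real.exp (Real.pi * T) * (max 1 c⁻¹) ^ (s₀.re + 1) with hC
  have hu := (hf.summable_weight hσ1).mul_left C
  have := differentiableOn_tsum_of_summable_norm (F := fun ρ s => zetaTerm f s x ρ) hu
    (U := V) (fun ρ => by
      intro s _
      have : x - ρ ≠ 0 := slitPlane_ne_zero (hx ρ ρ.2)
      unfold zetaTerm
      exact (DifferentiableAt.const_mul ((differentiableAt_id.neg).const_cpow (Or.inl this))
        _).differentiableWithinAt) hVo
    (fun ρ s hs => by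
      have h1 : c * (1 + ‖(ρ : ℂ) - 2‖) ≤ ‖x - ρ‖ := by simpa using h ρ ρ.2 0 le_rfl
      rw [zetaTerm, norm_mul, norm_natCast, mul_left_comm]
      gcongr
      refine (norm_cpow_neg_le (slitPlane_ne_zero (hx ρ ρ.2)) s).trans ?_
      rw [hC, mul_assoc]
      have hsre : 0 < s.re := by linarith [hs.1]
      have h2 : ‖x - ρ‖ ^ (-s.re) ≤ (c * (1 + ‖(ρ : ℂ) - 2‖)) ^ (-s.re) :=
        Real.rpow_le_rpow_of_nonpos (by positivity) h1 (by linarith)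
      have h3 : c ^ (-s.re) ≤ (max 1 c⁻¹) ^ (s₀.re + 1) := by
        rw [Real.rpow_neg hc.le, ← Real.inv_rpow hc.le]
        calc c⁻¹ ^ s.re ≤ (max 1 c⁻¹) ^ s.re := by gcongr; exact le_max_right _ _
          _ ≤ _ := Real.rpow_le_rpow_of_exponent_le (le_max_left _ _) hs.2.1.le
      have h4 : (1 + ‖(ρ : ℂ) - 2‖) ^ (-s.re) ≤ (1 + ‖(ρ : ℂ) - 2‖) ^ (-σ) :=
        Real.rpow_le_rpow_of_exponent_le (by linarith [norm_nonneg ((ρ : ℂ) - 2)])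
          (by linarith [hs.1])
      rw [Real.mul_rpow hc.le (by positivity)] at h2
      have h5 : Real.exp (Real.pi * |s.im|) ≤ Real.exp (Real.pi * T) := by
        gcongr
        exact hs.2.2.le
      calc _ ≤ Real.exp (Real.pi * T) * (c ^ (-s.re) * (1 + ‖(ρ : ℂ) - 2‖) ^ (-s.re)) := by
            gcongr
        _ ≤ _ := by gcongr)
  exact ((this s₀ hsV).differentiableAt (hVo.mem_nhds hsV)).differentiableWithinAt

variable {ℓ : ℂ → ℂ}

theorem deriv_log_eq (hf : IsOrderOneLeft f) (hℓ : AnalyticOnNhd ℂ ℓ (eligible f))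
    (he : ∀ z ∈ eligible f, exp (ℓ z) = f z) {x : ℂ} (hx : x ∈ eligible f) :
    deriv ℓ x = logDeriv f x := by
  have h1 : f =ᶠ[𝓝 x] fun z => exp (ℓ z) := by
    filter_upwards [hf.isOpen_eligible.mem_nhds hx] with z hz using (he z hz).symm
  rw [logDeriv_apply, h1.deriv_eq, ((hℓ x hx).differentiableAt.hasDerivAt.cexp).deriv, ← he x hx,
    mul_div_cancel_left₀ _ (exp_ne_zero _)]

theorem iteratedDeriv_two_log (hf : IsOrderOneLeft f) (hℓ : AnalyticOnNhd ℂ ℓ (eligible f))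
    (he : ∀ z ∈ eligible f, exp (ℓ z) = f z) {x : ℂ} (hx : x ∈ eligible f) :
    iteratedDeriv 2 ℓ x = - zeroPowSum f 2 x := by
  rw [← deriv_logDeriv_eq_neg_zeroPowSum hf.differentiable hf.two_ne_zero hf.growth
    (ne_zero_of_mem_eligible hx) (hf.summable_zeroPowSum le_rfl hx), iteratedDeriv_succ,
    iteratedDeriv_one]
  refine EventuallyEq.deriv_eq ?_
  filter_upwards [hf.isOpen_eligible.mem_nhds hx] with z hz using hf.deriv_log_eq hℓ he hz

theorem iteratedDeriv_log (hf : IsOrderOneLeft f) (hℓ : AnalyticOnNhd ℂ ℓ (eligible f))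
    (he : ∀ z ∈ eligible f, exp (ℓ z) = f z) {n : ℕ} (hn : 2 ≤ n) :
    ∀ x ∈ eligible f,
      iteratedDeriv n ℓ x = (-1) ^ (n - 1) * ((n - 1).factorial : ℂ) * zeroPowSum f n x := by
  induction n, hn using Nat.le_induction with
  | base => intro x hx; rw [hf.iteratedDeriv_two_log hℓ he hx]; simp
  | succ n hn ih =>
    intro x hx
    have h1 : iteratedDeriv n ℓ =ᶠ[𝓝 x]
        fun z => (-1) ^ (n - 1) * ((n - 1).factorial : ℂ) * zeroPowSum f n z := by
      filter_upwards [hf.isOpen_eligible.mem_nhds hx] with z hz using ih z hz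
    rw [iteratedDeriv_succ, h1.deriv_eq, ((hf.hasDerivAt_zeroPowSum hn hx).const_mul _).deriv]
    obtain ⟨k, rfl⟩ : ∃ k, n = k + 1 := ⟨n - 1, by lia⟩
    simp only [Nat.add_sub_cancel, Nat.factorial_succ, pow_succ]
    push_cast
    ring

theorem tsum_zetaTerm_natCast (hf : IsOrderOneLeft f) (hℓ : AnalyticOnNhd ℂ ℓ (eligible f))
    (he : ∀ z ∈ eligible f, exp (ℓ z) = f z) {n : ℕ} (hn : 2 ≤ n) {x : ℂ}
    (hx : x ∈ eligible f) :
    ∑' ρ, zetaTerm f n x ρ = (-1) ^ (n - 1) / ((n - 1).factorial : ℂ) * iteratedDeriv n ℓ x := by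
  rw [hf.iteratedDeriv_log hℓ he hn x hx]
  simp only [zetaTerm_natCast]
  rw [← zeroPowSum]
  have : ((n - 1).factorial : ℂ) ≠ 0 := by exact_mod_cast (n - 1).factorial_ne_zero
  have h1 : ((-1 : ℂ) ^ (n - 1)) * (-1) ^ (n - 1) = 1 := by rw [← mul_pow]; simp
  rw [div_mul_eq_mul_div, eq_div_iff this]
  linear_combination (-zeroPowSum f n x * ((n - 1).factorial : ℂ)) * h1

end IsOrderOneLeft

end Eligible

/-! ### From the Stirling expansion on the real axis to expansions along horizontal lines. -/

section Strip
open Complex Set Metric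

/-- A function that decays on the real axis together with its derivatives, and whose second
derivative is bounded in a sector, decays in horizontal strips together with its derivatives. -/
theorem exists_strip_bound {r : ℂ → ℂ} (hr : AnalyticOnNhd ℂ r {z | 1 < z.re}) (M : ℕ)
    (hreal : ∀ m : ℕ, (fun x : ℝ => iteratedDeriv m r (x : ℂ)) =O[atTop] fun x : ℝ => (x ^ M)⁻¹)
    {C₀ : ℝ} (hsec : ∀ z : ℂ, 3 ≤ z.re → |z.im| ≤ 2 * (z.re - 2) → ‖iteratedDeriv 2 r z‖ ≤ C₀)
    {R : ℝ} (hR : 0 ≤ R) (m : ℕ) :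
    ∃ C T : ℝ, ∀ t : ℝ, T ≤ t → ∀ w : ℂ, ‖w‖ ≤ R → ‖iteratedDeriv m r (t + w)‖ ≤ C * (t ^ M)⁻¹ := by
  have hC₀ : 0 ≤ C₀ := (norm_nonneg _).trans (hsec 3 (by norm_num) (by norm_num))
  have hana : ∀ m, AnalyticOnNhd ℂ (iteratedDeriv m r) {z | 1 < z.re} := fun m => by
    rw [iteratedDeriv_eq_iterate]; exact hr.iterated_deriv m
  have hre : ∀ {t : ℝ} {w : ℂ}, ‖w‖ ≤ R → t - R ≤ ((t : ℂ) + w).re := by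
    intro t w hw
    rw [add_re, ofReal_re]
    have := neg_abs_le w.re
    linarith [abs_re_le_norm w]
  -- Downward induction on the order `m`: derivatives of order at least `M + 2` decay by Cauchy's
  -- estimate, and each lower order is recovered by integrating from the real point `t`, where the
  -- decay is known.
  have key : ∀ j m : ℕ, M + 2 ≤ m + j → ∃ C T : ℝ, ∀ t : ℝ, T ≤ t → ∀ w : ℂ, ‖w‖ ≤ R →
      ‖iteratedDeriv m r (t + w)‖ ≤ C * (t ^ M)⁻¹ := by
    intro j
    induction j with
    | zero =>
      intro m hm
      obtain ⟨k, rfl⟩ : ∃ k, m = k + 2 := ⟨m - 2, by lia⟩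
      have hkM : M ≤ k := by lia
      -- For `t ≥ 6R + 10` the disc of radius `t / 2` about `t + w` lies in the sector, so `k`
      -- further derivatives of the bounded second derivative gain `(2 / t)^k`.
      refine ⟨k.factorial * C₀ * 2 ^ k, 6 * R + 10, fun t ht w hw => ?_⟩
      have ht0 : 0 < t := by linarith
      have hmem : ∀ v ∈ closedBall ((t : ℂ) + w) (t / 2), 3 ≤ v.re ∧ |v.im| ≤ 2 * (v.re - 2) := by
        intro v hv
        have h1 : ‖v - (t + w)‖ ≤ t / 2 := by simpa [dist_eq_norm] using hv
        have h2 : ‖v - t‖ ≤ t / 2 + R := by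
          calc ‖v - t‖ = ‖(v - (t + w)) + w‖ := by congr 1; ring
            _ ≤ _ := (norm_add_le _ _).trans (by linarith)
        have h3 := (abs_re_le_norm (v - t)).trans h2
        have h4 := (abs_im_le_norm (v - t)).trans h2
        simp only [sub_re, ofReal_re, sub_im, ofReal_im, sub_zero] at h3 h4
        rw [abs_le] at h3
        constructor <;> linarith [h3.1]
      have h5 := norm_iteratedDeriv_le_of_forall_mem_sphere_norm_le (f := iteratedDeriv 2 r)
        (c := t + w) (R := t / 2) (C := C₀) k (by positivity)
        (DifferentiableOn.diffContOnCl (by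
          rw [closure_ball _ (by positivity)]
          intro v hv
          exact ((hana 2 v (by
            have := (hmem v hv).1
            show 1 < v.re
            linarith)).differentiableAt).differentiableWithinAt))
        (fun v hv => by
          have := hmem v (sphere_subset_closedBall hv)
          exact hsec v this.1 this.2)
      rw [iteratedDeriv_eq_iterate, iteratedDeriv_eq_iterate, ← Function.iterate_add_apply,
        ← iteratedDeriv_eq_iterate] at h5
      refine h5.trans ?_
      rw [div_pow, div_div_eq_mul_div, div_eq_mul_inv]
      gcongr
      linarith
    | succ j ih =>
      intro m hm
      obtain ⟨C, T, hCT⟩ := ih (m + 1) (by lia)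
      obtain ⟨C', hC'⟩ := (hreal m).bound
      obtain ⟨T', hT'⟩ := eventually_atTop.mp hC'
      refine ⟨C' + C * R, max (max T T') (R + 2), fun t ht w hw => ?_⟩
      have htT : T ≤ t := ((le_max_left _ _).trans (le_max_left _ _)).trans ht
      have htT' : T' ≤ t := ((le_max_right _ _).trans (le_max_left _ _)).trans ht
      have htR : R + 2 ≤ t := (le_max_right _ _).trans ht
      have ht0 : 0 < t := by linarith
      have hd := (convex_closedBall (t : ℂ) R).norm_image_sub_le_of_norm_deriv_le
        (𝕜 := ℂ) (f := iteratedDeriv m r) (C := C * (t ^ M)⁻¹) (x := t) (y := t + w)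
        (fun v hv => by
          refine (hana m v ?_).differentiableAt
          have h1 : ‖v - t‖ ≤ R := by simpa [dist_eq_norm] using hv
          have h2 := hre (t := t) h1
          rw [add_sub_cancel] at h2
          show 1 < v.re
          linarith)
        (fun v hv => by
          have h1 : ‖v - t‖ ≤ R := by simpa [dist_eq_norm] using hv
          have := hCT t htT (v - t) h1
          rwa [add_sub_cancel, iteratedDeriv_succ] at this)
        (mem_closedBall_self hR) (by simpa [dist_eq_norm] using hw)
      rw [add_sub_cancel_left] at hd
      have h3 := hT' t htT'
      rw [Real.norm_of_nonneg (by positivity : 0 ≤ (t ^ M)⁻¹)] at h3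
      have hCn : 0 ≤ C * (t ^ M)⁻¹ := (norm_nonneg _).trans (hCT t htT 0 (by simpa using hR))
      calc ‖iteratedDeriv m r (t + w)‖
          ≤ ‖iteratedDeriv m r (t + w) - iteratedDeriv m r t‖ + ‖iteratedDeriv m r t‖ := by
            simpa using norm_add_le (iteratedDeriv m r (t + w) - iteratedDeriv m r t)
              (iteratedDeriv m r t)
        _ ≤ C * (t ^ M)⁻¹ * ‖w‖ + C' * (t ^ M)⁻¹ := add_le_add hd h3
        _ ≤ C * (t ^ M)⁻¹ * R + C' * (t ^ M)⁻¹ := by gcongr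
        _ = _ := by ring
  exact key (M + 2) m (by lia)

/-- The truncated generalized Stirling expansion. -/
noncomputable def stirlingSum (α b β b₀ : ℂ) (a : ℕ → ℂ) (N : ℕ) (z : ℂ) : ℂ :=
  α * z * (log z - 1) + b * z + β * log z + b₀ + ∑ n ∈ Finset.Icc 1 N, a n * (z ^ n)⁻¹

/-- `ℓ` has a generalized Stirling expansion along the positive real axis, differentiable term by
term. -/
def HasLogExpansion (ℓ : ℂ → ℂ) (α b β b₀ : ℂ) (a : ℕ → ℂ) : Prop :=
  ∀ m N : ℕ, (fun x : ℝ => iteratedDeriv m (fun z => ℓ z - stirlingSum α b β b₀ a N z) (x : ℂ))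
    =O[atTop] fun x : ℝ => (x ^ (N + 1 + m))⁻¹

variable {α b β b₀ : ℂ} {a : ℕ → ℂ}

theorem hasDerivAt_stirlingSum (N : ℕ) {z : ℂ} (hz : z ∈ slitPlane) :
    HasDerivAt (stirlingSum α b β b₀ a N)
      (α * log z + b + β * z⁻¹ - ∑ n ∈ Finset.Icc 1 N, n * a n * (z ^ (n + 1))⁻¹) z := by
  have hz0 := slitPlane_ne_zero hz
  have h1 := ((hasDerivAt_id z).const_mul α).mul ((hasDerivAt_log hz).sub_const 1)
  have h2 := (hasDerivAt_id z).const_mul b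
  have h3 := (hasDerivAt_log hz).const_mul β
  have h4 : HasDerivAt (fun z : ℂ => ∑ n ∈ Finset.Icc 1 N, a n * (z ^ n)⁻¹)
      (∑ n ∈ Finset.Icc 1 N, a n * (-n * (z ^ (n + 1))⁻¹)) z := by
    refine HasDerivAt.fun_sum fun n _ => HasDerivAt.const_mul _ ?_
    have := IsOrderOneLeft.hasDerivAt_inv_pow n (z := z) (ρ := 0) (by simpa using hz0)
    simpa using this
  refine ((((h1.add h2).add h3).add_const b₀).add h4).congr_deriv ?_
  have h5 : ∑ n ∈ Finset.Icc 1 N, a n * (-n * (z ^ (n + 1))⁻¹) =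
      - ∑ n ∈ Finset.Icc 1 N, n * a n * (z ^ (n + 1))⁻¹ := by
    rw [← Finset.sum_neg_distrib]
    exact Finset.sum_congr rfl fun n _ => by ring
  rw [h5]
  simp only [id]
  field_simp
  ring

theorem iteratedDeriv_two_stirlingSum (N : ℕ) {z : ℂ} (hz : z ∈ slitPlane) :
    iteratedDeriv 2 (stirlingSum α b β b₀ a N) z =
      α * z⁻¹ - β * (z ^ 2)⁻¹ + ∑ n ∈ Finset.Icc 1 N, n * (n + 1) * a n * (z ^ (n + 2))⁻¹ := by
  have hz0 := slitPlane_ne_zero hz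
  have h0 : deriv (stirlingSum α b β b₀ a N) =ᶠ[𝓝 z] fun z =>
      α * log z + b + β * z⁻¹ - ∑ n ∈ Finset.Icc 1 N, n * a n * (z ^ (n + 1))⁻¹ := by
    filter_upwards [isOpen_slitPlane.mem_nhds hz] with w hw using (hasDerivAt_stirlingSum N hw).deriv
  rw [iteratedDeriv_succ, iteratedDeriv_one, h0.deriv_eq]
  have h4 : HasDerivAt (fun z : ℂ => ∑ n ∈ Finset.Icc 1 N, n * a n * (z ^ (n + 1))⁻¹)
      (∑ n ∈ Finset.Icc 1 N, n * a n * (-((n + 1 : ℕ) : ℂ) * (z ^ (n + 1 + 1))⁻¹)) z := by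
    refine HasDerivAt.fun_sum fun n _ => HasDerivAt.const_mul _ ?_
    have := IsOrderOneLeft.hasDerivAt_inv_pow (n + 1) (z := z) (ρ := 0) (by simpa using hz0)
    simpa using this
  have h1 := ((((hasDerivAt_log hz).const_mul α).add_const b).add
    ((hasDerivAt_inv hz0).const_mul β)).sub h4
  refine h1.deriv.trans ?_
  rw [sub_eq_add_neg, ← Finset.sum_neg_distrib]
  congr 1
  · ring
  · refine Finset.sum_congr rfl fun n _ => ?_
    push_cast
    ring

theorem analyticAt_stirlingSum (N : ℕ) {z : ℂ} (hz : z ∈ slitPlane) :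
    AnalyticAt ℂ (stirlingSum α b β b₀ a N) z := by
  rw [analyticAt_iff_eventually_differentiableAt]
  filter_upwards [isOpen_slitPlane.mem_nhds hz] with w hw
    using (hasDerivAt_stirlingSum N hw).differentiableAt

variable {f ℓ : ℂ → ℂ}

namespace IsOrderOneLeft

/-- With `B = 2 - ρ`, the sector condition gives `‖B‖ ≤ re B + |im B| ≤ 3 ‖z - ρ‖`, and `1 + ‖B‖ ≤ 2
‖B‖`. Hence the distance to each zero is at least a sixth of its weight, and `36 = 6²`. -/
theorem exists_norm_zeroPowSum_le (hf : IsOrderOneLeft f) :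
    ∃ C : ℝ, ∀ z : ℂ, 3 ≤ z.re → |z.im| ≤ 2 * (z.re - 2) → ‖zeroPowSum f 2 z‖ ≤ C := by
  have hs := (hf.summable_weight (σ := 2) (by norm_num)).mul_left 36
  refine ⟨_, fun z hz1 hz2 => tsum_of_norm_bounded hs.hasSum fun ρ => ?_⟩
  have hre := hf.re_le_one ρ ρ.2
  set B := 2 - (ρ : ℂ) with hB
  have hBre : 1 ≤ B.re := by simp [hB]; linarith
  have hB1 : 1 ≤ ‖B‖ := hBre.trans (re_le_norm _)
  have h1 : (z - ρ).re = z.re - 2 + B.re := by simp [hB]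
  have h2 : (z - ρ).im = z.im + B.im := by simp [hB]; ring
  have h3 := re_le_norm (z - ρ)
  have h4 := abs_im_le_norm (z - ρ)
  have h5 : |B.im| ≤ |(z - ρ).im| + |z.im| := by
    rw [h2]
    calc |B.im| = |(z.im + B.im) - z.im| := by congr 1; ring
      _ ≤ _ := abs_sub _ _
  have h6 : ‖B‖ ≤ |B.re| + |B.im| := norm_le_abs_re_add_abs_im B
  rw [abs_of_pos (by linarith)] at h6
  have h7 : ‖B‖ ≤ 3 * ‖z - ρ‖ := by linarith
  have h8 : 6⁻¹ * (1 + ‖(ρ : ℂ) - 2‖ + 0) ≤ ‖z - ρ‖ := by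
    rw [norm_sub_rev (ρ : ℂ) 2]; linarith
  have h9 := norm_inv_pow_le (by norm_num) (norm_nonneg _) le_rfl h8 2
  rw [norm_mul, norm_natCast]
  calc _ ≤ (analyticOrderNatAt f ρ : ℝ) * ((6⁻¹)⁻¹ ^ 2 * (1 + ‖(ρ : ℂ) - 2‖) ^ (-((2 : ℕ) : ℝ))) := by
        gcongr
    _ = _ := by push_cast; ring

/-- The second derivative of the remainder is bounded in the sector, being the sum over zeros up to
explicit negative powers, so `exists_strip_bound` applies. The additional decay with each derivative
is given up; it is not needed off the axis. -/
theorem isBigO_iteratedDeriv_add (hf : IsOrderOneLeft f)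
    (hℓ : AnalyticOnNhd ℂ ℓ (eligible f)) (he : ∀ z ∈ eligible f, exp (ℓ z) = f z)
    (hex : HasLogExpansion ℓ α b β b₀ a) (m N : ℕ) (x : ℂ) :
    (fun y : ℝ => iteratedDeriv m (fun z => ℓ z - stirlingSum α b β b₀ a N z) (x + y))
      =O[atTop] fun y : ℝ => (y ^ (N + 1))⁻¹ := by
  have hslit : ∀ {z : ℂ}, 1 < z.re → z ∈ slitPlane := fun h =>
    mem_slitPlane_iff.mpr (Or.inl (by linarith))
  obtain ⟨C₁, hC₁⟩ := hf.exists_norm_zeroPowSum_le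
  obtain ⟨C, T, hCT⟩ := exists_strip_bound
    (r := fun z => ℓ z - stirlingSum α b β b₀ a N z)
    (fun z hz => (hℓ z (hf.mem_eligible hz)).sub (analyticAt_stirlingSum N (hslit hz))) (N + 1)
    (fun m => (hex m N).trans (by
      refine IsBigO.of_bound 1 ?_
      filter_upwards [eventually_ge_atTop 1] with t ht
      rw [Real.norm_of_nonneg (by positivity), Real.norm_of_nonneg (by positivity), one_mul]
      exact inv_anti₀ (by positivity) (pow_le_pow_right₀ ht (by lia))))
    (C₀ := C₁ + (‖α‖ + ‖β‖ + ∑ n ∈ Finset.Icc 1 N, ‖n * (n + 1) * a n‖))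
    (fun z hz1 hz2 => by
      have hz : 1 < z.re := by linarith
      have hzn : 1 ≤ ‖z‖ := hz.le.trans (re_le_norm z)
      have hinv : ∀ k : ℕ, ‖(z ^ k)⁻¹‖ ≤ 1 := fun k => by
        rw [norm_inv, norm_pow]
        exact inv_le_one_of_one_le₀ (one_le_pow₀ hzn)
      have hsub : iteratedDeriv 2 (fun z => ℓ z - stirlingSum α b β b₀ a N z) z =
          iteratedDeriv 2 ℓ z - iteratedDeriv 2 (stirlingSum α b β b₀ a N) z :=
        iteratedDeriv_fun_sub (hℓ z (hf.mem_eligible hz)).contDiffAt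
          (analyticAt_stirlingSum N (hslit hz)).contDiffAt
      rw [hsub, hf.iteratedDeriv_two_log hℓ he (hf.mem_eligible hz),
        iteratedDeriv_two_stirlingSum N (hslit hz)]
      refine (norm_sub_le _ _).trans (add_le_add (by rw [norm_neg]; exact hC₁ z hz1 hz2) ?_)
      refine (norm_add_le _ _).trans (add_le_add ((norm_sub_le _ _).trans (add_le_add ?_ ?_))
        ((norm_sum_le _ _).trans (Finset.sum_le_sum fun n _ => ?_)))
      · have := hinv 1
        rw [pow_one] at this
        rw [norm_mul]
        exact mul_le_of_le_one_right (norm_nonneg _) this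
      all_goals
        rw [norm_mul]
        exact mul_le_of_le_one_right (norm_nonneg _) (hinv _))
    (norm_nonneg x) m
  refine IsBigO.of_bound C ?_
  filter_upwards [eventually_ge_atTop T, eventually_gt_atTop 0] with y hy hy0
  have := hCT y hy x le_rfl
  rw [add_comm x, Real.norm_of_nonneg (by positivity)]
  exact this

end IsOrderOneLeft

/-- The coefficients of the expansion of `-ℓ''` in powers of `z⁻¹`. -/
noncomputable def expCoeff (α β : ℂ) (a : ℕ → ℂ) : ℕ → ℂ
  | 0 => 0
  | 1 => -α
  | 2 => β
  | k + 3 => -(((k + 1 : ℕ) : ℂ) * ((k + 2 : ℕ) : ℂ) * a (k + 1))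

/-- The coefficients of the expansion of `-ℓ''(x + y)` in powers of `y⁻¹`. -/
noncomputable def shiftCoeff (α β : ℂ) (a : ℕ → ℂ) (x : ℂ) (n : ℕ) : ℂ :=
  ∑ p ∈ Finset.Icc 1 n, expCoeff α β a p * ((n - 1).choose (p - 1) : ℂ) * (-x) ^ (n - p)

theorem iteratedDeriv_two_stirlingSum' (N : ℕ) {z : ℂ} (hz : z ∈ slitPlane) :
    iteratedDeriv 2 (stirlingSum α b β b₀ a N) z =
      - ∑ p ∈ Finset.Icc 1 (N + 2), expCoeff α β a p * (z ^ p)⁻¹ := by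
  rw [iteratedDeriv_two_stirlingSum N hz]
  induction N with
  | zero => simp [Finset.sum_Icc_succ_top, expCoeff]; ring
  | succ N ih =>
    rw [Finset.sum_Icc_succ_top (by lia), Finset.sum_Icc_succ_top (by lia), ← add_assoc, ih]
    simp only [expCoeff]
    push_cast
    ring

/-- Expansion of `(x + y) ^ (-p)` in powers of `y⁻¹`. -/
theorem isBigO_inv_add_pow (x : ℂ) {p K : ℕ} (hp : 1 ≤ p) (hpK : p ≤ K) :
    (fun y : ℝ => (((x + y) ^ p)⁻¹ : ℂ) - ∑ n ∈ Finset.Icc p K,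
        ((n - 1).choose (p - 1) : ℂ) * (-x) ^ (n - p) * ((y : ℂ) ^ n)⁻¹)
      =O[atTop] fun y : ℝ => (y ^ (K + 1))⁻¹ := by
  -- `(x + y)^(-p) = y^(-p) (1 - u)^(-p)` with `u = -x / y → 0`, expanded by the negative binomial
  -- series.
  obtain ⟨q, rfl⟩ : ∃ q, p = q + 1 := ⟨p - 1, by lia⟩
  have h1 := ((one_div_one_sub_pow_hasFPowerSeriesOnBall_zero q).hasFPowerSeriesAt).isBigO_sub_partialSum_pow
    (K - q)
  have h2 : Tendsto (fun y : ℝ => -x * (y : ℂ)⁻¹) atTop (𝓝 0) := by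
    rw [← mul_zero (-x)]
    refine Tendsto.const_mul _ ?_
    have : Tendsto (fun y : ℝ => ((y⁻¹ : ℝ) : ℂ)) atTop (𝓝 ((0 : ℝ) : ℂ)) :=
      (continuous_ofReal.tendsto 0).comp tendsto_inv_atTop_zero
    simpa using this
  have h3 := h1.comp_tendsto h2
  have h4 : (fun y : ℝ => (((x + y) ^ (q + 1))⁻¹ : ℂ) - ∑ n ∈ Finset.Icc (q + 1) K,
        ((n - 1).choose (q + 1 - 1) : ℂ) * (-x) ^ (n - (q + 1)) * ((y : ℂ) ^ n)⁻¹) =ᶠ[atTop]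
      fun y : ℝ => ((y : ℂ) ^ (q + 1))⁻¹ * (((fun y : ℂ => 1 / (1 - (0 + y)) ^ (q + 1) -
        (FormalMultilinearSeries.ofScalars ℂ (𝕜 := ℂ)
          fun n ↦ ((Nat.choose (q + n) q : ℕ) : ℂ)).partialSum (K - q) y) ∘
            fun y : ℝ => -x * (y : ℂ)⁻¹) y) := by
    filter_upwards [eventually_gt_atTop 0] with y hy
    have hy0 : (y : ℂ) ≠ 0 := ofReal_ne_zero.mpr hy.ne'
    simp only [Function.comp, FormalMultilinearSeries.partialSum, mul_sub, Finset.mul_sum]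
    congr 1
    · rw [zero_add, one_div, ← mul_inv, ← mul_pow]
      congr 2
      field_simp
      ring
    · rw [Finset.range_eq_Ico, ← Finset.Ico_succ_right_eq_Icc, Finset.sum_Ico_eq_sum_range,
        ← Finset.range_eq_Ico]
      refine Finset.sum_congr (by simp) fun i _ => ?_
      simp only [FormalMultilinearSeries.ofScalars_apply_eq, smul_eq_mul]
      rw [show q + 1 + i - 1 = q + i by lia, show q + 1 + i - (q + 1) = i by lia,
        Nat.add_sub_cancel, mul_pow, pow_add, mul_inv, inv_pow]
      ring
  refine h4.trans_isBigO ?_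
  have h5 : (fun y : ℝ => ((y : ℂ) ^ (q + 1))⁻¹) =O[atTop] fun y : ℝ => (y ^ (q + 1))⁻¹ := by
    refine IsBigO.of_bound 1 (Eventually.of_forall fun y => ?_)
    simp
  have h6 : ((fun y : ℂ => ‖y‖ ^ (K - q)) ∘ fun y : ℝ => -x * (y : ℂ)⁻¹) =O[atTop]
      fun y : ℝ => (y ^ (K - q))⁻¹ := by
    refine IsBigO.of_bound (‖x‖ ^ (K - q)) (Eventually.of_forall fun y => ?_)
    simp [mul_pow]
  refine (h5.mul (h3.trans h6)).congr_right fun y => ?_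
  rw [← mul_inv, ← pow_add]
  congr 2
  lia

namespace IsOrderOneLeft

/-- The expansion of `∑ (x + y - ρ) ^ (-2)` as `y → +∞`. -/
theorem isBigO_zeroPowSum_sub (hf : IsOrderOneLeft f)
    (hℓ : AnalyticOnNhd ℂ ℓ (eligible f)) (he : ∀ z ∈ eligible f, exp (ℓ z) = f z)
    (hex : HasLogExpansion ℓ α b β b₀ a) (x : ℂ) (K : ℕ) :
    (fun y : ℝ => zeroPowSum f 2 (x + y) -
        ∑ n ∈ Finset.Icc 1 K, shiftCoeff α β a x n * ((y : ℂ) ^ n)⁻¹)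
      =O[atTop] fun y : ℝ => (y ^ (K + 1))⁻¹ := by
  have hle : ∀ {m n : ℕ}, m ≤ n →
      (fun y : ℝ => (y ^ n)⁻¹) =O[atTop] fun y : ℝ => (y ^ m)⁻¹ := by
    intro m n hmn
    refine IsBigO.of_bound 1 ?_
    filter_upwards [eventually_ge_atTop 1] with t ht
    rw [Real.norm_of_nonneg (by positivity), Real.norm_of_nonneg (by positivity), one_mul]
    exact inv_anti₀ (by positivity) (pow_le_pow_right₀ ht hmn)
  -- Two derivatives of the sum truncated at `K` reach the power `K + 2`, so the re-expanded terms
  -- of index `K + 1` and `K + 2` are moved into the error.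
  have h1 := hf.isBigO_iteratedDeriv_add hℓ he hex 2 K x
  have h2 : (fun y : ℝ => ∑ p ∈ Finset.Icc 1 (K + 2), expCoeff α β a p *
      ((((x + y) ^ p)⁻¹ : ℂ) - ∑ n ∈ Finset.Icc p (K + 2),
        ((n - 1).choose (p - 1) : ℂ) * (-x) ^ (n - p) * ((y : ℂ) ^ n)⁻¹))
      =O[atTop] fun y : ℝ => (y ^ (K + 1))⁻¹ := by
    refine IsBigO.fun_sum fun p hp => IsBigO.const_mul_left ?_ _
    rw [Finset.mem_Icc] at hp
    exact (isBigO_inv_add_pow x hp.1 hp.2).trans (hle (by lia))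
  have h3 : ∀ n, K + 1 ≤ n → (fun y : ℝ => shiftCoeff α β a x n * ((y : ℂ) ^ n)⁻¹)
      =O[atTop] fun y : ℝ => (y ^ (K + 1))⁻¹ := by
    intro n hn
    refine IsBigO.const_mul_left (IsBigO.trans ?_ (hle hn)) _
    exact IsBigO.of_bound 1 (Eventually.of_forall fun y => by simp)
  refine ((h2.sub h1).add ((h3 (K + 1) le_rfl).add (h3 (K + 2) (by lia)))).congr' ?_
    EventuallyEq.rfl
  filter_upwards [eventually_gt_atTop (1 - x.re)] with y hy
  have hre : 1 < (x + y).re := by rw [add_re, ofReal_re]; linarith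
  have hslit : x + y ∈ slitPlane := mem_slitPlane_iff.mpr (Or.inl (by linarith))
  have hsub : iteratedDeriv 2 (fun z => ℓ z - stirlingSum α b β b₀ a K z) (x + y) =
      iteratedDeriv 2 ℓ (x + y) - iteratedDeriv 2 (stirlingSum α b β b₀ a K) (x + y) :=
    iteratedDeriv_fun_sub (hℓ _ (hf.mem_eligible hre)).contDiffAt
      (analyticAt_stirlingSum K hslit).contDiffAt
  have hswap : ∑ p ∈ Finset.Icc 1 (K + 2), expCoeff α β a p *
      ∑ n ∈ Finset.Icc p (K + 2),
        ((n - 1).choose (p - 1) : ℂ) * (-x) ^ (n - p) * ((y : ℂ) ^ n)⁻¹ =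
      ∑ n ∈ Finset.Icc 1 (K + 2), shiftCoeff α β a x n * ((y : ℂ) ^ n)⁻¹ := by
    simp only [shiftCoeff, Finset.sum_mul, Finset.mul_sum]
    rw [Finset.sum_comm' (t' := Finset.Icc 1 (K + 2)) (s' := fun n => Finset.Icc 1 n)]
    · exact Finset.sum_congr rfl fun n _ => Finset.sum_congr rfl fun p _ => by ring
    · intro p n
      simp only [Finset.mem_Icc]
      lia
  rw [hsub, hf.iteratedDeriv_two_log hℓ he (hf.mem_eligible hre),
    iteratedDeriv_two_stirlingSum' K hslit]
  simp only [mul_sub, Finset.sum_sub_distrib]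
  have hsplit : ∑ n ∈ Finset.Icc 1 (K + 2), shiftCoeff α β a x n * ((y : ℂ) ^ n)⁻¹ =
      ∑ n ∈ Finset.Icc 1 K, shiftCoeff α β a x n * ((y : ℂ) ^ n)⁻¹ +
        shiftCoeff α β a x (K + 1) * ((y : ℂ) ^ (K + 1))⁻¹ +
        shiftCoeff α β a x (K + 2) * ((y : ℂ) ^ (K + 2))⁻¹ := by
    rw [Finset.sum_Icc_succ_top (by lia), Finset.sum_Icc_succ_top (by lia)]
  rw [hswap, hsplit]
  ring

end IsOrderOneLeft
end Strip

/-! ### The Mellin transform of an inverse square. -/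

section MellinPower
open Complex Set Metric MeasureTheory

theorem integrableOn_rpow_mul_one_add_rpow {u p : ℝ} (hu : 0 < u) (hup : u < p) :
    IntegrableOn (fun y : ℝ => y ^ (u - 1) * (1 + y) ^ (-p)) (Ioi 0) := by
  have hc : ContinuousOn (fun y : ℝ => (1 + y) ^ (-p)) (Ici 0) := by
    refine ContinuousOn.rpow_const (by fun_prop) fun y hy => Or.inl ?_
    have : (0 : ℝ) ≤ y := hy
    positivity
  refine mellin_convergent_of_isBigO_scalar (a := p) (b := 0)
    ((hc.mono Ioi_subset_Ici_self).locallyIntegrableOn measurableSet_Ioi) ?_ hup ?_ hu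
  · refine IsBigO.of_bound 1 ?_
    filter_upwards [eventually_gt_atTop 0] with y hy
    rw [Real.norm_of_nonneg (by positivity), Real.norm_of_nonneg (by positivity), one_mul]
    exact Real.rpow_le_rpow_of_nonpos hy (by linarith) (by linarith)
  · refine IsBigO.of_bound 1 ?_
    filter_upwards [self_mem_nhdsWithin] with y hy
    have hy : (0 : ℝ) < y := hy
    rw [Real.norm_of_nonneg (by positivity), neg_zero, Real.rpow_zero, norm_one, one_mul]
    exact Real.rpow_le_one_of_one_le_of_nonpos (by linarith) (by linarith)

/-- The substitution `y = u / (1 - u)` turns the integral into the Beta integral `B(2 - s, s)`, and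
`Γ(2) = 1`. -/
theorem mellin_inv_one_add_sq {s : ℂ} (h0 : 0 < s.re) (h2 : s.re < 2) :
    mellin (fun y : ℝ => (((y : ℂ) + 1) ^ 2)⁻¹) (2 - s) = Gamma (2 - s) * Gamma s := by
  have hΓ := Gamma_mul_Gamma_eq_betaIntegral (s := 2 - s) (t := s) (by simp; linarith) h0
  rw [sub_add_cancel, show Gamma 2 = 1 by simp, one_mul] at hΓ
  rw [hΓ, betaIntegral, intervalIntegral.integral_of_le zero_le_one, integral_Ioc_eq_integral_Ioo,
    mellin]
  have himg : (fun u : ℝ => u / (1 - u)) '' Ioo 0 1 = Ioi 0 := by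
    ext y
    constructor
    · rintro ⟨u, ⟨hu0, hu1⟩, rfl⟩
      exact div_pos hu0 (by linarith)
    · intro hy
      have hy : (0 : ℝ) < y := hy
      refine ⟨y / (1 + y), ⟨by positivity, ?_⟩, ?_⟩
      · rw [div_lt_one (by positivity)]; linarith
      · field_simp
        ring
  have hder : ∀ u ∈ Ioo (0 : ℝ) 1,
      HasDerivWithinAt (fun u : ℝ => u / (1 - u)) (((1 - u) ^ 2)⁻¹) (Ioo 0 1) u := by
    intro u hu
    have h1 : (1 - u) ≠ 0 := by linarith [hu.2]
    have := ((hasDerivAt_id u).fun_div ((hasDerivAt_id u).const_sub 1) h1)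
    refine (this.congr_deriv ?_).hasDerivWithinAt
    simp only [id]
    field_simp
    ring
  have hinj : InjOn (fun u : ℝ => u / (1 - u)) (Ioo 0 1) := by
    intro u hu v hv huv
    have h1 : (1 - u) ≠ 0 := by linarith [hu.2]
    have h2 : (1 - v) ≠ 0 := by linarith [hv.2]
    have : u * (1 - v) = v * (1 - u) := (div_eq_div_iff h1 h2).mp huv
    linarith
  rw [← himg, integral_image_eq_integral_abs_deriv_smul measurableSet_Ioo hder hinj]
  refine setIntegral_congr_fun measurableSet_Ioo fun u hu => ?_
  have h1 : 0 < 1 - u := by linarith [hu.2]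
  have h1c : (1 - (u : ℂ)) ≠ 0 := by
    have : ((1 - u : ℝ) : ℂ) ≠ 0 := ofReal_ne_zero.mpr h1.ne'
    simpa using this
  have e1 : ((u / (1 - u) : ℝ) : ℂ) + 1 = (1 - (u : ℂ))⁻¹ := by
    push_cast
    field_simp
    ring
  have e2 : ((u / (1 - u) : ℝ) : ℂ) ^ (2 - s - 1) =
      (u : ℂ) ^ (2 - s - 1) * (1 - (u : ℂ)) ^ (s - 1) := by
    rw [div_eq_mul_inv, ofReal_mul, mul_cpow_ofReal_nonneg hu.1.le (by positivity), ofReal_inv,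
      inv_cpow_eq_ite, if_neg, ← cpow_neg, ofReal_sub, ofReal_one]
    · congr 2; ring
    · rw [arg_ofReal_of_nonneg h1.le]; exact Real.pi_ne_zero.symm
  simp only [e1, e2]
  rw [abs_of_pos (by positivity), real_smul, smul_eq_mul]
  push_cast
  field_simp

theorem exists_slitPlane_separation {w : ℂ} (hw : w ∈ slitPlane) :
    ∃ c : ℝ, 0 < c ∧ ∀ z ∈ ball w c, ∀ y : ℝ, 0 ≤ y → c * (1 + y) ≤ ‖z + y‖ := by
  obtain ⟨d, hd, hdw⟩ : ∃ d : ℝ, 0 < d ∧ ∀ y : ℝ, 0 ≤ y → d ≤ ‖w + y‖ := by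
    rcases mem_slitPlane_iff.mp hw with h | h
    · refine ⟨w.re, h, fun y hy => le_trans ?_ (re_le_norm _)⟩
      simp [hy]
    · refine ⟨|w.im|, abs_pos.mpr h, fun y hy => le_trans ?_ (abs_im_le_norm _)⟩
      simp
  set K := 1 + ‖w‖ with hK
  have hK0 : 0 < K := by positivity
  have key : ∀ y : ℝ, 0 ≤ y → (K / d + 1)⁻¹ * (1 + y) ≤ ‖w + y‖ := by
    intro y hy
    rw [inv_mul_le_iff₀ (by positivity)]
    have h1 : y ≤ ‖w + y‖ + ‖w‖ := by
      calc y = ‖(w + y) - w‖ := by simp [abs_of_nonneg hy]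
        _ ≤ _ := norm_sub_le _ _
    have h2 : K ≤ K / d * ‖w + y‖ := by
      rw [div_mul_eq_mul_div, le_div_iff₀ hd]
      exact mul_le_mul_of_nonneg_left (hdw y hy) hK0.le
    linarith
  set c := (K / d + 1)⁻¹ with hc
  have hc0 : 0 < c := by positivity
  refine ⟨c / 2, by positivity, fun z hz y hy => ?_⟩
  have h2 : ‖w - z‖ < c / 2 := by rwa [mem_ball, dist_comm, dist_eq_norm] at hz
  have h3 : ‖w + y‖ ≤ ‖z + y‖ + ‖w - z‖ := by
    calc ‖w + y‖ = ‖(z + y) + (w - z)‖ := by congr 1; ring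
      _ ≤ _ := norm_add_le _ _
  nlinarith [key y hy]

theorem continuousOn_cpow_smul {g : ℝ → ℂ} (hg : ContinuousOn g (Ioi 0)) (s : ℂ) :
    ContinuousOn (fun y : ℝ => (y : ℂ) ^ s • g y) (Ioi 0) := by
  have h1 : ContinuousOn (fun y : ℝ => (y : ℂ) ^ s) (Ioi 0) := fun y hy =>
    (continuousAt_ofReal_cpow_const y s (Or.inr (ne_of_gt hy))).continuousWithinAt
  exact h1.smul hg

/-- Holomorphy in `w`, by differentiation under the integral, prepares the passage from positive `w`
to the slit plane. -/
theorem differentiableAt_mellin_inv_add_sq {s : ℂ} (h0 : 0 < s.re) (h2 : s.re < 2) {w : ℂ}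
    (hw : w ∈ slitPlane) :
    DifferentiableAt ℂ (fun w : ℂ => mellin (fun y : ℝ => (((y : ℂ) + w) ^ 2)⁻¹) (2 - s)) w := by
  obtain ⟨c, hc, h⟩ := exists_slitPlane_separation hw
  have hb : ∀ z ∈ ball w c, ∀ y ∈ Ioi (0 : ℝ), c * (1 + 0 + y) ≤ ‖(y : ℂ) + z‖ := by
    intro z hz y hy
    rw [add_comm (y : ℂ), add_zero]
    exact h z hz y (le_of_lt hy)
  have hne : ∀ z ∈ ball w c, ∀ y ∈ Ioi (0 : ℝ), (y : ℂ) + z ≠ 0 := by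
    intro z hz y hy h0
    have h1 := hb z hz y hy
    have hy : (0 : ℝ) < y := hy
    rw [h0, norm_zero] at h1
    have : 0 < c * (1 + 0 + y) := by positivity
    linarith
  have hcont : ∀ (n : ℕ), ∀ z ∈ ball w c,
      ContinuousOn (fun y : ℝ => (((y : ℂ) + z) ^ n)⁻¹) (Ioi 0) := by
    intro n z hz
    exact ContinuousOn.inv₀ (by fun_prop) fun y hy => pow_ne_zero _ (hne z hz y hy)
  have hint := integrableOn_rpow_mul_one_add_rpow (u := 2 - s.re) (p := 2) (by linarith)
    (by linarith)
  have hnorm : ∀ n : ℕ, 2 ≤ n → ∀ z ∈ ball w c, ∀ y ∈ Ioi (0 : ℝ),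
      ‖(y : ℂ) ^ (2 - s - 1) * (((y : ℂ) + z) ^ n)⁻¹‖ ≤
        c⁻¹ ^ n * (y ^ (2 - s.re - 1) * (1 + y) ^ (-2 : ℝ)) := by
    intro n hn z hz y hy
    have hy0 : (0 : ℝ) < y := hy
    have h1 := IsOrderOneLeft.norm_inv_pow_le hc hy0.le le_rfl
      (by simpa using hb z hz y hy) n
    rw [norm_mul, norm_cpow_eq_rpow_re_of_pos hy0]
    have h3 : (1 + y) ^ (-(n : ℝ)) ≤ (1 + y) ^ (-2 : ℝ) :=
      Real.rpow_le_rpow_of_exponent_le (by linarith) (by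
        have : (2 : ℝ) ≤ n := by exact_mod_cast hn
        linarith)
    simp only [sub_re, re_ofNat, one_re]
    calc _ ≤ y ^ (2 - s.re - 1) * (c⁻¹ ^ n * (1 + y) ^ (-2 : ℝ)) := by
          gcongr
          exact h1.trans (by gcongr)
      _ = _ := by ring
  have hmeas : ∀ n : ℕ, ∀ z ∈ ball w c, AEStronglyMeasurable
      (fun y : ℝ => (y : ℂ) ^ (2 - s - 1) * (((y : ℂ) + z) ^ n)⁻¹)
      (volume.restrict (Ioi 0)) := fun n z hz =>
    (continuousOn_cpow_smul (hcont n z hz) _).aestronglyMeasurable measurableSet_Ioi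
  have hw' := mem_ball_self (x := w) hc
  have := hasDerivAt_integral_of_dominated_loc_of_deriv_le (μ := volume.restrict (Ioi (0 : ℝ)))
    (F := fun z y => (y : ℂ) ^ (2 - s - 1) * (((y : ℂ) + z) ^ 2)⁻¹)
    (F' := fun z y => (y : ℂ) ^ (2 - s - 1) * (-2 * (((y : ℂ) + z) ^ 3)⁻¹))
    (x₀ := w) (s := ball w c)
    (bound := fun y => 2 * (c⁻¹ ^ 3 * (y ^ (2 - s.re - 1) * (1 + y) ^ (-2 : ℝ))))
    (ball_mem_nhds w hc)
    (by filter_upwards [ball_mem_nhds w hc] with z hz using hmeas 2 z hz)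
    ((hint.const_mul (c⁻¹ ^ 2)).mono' (hmeas 2 w hw')
      ((ae_restrict_iff' measurableSet_Ioi).mpr (Eventually.of_forall fun y hy =>
        hnorm 2 le_rfl w hw' y hy)))
    (by
      refine ((hmeas 3 w hw').const_mul (-2)).congr (Eventually.of_forall fun y => ?_)
      simp only
      ring)
    ((ae_restrict_iff' measurableSet_Ioi).mpr (Eventually.of_forall fun y hy z hz => by
      rw [mul_left_comm, norm_mul, norm_neg, Complex.norm_ofNat]
      gcongr
      exact hnorm 3 (by norm_num) z hz y hy))
    ((hint.const_mul _).const_mul _)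
    ((ae_restrict_iff' measurableSet_Ioi).mpr (Eventually.of_forall fun y hy z hz => by
      refine HasDerivAt.const_mul _ ?_
      have h1 := IsOrderOneLeft.hasDerivAt_inv_pow 2 (z := z) (ρ := -(y : ℂ))
        (by rw [sub_neg_eq_add, add_comm]; exact hne z hz y hy)
      simp only [sub_neg_eq_add] at h1
      simp only [add_comm (y : ℂ)]
      exact_mod_cast h1))
  exact this.2.differentiableAt

/-- For positive `w` this is the case `w = 1` after scaling `y`. Both sides are holomorphic on the
connected slit plane, so the identity theorem at the accumulation point `1` of positive reals gives
the rest, with the principal power. -/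
theorem mellin_inv_add_sq {s : ℂ} (h0 : 0 < s.re) (h2 : s.re < 2) {w : ℂ} (hw : w ∈ slitPlane) :
    mellin (fun y : ℝ => (((y : ℂ) + w) ^ 2)⁻¹) (2 - s) = Gamma (2 - s) * Gamma s * w ^ (-s) := by
  have hpos : ∀ t : ℝ, 0 < t → mellin (fun y : ℝ => (((y : ℂ) + t) ^ 2)⁻¹) (2 - s) =
      Gamma (2 - s) * Gamma s * (t : ℂ) ^ (-s) := by
    intro t ht
    have ht0 : (t : ℂ) ≠ 0 := ofReal_ne_zero.mpr ht.ne'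
    have h1 := mellin_comp_mul_left (fun y : ℝ => (((y : ℂ) + t) ^ 2)⁻¹) (2 - s) ht
    have h3 : (fun y : ℝ => ((((t * y : ℝ) : ℂ) + t) ^ 2)⁻¹) =
        fun y : ℝ => ((t : ℂ) ^ 2)⁻¹ • (((y : ℂ) + 1) ^ 2)⁻¹ := by
      ext y
      rw [smul_eq_mul, ← mul_inv, ← mul_pow]
      congr 2
      push_cast
      ring
    rw [h3, mellin_const_smul, mellin_inv_one_add_sq h0 h2, smul_eq_mul, smul_eq_mul] at h1
    have h4 : (t : ℂ) ^ (-(2 - s)) = ((t : ℂ) ^ 2)⁻¹ * ((t : ℂ) ^ (-s))⁻¹ := by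
      rw [neg_sub, cpow_sub _ _ ht0, cpow_neg, inv_inv, cpow_ofNat, div_eq_inv_mul]
    rw [h4] at h1
    have h5 : (t : ℂ) ^ (-s) ≠ 0 := by simp [cpow_eq_zero_iff, ht0]
    have h6 : (t : ℂ) ^ 2 ≠ 0 := pow_ne_zero _ ht0
    generalize mellin (fun y : ℝ => (((y : ℂ) + t) ^ 2)⁻¹) (2 - s) = J at h1 ⊢
    field_simp at h1
    rw [← h1]
  have hconn : IsPreconnected slitPlane :=
    starConvex_one_slitPlane.isPathConnected one_mem_slitPlane |>.isConnected.isPreconnected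
  have hA : AnalyticOnNhd ℂ
      (fun w : ℂ => mellin (fun y : ℝ => (((y : ℂ) + w) ^ 2)⁻¹) (2 - s)) slitPlane :=
    DifferentiableOn.analyticOnNhd (fun z hz =>
      (differentiableAt_mellin_inv_add_sq h0 h2 hz).differentiableWithinAt) isOpen_slitPlane
  have hB : AnalyticOnNhd ℂ (fun w : ℂ => Gamma (2 - s) * Gamma s * w ^ (-s)) slitPlane :=
    DifferentiableOn.analyticOnNhd (fun z hz => (DifferentiableAt.const_mul
      (differentiableAt_id.cpow_const hz) _).differentiableWithinAt) isOpen_slitPlane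
  refine hA.eqOn_of_preconnected_of_frequently_eq hB hconn one_mem_slitPlane ?_ hw
  have htend : Tendsto (fun t : ℝ => (t : ℂ)) (𝓝[>] 1) (𝓝[≠] 1) := by
    refine tendsto_nhdsWithin_iff.mpr ⟨?_, ?_⟩
    · have := (continuous_ofReal.tendsto 1).mono_left (nhdsWithin_le_nhds (s := Ioi 1))
      simpa using this
    · filter_upwards [self_mem_nhdsWithin] with t ht
      have ht : (1 : ℝ) < t := ht
      simpa using ht.ne'
  refine htend.frequently (Eventually.frequently ?_)
  filter_upwards [self_mem_nhdsWithin] with t ht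
  exact hpos t (lt_trans one_pos ht)

theorem Gamma_two_sub_mul_Gamma {s : ℂ} (h1 : 1 < s.re) (h2 : s.re < 2) :
    sin (Real.pi * s) * (Gamma (2 - s) * Gamma s) = Real.pi * (1 - s) := by
  have hs1 : 1 - s ≠ 0 := by
    intro h
    have := congrArg re h
    simp at this
    linarith
  have hsin : sin (Real.pi * s) ≠ 0 := by
    intro h
    obtain ⟨k, hk⟩ := sin_eq_zero_iff.mp h
    have hpi : (Real.pi : ℂ) ≠ 0 := ofReal_ne_zero.mpr Real.pi_ne_zero
    have hsk : s = k := by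
      apply mul_left_cancel₀ hpi
      rw [hk]; ring
    rw [hsk, intCast_re] at h1 h2
    have h1' : (1 : ℤ) < k := by exact_mod_cast h1
    have h2' : k < (2 : ℤ) := by exact_mod_cast h2
    lia
  rw [show (2 : ℂ) - s = (1 - s) + 1 by ring, Gamma_add_one _ hs1]
  have h3 := Gamma_mul_Gamma_one_sub s
  rw [eq_div_iff hsin] at h3
  linear_combination (1 - s) * h3

end MellinPower

/-! ### Meromorphic continuation of the Mellin transform. -/

section Continuation
open Complex Set Metric MeasureTheory

namespace IsOrderOneLeft

variable {f : ℂ → ℂ}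

theorem countable_zeros (hf : IsOrderOneLeft f) : Countable {ρ : ℂ // f ρ = 0} := by
  have h : {ρ : ℂ | f ρ = 0} = ⋃ n : ℕ, {ρ : ℂ | f ρ = 0 ∧ ‖ρ - 2‖ ≤ n} := by
    ext ρ
    simp only [mem_ofPred_eq, mem_iUnion, exists_and_left]
    exact ⟨fun h => ⟨h, exists_nat_ge _⟩, fun h => h.1⟩
  have h2 : {ρ : ℂ | f ρ = 0}.Countable := by
    rw [h]
    exact countable_iUnion fun n =>
      (finite_zeros_closedBall hf.differentiable hf.two_ne_zero 2 n).countable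
  exact h2.to_subtype

theorem continuousOn_zeroPowSum_add (hf : IsOrderOneLeft f) {x : ℂ} (hx : x ∈ eligible f) :
    ContinuousOn (fun y : ℝ => zeroPowSum f 2 (x + y)) (Ici 0) := by
  intro y hy
  have h1 := (hf.hasDerivAt_zeroPowSum le_rfl (add_mem_eligible hx hy)).continuousAt
  have h2 : ContinuousAt (fun y : ℝ => x + (y : ℂ)) y := by fun_prop
  exact (ContinuousAt.comp (f := fun y : ℝ => x + (y : ℂ)) h1 h2).continuousWithinAt

/-- The Mellin transform of `y ↦ ∑ (x + y - ρ) ^ (-2)`. -/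
theorem mellin_zeroPowSum (hf : IsOrderOneLeft f) {x : ℂ} (hx : x ∈ eligible f) {s : ℂ}
    (h1 : 1 < s.re) (h2 : s.re < 2) :
    mellin (fun y : ℝ => zeroPowSum f 2 (x + y)) (2 - s) =
      Gamma (2 - s) * Gamma s * ∑' ρ, zetaTerm f s x ρ := by
  have := hf.countable_zeros
  obtain ⟨c, hc, h⟩ := hf.exists_separation hx
  -- The exponent `2` is split as `σ + (2 - σ)` with `1 < σ < re s`: the first part makes the sum
  -- over zeros converge, the second the integral at infinity. This justifies exchanging the two.
  set σ := (1 + s.re) / 2 with hσ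
  have hσ1 : 1 < σ := by linarith
  have hint := integrableOn_rpow_mul_one_add_rpow (u := 2 - s.re) (p := 2 - σ) (by linarith)
    (by linarith)
  set F : {ρ : ℂ // f ρ = 0} → ℝ → ℂ := fun ρ y =>
    (y : ℂ) ^ (2 - s - 1) * ((analyticOrderNatAt f ρ : ℂ) * ((x + y - ρ) ^ 2)⁻¹) with hF
  have hbound : ∀ ρ : {ρ : ℂ // f ρ = 0}, ∀ y ∈ Ioi (0 : ℝ), ‖F ρ y‖ ≤
      (c⁻¹ ^ 2 * ((analyticOrderNatAt f ρ : ℝ) * (1 + ‖(ρ : ℂ) - 2‖) ^ (-σ))) *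
        (y ^ (2 - s.re - 1) * (1 + y) ^ (-(2 - σ))) := by
    intro ρ y hy
    have hy0 : (0 : ℝ) < y := hy
    set r := ‖(ρ : ℂ) - 2‖ with hr
    have hr0 : 0 ≤ r := norm_nonneg _
    have h3 : ‖((x + y - ρ) ^ 2)⁻¹‖ ≤ c⁻¹ ^ 2 * ((1 + r) ^ (-σ) * (1 + y) ^ (-(2 - σ))) := by
      have h4 := h ρ ρ.2 y hy0.le
      rw [norm_inv, norm_pow, inv_pow, ← hr] at *
      rw [Real.rpow_neg (by positivity), Real.rpow_neg (by positivity), ← mul_inv, ← mul_inv]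
      refine inv_anti₀ (by positivity) ?_
      calc c ^ 2 * ((1 + r) ^ σ * (1 + y) ^ (2 - σ))
          ≤ c ^ 2 * ((1 + r + y) ^ σ * (1 + r + y) ^ (2 - σ)) := by
            have h5 : (1 + r) ^ σ ≤ (1 + r + y) ^ σ :=
              Real.rpow_le_rpow (by positivity) (by linarith) (by linarith)
            have h6 : (1 + y) ^ (2 - σ) ≤ (1 + r + y) ^ (2 - σ) :=
              Real.rpow_le_rpow (by positivity) (by linarith) (by linarith)
            gcongr
        _ = (c * (1 + r + y)) ^ 2 := by
            rw [← Real.rpow_add (by positivity), add_sub_cancel, Real.rpow_two, mul_pow]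
        _ ≤ _ := by gcongr
    rw [hF]
    simp only
    rw [norm_mul, norm_mul, Complex.norm_natCast, norm_cpow_eq_rpow_re_of_pos hy0]
    simp only [sub_re, re_ofNat, one_re]
    calc _ ≤ y ^ (2 - s.re - 1) * ((analyticOrderNatAt f ρ : ℝ) *
          (c⁻¹ ^ 2 * ((1 + r) ^ (-σ) * (1 + y) ^ (-(2 - σ))))) := by gcongr
      _ = _ := by ring
  have hcont : ∀ ρ : {ρ : ℂ // f ρ = 0}, AEStronglyMeasurable (F ρ) (volume.restrict (Ioi 0)) := by
    intro ρ
    refine (continuousOn_cpow_smul (g := fun y : ℝ =>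
      (analyticOrderNatAt f ρ : ℂ) * ((x + y - ρ) ^ 2)⁻¹) ?_ _).aestronglyMeasurable
      measurableSet_Ioi
    refine continuousOn_const.mul (ContinuousOn.inv₀ (by fun_prop) fun y hy => pow_ne_zero _ ?_)
    exact slitPlane_ne_zero (add_mem_eligible hx (le_of_lt hy) ρ ρ.2)
  have hae : ∀ ρ : {ρ : ℂ // f ρ = 0}, ∀ᵐ y ∂(volume.restrict (Ioi (0 : ℝ))), ‖F ρ y‖ ≤
      (c⁻¹ ^ 2 * ((analyticOrderNatAt f ρ : ℝ) * (1 + ‖(ρ : ℂ) - 2‖) ^ (-σ))) *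
        (y ^ (2 - s.re - 1) * (1 + y) ^ (-(2 - σ))) := fun ρ =>
    (ae_restrict_iff' measurableSet_Ioi).mpr (Eventually.of_forall (hbound ρ))
  have hFint : ∀ ρ, Integrable (F ρ) (volume.restrict (Ioi 0)) := fun ρ =>
    (hint.const_mul _).mono' (hcont ρ) (hae ρ)
  have hsum : Summable fun ρ => ∫ y in Ioi (0 : ℝ), ‖F ρ y‖ := by
    refine Summable.of_nonneg_of_le (fun ρ => integral_nonneg fun y => norm_nonneg _)
      (fun ρ => integral_mono_ae (hFint ρ).norm (hint.const_mul _) (hae ρ)) ?_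
    simp only [integral_const_mul]
    exact ((hf.summable_weight hσ1).mul_left _).mul_right _
  have hhs := hasSum_integral_of_summable_integral_norm hFint hsum
  have e1 : ∫ y in Ioi (0 : ℝ), ∑' ρ, F ρ y =
      mellin (fun y : ℝ => zeroPowSum f 2 (x + y)) (2 - s) := by
    simp only [mellin, hF, tsum_mul_left, zeroPowSum, smul_eq_mul]
  rw [← e1, ← hhs.tsum_eq, ← tsum_mul_left]
  refine tsum_congr fun ρ => ?_
  have e2 := mellin_inv_add_sq (s := s) (by linarith) h2 (hx ρ ρ.2)
  rw [zetaTerm, mul_left_comm, ← e2, mellin, ← integral_const_mul]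
  refine integral_congr_ae (Eventually.of_forall fun y => ?_)
  simp only [hF, smul_eq_mul]
  rw [show (y : ℂ) + (x - ρ) = x + y - ρ by ring]
  ring

end IsOrderOneLeft

/-- The entire function `sin (π u) / u`. -/
noncomputable def sinQuot : ℂ → ℂ := dslope (fun u => sin (Real.pi * u)) 0

theorem differentiable_sinQuot : Differentiable ℂ sinQuot := by
  have h : DifferentiableOn ℂ (fun u : ℂ => sin (Real.pi * u)) univ := by fun_prop
  exact differentiableOn_univ.mp ((differentiableOn_dslope univ_mem).mpr h)

theorem mul_sinQuot (u : ℂ) : u * sinQuot u = sin (Real.pi * u) := by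
  have := sub_smul_dslope (fun u : ℂ => sin (Real.pi * u)) 0 u
  simpa [sinQuot] using this

theorem sinQuot_zero : sinQuot 0 = Real.pi := by
  have h : HasDerivAt (fun u : ℂ => sin (Real.pi * u)) Real.pi 0 := by
    have := ((hasDerivAt_id (0 : ℂ)).const_mul (Real.pi : ℂ)).csin
    simpa using this
  rw [sinQuot, dslope_same, h.deriv]

theorem sinQuot_neg (u : ℂ) : sinQuot (-u) = sinQuot u := by
  by_cases hu : u = 0
  · simp [hu]
  have h1 := mul_sinQuot (-u)
  rw [mul_neg, sin_neg, ← mul_sinQuot u] at h1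
  apply mul_left_cancel₀ hu
  linear_combination -h1

theorem deriv_sinQuot_zero : deriv sinQuot 0 = 0 := by
  have h1 : deriv (fun u => sinQuot (-u)) 0 = -deriv sinQuot (-0) := deriv_comp_neg _ _
  have h2 : (fun u => sinQuot (-u)) = sinQuot := funext sinQuot_neg
  rw [h2, neg_zero] at h1
  linear_combination h1 / 2

theorem sinQuot_intCast {k : ℤ} (hk : k ≠ 0) : sinQuot k = 0 := by
  have h := mul_sinQuot k
  rw [mul_comm (Real.pi : ℂ), sin_int_mul_pi] at h
  exact (mul_eq_zero.mp h).resolve_left (by exact_mod_cast hk)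

/-- The factor of `c j` in the continuation of the Mellin transform. -/
noncomputable def poleFactor (j : ℕ) (s : ℂ) : ℂ := (-1) ^ j * sinQuot (s + j - 2)

theorem differentiable_poleFactor (j : ℕ) : Differentiable ℂ (poleFactor j) := by
  have := differentiable_sinQuot
  unfold poleFactor
  fun_prop

/-- Periodicity of the sine: `poleFactor j` is `sin (π s) / (s + j - 2)` with the removable
singularity at `s = 2 - j` filled. -/
theorem mul_poleFactor (j : ℕ) (s : ℂ) : (s + j - 2) * poleFactor j s = sin (Real.pi * s) := by
  rw [poleFactor, mul_left_comm, mul_sinQuot,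
    show (Real.pi : ℂ) * (s + j - 2) = Real.pi * s + j * Real.pi - 2 * Real.pi by ring,
    sin_sub_two_pi, sin_antiperiodic.add_nat_mul_eq j, ← mul_assoc, ← mul_pow]
  simp

/-- `φ` minus the first terms of its expansion at `+∞`, cut off at `1`. -/
noncomputable def cutRemainder (φ : ℝ → ℂ) (c : ℕ → ℂ) (K : ℕ) (y : ℝ) : ℂ :=
  φ y - ∑ j ∈ Finset.Icc 1 K, c j * (Ioi (1 : ℝ)).indicator (fun y : ℝ => ((y : ℂ) ^ j)⁻¹) y

/-- The continuation of `s ↦ sin (π s) * mellin φ (2 - s)` to `1 - K < re s`. -/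
noncomputable def mellinCont (φ : ℝ → ℂ) (c : ℕ → ℂ) (K : ℕ) (s : ℂ) : ℂ :=
  sin (Real.pi * s) * mellin (cutRemainder φ c K) (2 - s)
    + ∑ j ∈ Finset.Icc 1 K, c j * poleFactor j s

variable {φ : ℝ → ℂ} {c : ℕ → ℂ}

theorem locallyIntegrableOn_cutRemainder (hφ : ContinuousOn φ (Ici 0)) (K : ℕ) :
    LocallyIntegrableOn (cutRemainder φ c K) (Ioi 0) := by
  have h0 : LocallyIntegrableOn φ (Ioi 0) :=
    (hφ.mono Ioi_subset_Ici_self).locallyIntegrableOn measurableSet_Ioi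
  have h1 : ∀ j : ℕ, LocallyIntegrableOn
      (fun y => c j * (Ioi (1 : ℝ)).indicator (fun y : ℝ => ((y : ℂ) ^ j)⁻¹) y) (Ioi 0) := by
    intro j
    have h2 : LocallyIntegrableOn (fun y : ℝ => c j * ((y : ℂ) ^ j)⁻¹) (Ioi 0) := by
      refine ContinuousOn.locallyIntegrableOn ?_ measurableSet_Ioi
      refine continuousOn_const.mul (ContinuousOn.inv₀ (by fun_prop) fun y hy => pow_ne_zero _ ?_)
      exact ofReal_ne_zero.mpr (ne_of_gt hy)
    intro y hy
    obtain ⟨t, ht, hti⟩ := h2 y hy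
    refine ⟨t, ht, ?_⟩
    have h3 := hti.indicator (measurableSet_Ioi (a := (1 : ℝ)))
    refine h3.congr (Eventually.of_forall fun y => ?_)
    by_cases hy : y ∈ Ioi (1 : ℝ) <;> simp [indicator, hy]
  have h2 : LocallyIntegrableOn (fun y => ∑ j ∈ Finset.Icc 1 K,
      c j * (Ioi (1 : ℝ)).indicator (fun y : ℝ => ((y : ℂ) ^ j)⁻¹) y) (Ioi 0) := by
    classical
    induction Finset.Icc 1 K using Finset.induction_on with
    | empty => simp only [Finset.sum_empty]; exact locallyIntegrableOn_const 0
    | insert j s hj ih =>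
      simp only [Finset.sum_insert hj]
      exact (h1 j).add ih
  exact h0.sub h2

theorem cutRemainder_of_le (K : ℕ) {y : ℝ} (hy : y ≤ 1) : cutRemainder φ c K y = φ y := by
  rw [cutRemainder, Finset.sum_eq_zero, sub_zero]
  intro j _
  rw [indicator_of_notMem (by simpa using hy), mul_zero]

theorem cutRemainder_of_lt (K : ℕ) {y : ℝ} (hy : 1 < y) :
    cutRemainder φ c K y = φ y - ∑ j ∈ Finset.Icc 1 K, c j * ((y : ℂ) ^ j)⁻¹ := by
  rw [cutRemainder]
  congr 1
  refine Finset.sum_congr rfl fun j _ => ?_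
  rw [indicator_of_mem (by simpa using hy)]

theorem isBigO_cutRemainder_zero (hφ : ContinuousOn φ (Ici 0)) (K : ℕ) :
    cutRemainder φ c K =O[𝓝[>] 0] fun y : ℝ => y ^ (-(0 : ℝ)) := by
  have h1 : Tendsto φ (𝓝[>] 0) (𝓝 (φ 0)) :=
    (hφ 0 self_mem_Ici).tendsto.mono_left (nhdsWithin_mono _ Ioi_subset_Ici_self)
  have h2 : φ =O[𝓝[>] 0] fun _ : ℝ => (1 : ℝ) := h1.isBigO_one ℝ
  refine h2.congr' ?_ (Eventually.of_forall fun y => by simp)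
  filter_upwards [Ioo_mem_nhdsGT (zero_lt_one' ℝ)] with y hy using (cutRemainder_of_le K hy.2.le).symm

theorem isBigO_cutRemainder_atTop {K : ℕ}
    (hc : (fun y : ℝ => φ y - ∑ j ∈ Finset.Icc 1 K, c j * ((y : ℂ) ^ j)⁻¹)
      =O[atTop] fun y : ℝ => (y ^ (K + 1))⁻¹) :
    cutRemainder φ c K =O[atTop] fun y : ℝ => y ^ (-((K : ℝ) + 1)) := by
  refine hc.congr' ?_ ?_
  · filter_upwards [eventually_gt_atTop 1] with y hy using (cutRemainder_of_lt K hy).symm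
  · filter_upwards [eventually_gt_atTop 0] with y hy
    rw [Real.rpow_neg hy.le, ← Nat.cast_succ, Real.rpow_natCast]

/-- The cut remainder is bounded near `0` and `O(y^(-K-1))` at infinity, so its transform at `2 - s`
converges for `0 < re (2 - s) < K + 1`. -/
theorem mellinConvergent_cutRemainder (hφ : ContinuousOn φ (Ici 0)) {K : ℕ}
    (hc : (fun y : ℝ => φ y - ∑ j ∈ Finset.Icc 1 K, c j * ((y : ℂ) ^ j)⁻¹)
      =O[atTop] fun y : ℝ => (y ^ (K + 1))⁻¹) {s : ℂ} (h1 : 1 - K < s.re) (h2 : s.re < 2) :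
    MellinConvergent (cutRemainder φ c K) (2 - s) :=
  mellinConvergent_of_isBigO_rpow (locallyIntegrableOn_cutRemainder hφ K)
    (isBigO_cutRemainder_atTop hc) (by simp; linarith) (isBigO_cutRemainder_zero hφ K)
    (by simp; linarith)

theorem differentiableAt_mellin_cutRemainder (hφ : ContinuousOn φ (Ici 0)) {K : ℕ}
    (hc : (fun y : ℝ => φ y - ∑ j ∈ Finset.Icc 1 K, c j * ((y : ℂ) ^ j)⁻¹)
      =O[atTop] fun y : ℝ => (y ^ (K + 1))⁻¹) {s : ℂ} (h1 : 1 - K < s.re) (h2 : s.re < 2) :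
    DifferentiableAt ℂ (fun s => mellin (cutRemainder φ c K) (2 - s)) s := by
  have := mellin_differentiableAt_of_isBigO_rpow (s := 2 - s)
    (locallyIntegrableOn_cutRemainder hφ K)
    (isBigO_cutRemainder_atTop hc) (by simp; linarith) (isBigO_cutRemainder_zero hφ K)
    (by simp; linarith)
  exact DifferentiableAt.comp (g := mellin (cutRemainder φ c K)) (f := fun s => 2 - s) s this
    (by fun_prop)

theorem differentiableAt_mellinCont (hφ : ContinuousOn φ (Ici 0)) {K : ℕ}
    (hc : (fun y : ℝ => φ y - ∑ j ∈ Finset.Icc 1 K, c j * ((y : ℂ) ^ j)⁻¹)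
      =O[atTop] fun y : ℝ => (y ^ (K + 1))⁻¹) {s : ℂ} (h1 : 1 - K < s.re) (h2 : s.re < 2) :
    DifferentiableAt ℂ (mellinCont φ c K) s := by
  have h3 := differentiableAt_mellin_cutRemainder hφ hc h1 h2
  have h4 : DifferentiableAt ℂ (fun s => ∑ j ∈ Finset.Icc 1 K, c j * poleFactor j s) s :=
    DifferentiableAt.fun_sum fun j _ => (differentiable_poleFactor j s).const_mul _
  have h5 : DifferentiableAt ℂ (fun s : ℂ => sin (Real.pi * s)) s := by fun_prop
  exact (h5.mul h3).add h4

/-- The tail of `y^(-j)` beyond `1` is what produces the pole at `s = 2 - j`. -/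
theorem hasMellin_indicator_Ioi {s : ℂ} {j : ℕ} (h : 2 - j < s.re) :
    HasMellin ((Ioi (1 : ℝ)).indicator fun y : ℝ => ((y : ℂ) ^ j)⁻¹) (2 - s)
      (1 / (s + j - 2)) := by
  have hre : (1 - s - j).re < -1 := by simp; linarith
  have h1 := integrableOn_Ioi_cpow_of_lt hre one_pos
  have h2 := integral_Ioi_cpow_of_lt hre one_pos
  have hfun : ∀ y : ℝ, (y : ℂ) ^ (2 - s - 1) •
      (Ioi (1 : ℝ)).indicator (fun y : ℝ => ((y : ℂ) ^ j)⁻¹) y =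
      (Ioi (1 : ℝ)).indicator (fun y : ℝ => (y : ℂ) ^ (1 - s - j)) y := by
    intro y
    by_cases hy : y ∈ Ioi (1 : ℝ)
    · have hy0 : (y : ℂ) ≠ 0 := ofReal_ne_zero.mpr (by have : (1 : ℝ) < y := hy; linarith)
      rw [indicator_of_mem hy, indicator_of_mem hy, show (2 : ℂ) - s - 1 = 1 - s by ring,
        cpow_sub (1 - s) j hy0, cpow_natCast, smul_eq_mul, div_eq_mul_inv]
    · rw [indicator_of_notMem hy, indicator_of_notMem hy, smul_zero]
  have hsub : Ioi (1 : ℝ) ⊆ Ioi 0 := Ioi_subset_Ioi zero_le_one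
  refine ⟨?_, ?_⟩
  · rw [MellinConvergent]
    simp only [hfun]
    exact ((integrable_indicator_iff measurableSet_Ioi).mpr h1).integrableOn
  · rw [mellin]
    simp only [hfun]
    rw [setIntegral_indicator measurableSet_Ioi, inter_eq_self_of_subset_right hsub, h2]
    rw [ofReal_one, one_cpow]
    rw [← neg_div_neg_eq]
    congr 1
    · ring
    · ring

/-- In the strip the removed tails with `j ≥ 1` have convergent transforms and can be added back;
times the sine, each gives `c j * poleFactor j s`. -/
theorem mellinCont_eq (hφ : ContinuousOn φ (Ici 0))
    (hc : ∀ K, (fun y : ℝ => φ y - ∑ j ∈ Finset.Icc 1 K, c j * ((y : ℂ) ^ j)⁻¹)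
      =O[atTop] fun y : ℝ => (y ^ (K + 1))⁻¹) (K : ℕ) {s : ℂ} (h1 : 1 < s.re) (h2 : s.re < 2) :
    mellinCont φ c K s = sin (Real.pi * s) * mellin φ (2 - s) := by
  have hj : ∀ j : ℕ, 1 ≤ j → (2 : ℝ) - j < s.re := fun j hj => by
    have : (1 : ℝ) ≤ j := by exact_mod_cast hj
    linarith
  have hcK := mellinConvergent_cutRemainder hφ (hc K) (s := s)
    (by have : (0 : ℝ) ≤ K := Nat.cast_nonneg K; linarith) h2
  have hsum : HasMellin (fun y => ∑ j ∈ Finset.Icc 1 K,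
      c j * (Ioi (1 : ℝ)).indicator (fun y : ℝ => ((y : ℂ) ^ j)⁻¹) y) (2 - s)
      (∑ j ∈ Finset.Icc 1 K, c j * (1 / (s + j - 2))) := by
    have hi : ∀ j ∈ Finset.Icc 1 K, IntegrableOn (fun y : ℝ => (y : ℂ) ^ (2 - s - 1) •
        (c j * (Ioi (1 : ℝ)).indicator (fun y : ℝ => ((y : ℂ) ^ j)⁻¹) y)) (Ioi 0) := fun j hjm =>
      (hasMellin_indicator_Ioi (hj j (Finset.mem_Icc.mp hjm).1)).1.const_smul (c j)
    constructor
    · simp only [MellinConvergent, Finset.smul_sum]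
      exact integrable_finsetSum _ hi
    · simp only [mellin, Finset.smul_sum]
      rw [integral_finsetSum _ hi]
      refine Finset.sum_congr rfl fun j hjm => ?_
      rw [← (hasMellin_indicator_Ioi (hj j (Finset.mem_Icc.mp hjm).1)).2, ← smul_eq_mul,
        ← mellin_const_smul]
      rfl
  have h3 := (hasMellin_add hcK hsum.1).2
  have h4 : (fun y => cutRemainder φ c K y + ∑ j ∈ Finset.Icc 1 K,
      c j * (Ioi (1 : ℝ)).indicator (fun y : ℝ => ((y : ℂ) ^ j)⁻¹) y) = φ := by
    ext y; rw [cutRemainder]; ring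
  rw [h4, hsum.2] at h3
  rw [h3, mul_add, mellinCont, Finset.mul_sum]
  congr 1
  refine Finset.sum_congr rfl fun j hjm => ?_
  have hne : s + j - 2 ≠ 0 := by
    intro h0
    have := congrArg re h0
    simp at this
    linarith [hj j (Finset.mem_Icc.mp hjm).1]
  rw [← mul_poleFactor j s]
  field_simp

/-- Functions on overlapping vertical strips that agree on a common strip patch to an entire
function. -/
theorem exists_entire_of_strips {g₀ : ℂ → ℂ} {g : ℕ → ℂ → ℂ}
    (h₀ : DifferentiableOn ℂ g₀ {s | 1 < s.re})
    (hg : ∀ K : ℕ, ∀ s : ℂ, 1 - K < s.re → s.re < 2 → DifferentiableAt ℂ (g K) s)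
    (heq : ∀ K : ℕ, ∀ s : ℂ, 1 < s.re → s.re < 2 → g K s = g₀ s) :
    ∃ H : ℂ → ℂ, Differentiable ℂ H ∧ (∀ s : ℂ, 1 < s.re → H s = g₀ s) ∧
      ∀ K : ℕ, ∀ s : ℂ, 1 - K < s.re → s.re < 2 → H s = g K s := by
  have hopen : ∀ a : ℝ, IsOpen {s : ℂ | a < s.re ∧ s.re < 2} := fun a =>
    (isOpen_lt continuous_const continuous_re).inter (isOpen_lt continuous_re continuous_const)
  have hmono : ∀ K K' : ℕ, K ≤ K' → ∀ s : ℂ, 1 - K < s.re → s.re < 2 → g K s = g K' s := by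
    intro K K' hKK' s hs1 hs2
    have hKK'' : (K : ℝ) ≤ K' := by exact_mod_cast hKK'
    have hK0 : (0 : ℝ) ≤ K := Nat.cast_nonneg K
    have hA : AnalyticOnNhd ℂ (g K) {s : ℂ | 1 - (K : ℝ) < s.re ∧ s.re < 2} :=
      DifferentiableOn.analyticOnNhd
        (fun z hz => (hg K z hz.1 hz.2).differentiableWithinAt) (hopen _)
    have hB : AnalyticOnNhd ℂ (g K') {s : ℂ | 1 - (K : ℝ) < s.re ∧ s.re < 2} :=
      DifferentiableOn.analyticOnNhd (fun z hz =>
        (hg K' z (by linarith [hz.1]) hz.2).differentiableWithinAt) (hopen _)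
    have hconn : IsPreconnected {s : ℂ | 1 - (K : ℝ) < s.re ∧ s.re < 2} :=
      ((convex_halfSpace_re_gt _).inter (convex_halfSpace_re_lt _)).isPreconnected
    refine hA.eqOn_of_preconnected_of_eventuallyEq hB hconn (z₀ := ((3 / 2 : ℝ) : ℂ)) ?_ ?_
      (show s ∈ _ from ⟨hs1, hs2⟩)
    · constructor
      · rw [ofReal_re]; linarith
      · rw [ofReal_re]; norm_num
    · filter_upwards [(hopen 1).mem_nhds (show ((3 / 2 : ℝ) : ℂ) ∈ _ by
        constructor <;> rw [ofReal_re] <;> norm_num)] with z hz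
      rw [heq K z hz.1 hz.2, heq K' z hz.1 hz.2]
  have hall : ∀ K K' : ℕ, ∀ s : ℂ, 1 - K < s.re → 1 - K' < s.re → s.re < 2 → g K s = g K' s := by
    intro K K' s h1 h2 h3
    rcases le_total K K' with h | h
    · exact hmono K K' h s h1 h3
    · exact (hmono K' K h s h2 h3).symm
  classical
  -- The index of a strip that reaches as far left as `s`; by the identity theorem the choice does
  -- not matter.
  set κ : ℂ → ℕ := fun s => ⌈1 - s.re⌉₊ + 1 with hκ
  have hκs : ∀ s : ℂ, 1 - (κ s : ℝ) < s.re := by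
    intro s
    have := Nat.le_ceil (1 - s.re)
    simp only [hκ]
    push_cast
    linarith
  set H : ℂ → ℂ := fun s => if 1 < s.re then g₀ s else g (κ s) s with hH
  have hH0 : ∀ s : ℂ, 1 < s.re → H s = g₀ s := fun s hs => by simp only [hH, if_pos hs]
  have hHK : ∀ K : ℕ, ∀ s : ℂ, 1 - K < s.re → s.re < 2 → H s = g K s := by
    intro K s h1 h2
    by_cases hs : 1 < s.re
    · rw [hH0 s hs, heq K s hs h2]
    · simp only [hH, if_neg hs]
      exact hall _ _ s (hκs s) h1 h2
  refine ⟨H, fun s => ?_, hH0, hHK⟩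
  by_cases hs : 1 < s.re
  · have ho : IsOpen {s : ℂ | 1 < s.re} := isOpen_lt continuous_const continuous_re
    refine ((h₀ s hs).differentiableAt (ho.mem_nhds hs)).congr_of_eventuallyEq ?_
    filter_upwards [ho.mem_nhds hs] with z hz using hH0 z hz
  · have h2 : s.re < 2 := by linarith
    refine (hg (κ s) s (hκs s) h2).congr_of_eventuallyEq ?_
    filter_upwards [(hopen (1 - κ s)).mem_nhds (show s ∈ _ from ⟨hκs s, h2⟩)] with z hz
      using hHK _ z hz.1 hz.2

end Continuation

/-! ### Expansion coefficients as polynomials, and the regularized integrals at `s = 1` and `s = 0`.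
-/

section Values
open Complex Set Metric MeasureTheory

variable {α b β b₀ : ℂ} {a : ℕ → ℂ} {f ℓ : ℂ → ℂ}

theorem shiftCoeff_one (x : ℂ) : shiftCoeff α β a x 1 = -α := by
  simp [shiftCoeff, expCoeff]

theorem shiftCoeff_two (x : ℂ) : shiftCoeff α β a x 2 = α * x + β := by
  simp [shiftCoeff, expCoeff, Finset.sum_Icc_succ_top]

theorem sum_Icc_one_eq_sum_range (h : ℕ → ℂ) (m : ℕ) :
    ∑ p ∈ Finset.Icc 1 m, h p = ∑ i ∈ Finset.range m, h (i + 1) := by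
  induction m with
  | zero => simp
  | succ m ih => rw [Finset.sum_Icc_succ_top (by lia), Finset.sum_range_succ, ih]

/-- The coefficients match by two absorption steps: `(i + 1)(i + 2) C(n + 1, i + 2) = (n + 1) n C(n
- 1, i)`. The indices `1` and `2` of `expCoeff` give the two leading monomials. -/
theorem shiftCoeff_eq_shadowPoly (x : ℂ) (n : ℕ) :
    (-1) ^ n * shiftCoeff α β a x (n + 2) / (n + 1) = -shadowPoly α β a n x := by
  have hn : (n : ℂ) + 1 ≠ 0 := by exact_mod_cast n.succ_ne_zero
  rw [div_eq_iff hn, shiftCoeff, shadowPoly, sum_Icc_one_eq_sum_range, sum_Icc_one_eq_sum_range,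
    Finset.sum_range_succ', Finset.sum_range_succ']
  have hsum : (-1) ^ n * ∑ i ∈ Finset.range n, expCoeff α β a (i + 1 + 1 + 1) *
      ((n + 2 - 1).choose (i + 1 + 1 + 1 - 1) : ℂ) * (-x) ^ (n + 2 - (i + 1 + 1 + 1)) =
      -((n : ℂ) + 1) * ((n : ℂ) * ∑ i ∈ Finset.range n,
        (-1 : ℂ) ^ (i + 1) * ((n - 1).choose (i + 1 - 1) : ℂ) * a (i + 1) * x ^ (n - (i + 1))) := by
    rw [Finset.mul_sum, Finset.mul_sum, Finset.mul_sum]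
    refine Finset.sum_congr rfl fun i hi => ?_
    obtain ⟨t, rfl⟩ : ∃ t, n = i + 1 + t := ⟨n - (i + 1), by have := Finset.mem_range.mp hi; lia⟩
    have h1 := Nat.add_one_mul_choose_eq (i + 1 + t) (i + 1)
    have h2 := Nat.add_one_mul_choose_eq (i + t) i
    have h1' : ((i : ℂ) + 1 + t + 1) * ((i + 1 + t).choose (i + 1) : ℂ) =
        ((i + t + 2).choose (i + 2) : ℂ) * (i + 2) := by
      rw [show i + t + 2 = (i + 1 + t).succ by lia, show i + 2 = (i + 1).succ by lia]
      have : (((i + 1 + t).succ * (i + 1 + t).choose (i + 1) : ℕ) : ℂ) =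
        (((i + 1 + t).succ.choose (i + 1).succ * (i + 1).succ : ℕ) : ℂ) := by rw [h1]
      push_cast at this ⊢
      linear_combination this
    have h2' : ((i : ℂ) + t + 1) * ((i + t).choose i : ℂ) =
        ((i + 1 + t).choose (i + 1) : ℂ) * (i + 1) := by
      rw [show i + 1 + t = (i + t).succ by lia]
      have : (((i + t).succ * (i + t).choose i : ℕ) : ℂ) =
        (((i + t).succ.choose i.succ * i.succ : ℕ) : ℂ) := by rw [h2]
      push_cast at this ⊢
      linear_combination this
    rw [show i + 1 + t + 2 - 1 = i + t + 2 by lia, show i + 1 + 1 + 1 - 1 = i + 2 by lia,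
      show i + 1 + t + 2 - (i + 1 + 1 + 1) = t by lia, show i + 1 + t - 1 = i + t by lia,
      show i + 1 - 1 = i by lia, show i + 1 + t - (i + 1) = t by lia,
      show i + 1 + 1 + 1 = i + 3 by lia, neg_pow x t]
    simp only [expCoeff]
    have h3 : (-1 : ℂ) ^ t * (-1) ^ t = 1 := by rw [← mul_pow]; simp
    push_cast
    rw [pow_add (-1 : ℂ) (i + 1) t]
    linear_combination (-(-1 : ℂ) ^ (i + 1) * (i + 1) * (i + 2) * a (i + 1) * x ^ t *
      ((i + t + 2).choose (i + 2) : ℂ)) * h3 + (-1 : ℂ) ^ (i + 1) * (i + 1) * a (i + 1) * x ^ t * h1'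
      + (-1 : ℂ) ^ (i + 1) * a (i + 1) * x ^ t * ((i : ℂ) + 1 + t + 1) * h2'
  rw [mul_add, mul_add, hsum]
  simp only [expCoeff, show n + 2 - 1 = n + 1 by lia,
    show n + 2 - (0 + 1 + 1) = n by lia, zero_add, Nat.sub_self, Nat.choose_zero_right,
    show 1 + 1 - 1 = 1 by lia, Nat.choose_one_right, neg_pow x (n + 1), neg_pow x n]
  have h3 : (-1 : ℂ) ^ n * (-1) ^ n = 1 := by rw [← mul_pow]; simp
  push_cast
  field_simp
  rw [pow_succ]
  linear_combination (β * (n + 1) * x ^ n + α * x ^ (n + 1)) * h3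

/-- Evaluation of an integral over `(0, ∞)` from which a divergent part is removed beyond `1`. -/
theorem integral_Ioi_of_cut {g u v Φ Λ : ℝ → ℂ} {m : ℂ} (hg : IntegrableOn g (Ioi 0))
    (hΦ : ∀ y, 0 ≤ y → HasDerivAt Φ (u y) y) (hΛ : ∀ y, 1 ≤ y → HasDerivAt Λ (v y) y)
    (h1 : ∀ y, y ≤ 1 → g y = u y) (h2 : ∀ y, 1 < y → g y = u y - v y)
    (hu : ContinuousOn u (Icc 0 1)) (hm : Tendsto (fun y => Φ y - Λ y) atTop (𝓝 m)) :
    ∫ y in Ioi (0 : ℝ), g y = m - Φ 0 + Λ 1 := by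
  have hg2 : IntegrableOn g (Ioi 1) := hg.mono_set (Ioi_subset_Ioi zero_le_one)
  have hg1 : IntegrableOn g (Ioc 0 1) := hg.mono_set Ioc_subset_Ioi_self
  rw [← Ioc_union_Ioi_eq_Ioi (zero_le_one' ℝ),
    setIntegral_union (Set.Ioc_disjoint_Ioi le_rfl) measurableSet_Ioi hg1 hg2]
  have e1 : ∫ y in Ioc (0 : ℝ) 1, g y = Φ 1 - Φ 0 := by
    rw [← intervalIntegral.integral_eq_sub_of_hasDerivAt (f := Φ) (f' := u) (a := 0) (b := 1)
      (fun y hy => hΦ y (by rw [uIcc_of_le zero_le_one] at hy; exact hy.1))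
      ((by rw [uIcc_of_le zero_le_one]; exact hu : ContinuousOn u (uIcc 0 1)).intervalIntegrable),
      intervalIntegral.integral_of_le zero_le_one]
    exact setIntegral_congr_fun measurableSet_Ioc fun y hy => h1 y hy.2
  have e2 : ∫ y in Ioi (1 : ℝ), g y = m - (Φ 1 - Λ 1) := by
    have h3 : EqOn g (fun y => u y - v y) (Ioi 1) := fun y hy => h2 y hy
    rw [setIntegral_congr_fun measurableSet_Ioi h3]
    exact integral_Ioi_of_hasDerivAt_of_tendsto' (f := fun y => Φ y - Λ y)
      (fun y hy => (hΦ y (zero_le_one.trans hy)).sub (hΛ y hy))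
      ((integrableOn_congr_fun h3 measurableSet_Ioi).mp hg2) hm
  rw [e1, e2]
  ring

theorem tendsto_ofReal_div_add (x : ℂ) :
    Tendsto (fun t : ℝ => (t : ℂ) / (x + t)) atTop (𝓝 1) := by
  have h1 : Tendsto (fun t : ℝ => 1 / (x * ((t⁻¹ : ℝ) : ℂ) + 1)) atTop
      (𝓝 (1 / (x * ((0 : ℝ) : ℂ) + 1))) := by
    refine Tendsto.div tendsto_const_nhds ?_ (by simp)
    exact ((((continuous_ofReal.tendsto 0).comp tendsto_inv_atTop_zero).const_mul x).add_const 1)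
  simp only [ofReal_zero, mul_zero, zero_add, div_one] at h1
  refine h1.congr' ?_
  filter_upwards [eventually_gt_atTop 0] with t ht
  have : (t : ℂ) ≠ 0 := ofReal_ne_zero.mpr ht.ne'
  push_cast
  field_simp

theorem tendsto_inv_add (x : ℂ) : Tendsto (fun t : ℝ => (x + t : ℂ)⁻¹) atTop (𝓝 0) := by
  have h1 : Tendsto (fun t : ℝ => ((t⁻¹ : ℝ) : ℂ)) atTop (𝓝 ((0 : ℝ) : ℂ)) :=
    (continuous_ofReal.tendsto 0).comp tendsto_inv_atTop_zero
  have h2 := h1.mul (tendsto_ofReal_div_add x)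
  rw [ofReal_zero, zero_mul] at h2
  refine h2.congr' ?_
  filter_upwards [eventually_gt_atTop 0] with t ht
  have : (t : ℂ) ≠ 0 := ofReal_ne_zero.mpr ht.ne'
  push_cast
  field_simp

theorem tendsto_log_add_sub_log (x : ℂ) :
    Tendsto (fun t : ℝ => log (x + t) - (Real.log t : ℂ)) atTop (𝓝 0) := by
  have h1 : Tendsto (fun t : ℝ => x * ((t⁻¹ : ℝ) : ℂ) + 1) atTop (𝓝 (x * ((0 : ℝ) : ℂ) + 1)) :=
    (((continuous_ofReal.tendsto 0).comp tendsto_inv_atTop_zero).const_mul x).add_const 1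
  simp only [ofReal_zero, mul_zero, zero_add] at h1
  have h2 := (continuousAt_clog one_mem_slitPlane).tendsto.comp h1
  rw [log_one] at h2
  refine h2.congr' ?_
  filter_upwards [eventually_gt_atTop ‖x‖] with t ht
  have ht0 : 0 < t := (norm_nonneg x).trans_lt ht
  have htc : (t : ℂ) ≠ 0 := ofReal_ne_zero.mpr ht0.ne'
  have hne : x * ((t⁻¹ : ℝ) : ℂ) + 1 ≠ 0 := by
    intro h0
    have h3 : x + t = 0 := by
      have : (x * ((t⁻¹ : ℝ) : ℂ) + 1) * t = x + t := by push_cast; field_simp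
      rw [← this, h0, zero_mul]
    have h4 : ‖x‖ = t := by
      rw [eq_neg_of_add_eq_zero_left h3, norm_neg, norm_real, Real.norm_of_nonneg ht0.le]
    linarith
  have h5 : x + t = t * (x * ((t⁻¹ : ℝ) : ℂ) + 1) := by push_cast; field_simp
  rw [h5, log_ofReal_mul ht0 hne]
  simp

namespace IsOrderOneLeft

variable (hf : IsOrderOneLeft f) (hℓ : AnalyticOnNhd ℂ ℓ (eligible f))
  (he : ∀ z ∈ eligible f, exp (ℓ z) = f z) (hex : HasLogExpansion ℓ α b β b₀ a)
include hf hℓ he hex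

theorem tendsto_log_remainder (x : ℂ) :
    Tendsto (fun t : ℝ => ℓ (x + t) - stirlingSum α b β b₀ a 1 (x + t)) atTop (𝓝 0) := by
  have h := hf.isBigO_iteratedDeriv_add hℓ he hex 0 1 x
  simp only [iteratedDeriv_zero] at h
  refine h.trans_tendsto ?_
  exact (tendsto_pow_atTop (by norm_num)).inv_tendsto_atTop

/-- Keeping the term `a 1` makes the remainder `O(t⁻²)`, so the factor `t` that occurs in the
primitive `ℓ - y ℓ'` is affordable. -/
theorem tendsto_mul_deriv_log_remainder (x : ℂ) :
    Tendsto (fun t : ℝ => t * (deriv ℓ (x + t) - (α * log (x + t) + b + β * (x + t)⁻¹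
      - a 1 * ((x + t) ^ 2)⁻¹))) atTop (𝓝 0) := by
  have h := hf.isBigO_iteratedDeriv_add hℓ he hex 1 1 x
  have h1 : (fun t : ℝ => (t : ℂ)) =O[atTop] fun t : ℝ => t :=
    IsBigO.of_bound 1 (Eventually.of_forall fun t => by simp)
  have h0 : Tendsto (fun t : ℝ => t * (t ^ (1 + 1))⁻¹) atTop (𝓝 0) := by
    refine tendsto_inv_atTop_zero.congr' ?_
    filter_upwards [eventually_gt_atTop 0] with t ht
    field_simp
  have h2 := (h1.mul h).trans_tendsto h0
  refine h2.congr' ?_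
  filter_upwards [eventually_gt_atTop (1 - x.re)] with t ht
  have hre : 1 < (x + t).re := by rw [add_re, ofReal_re]; linarith
  have hslit : x + t ∈ slitPlane := mem_slitPlane_iff.mpr (Or.inl (by linarith))
  have h3 := (hℓ _ (hf.mem_eligible hre)).differentiableAt.hasDerivAt.fun_sub
    (hasDerivAt_stirlingSum (α := α) (b := b) (β := β) (b₀ := b₀) (a := a) 1 hslit)
  rw [iteratedDeriv_one, h3.deriv]
  simp

theorem tendsto_deriv_log_remainder (x : ℂ) :
    Tendsto (fun t : ℝ => deriv ℓ (x + t) - (α * log (x + t) + b + β * (x + t)⁻¹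
      - a 1 * ((x + t) ^ 2)⁻¹)) atTop (𝓝 0) := by
  have h1 : Tendsto (fun t : ℝ => ((t⁻¹ : ℝ) : ℂ)) atTop (𝓝 ((0 : ℝ) : ℂ)) :=
    (continuous_ofReal.tendsto 0).comp tendsto_inv_atTop_zero
  have h2 := h1.mul (hf.tendsto_mul_deriv_log_remainder hℓ he hex x)
  rw [mul_zero] at h2
  refine h2.congr' ?_
  filter_upwards [eventually_gt_atTop 0] with t ht
  have : (t : ℂ) ≠ 0 := ofReal_ne_zero.mpr ht.ne'
  push_cast
  rw [inv_mul_cancel_left₀ this]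

omit hex in
theorem hasDerivAt_log_add {x : ℂ} (hx : x ∈ eligible f) {y : ℝ} (hy : 0 ≤ y) :
    HasDerivAt (fun y : ℝ => ℓ (x + y)) (deriv ℓ (x + y)) y ∧
      HasDerivAt (fun y : ℝ => deriv ℓ (x + y)) (-zeroPowSum f 2 (x + y)) y := by
  have hm := add_mem_eligible hx hy
  have h0 : HasDerivAt (fun y : ℝ => x + (y : ℂ)) 1 y := (ofRealCLM.hasDerivAt).const_add x
  constructor
  · have := (hℓ _ hm).differentiableAt.hasDerivAt.comp y h0
    simpa [Function.comp_def] using this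
  · have := (hℓ _ hm).deriv.differentiableAt.hasDerivAt.comp y h0
    rw [← hf.iteratedDeriv_two_log hℓ he hm, iteratedDeriv_succ, iteratedDeriv_one]
    simpa [Function.comp_def] using this

/-- At this point the weight is `1`. The primitive of the integrand is `-ℓ'(x + y)`, and `ℓ'(x + t)
- α log t → b`. -/
theorem mellin_cutRemainder_one {x : ℂ} (hx : x ∈ eligible f) :
    mellin (cutRemainder (fun y : ℝ => zeroPowSum f 2 (x + y)) (shiftCoeff α β a x) 1) 1 =
      deriv ℓ x - b := by
  have hφ := hf.continuousOn_zeroPowSum_add hx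
  have hconv := mellinConvergent_cutRemainder hφ (hf.isBigO_zeroPowSum_sub hℓ he hex x 1)
    (s := 1) (by simp) (by simp)
  norm_num [MellinConvergent] at hconv
  have h1 := integral_Ioi_of_cut (Φ := fun y : ℝ => -deriv ℓ (x + y))
    (u := fun y : ℝ => zeroPowSum f 2 (x + y)) (Λ := fun y : ℝ => -α * (Real.log y : ℂ))
    (v := fun y : ℝ => -α * (y : ℂ)⁻¹) (m := -b) hconv
    (fun y hy => by simpa using (hf.hasDerivAt_log_add hℓ he hx hy).2.fun_neg)
    (fun y hy => by
      have := (Real.hasDerivAt_log (by linarith : y ≠ 0)).ofReal_comp.const_mul (-α)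
      simpa using this)
    (fun y hy => cutRemainder_of_le _ hy)
    (fun y hy => by
      rw [cutRemainder_of_lt _ hy]
      simp [shiftCoeff_one])
    (hφ.mono Icc_subset_Ici_self)
    (by
      have h2 := hf.tendsto_deriv_log_remainder hℓ he hex x
      have h3 := (tendsto_log_add_sub_log x).const_mul α
      have h4 := (tendsto_inv_add x).const_mul β
      have h5 := ((tendsto_inv_add x).pow 2).const_mul (a 1)
      have h6 := ((h2.add h3).add (h4.sub h5)).const_sub (-b)
      simp only [mul_zero, add_zero, sub_zero, zero_pow (two_ne_zero' ℕ)] at h6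
      refine h6.congr fun t => ?_
      rw [inv_pow]
      ring)
  rw [mellin]
  simp only [sub_self, cpow_zero, one_smul]
  rw [h1]
  simp
  ring

/-- The weight is `y`, with primitive `ℓ(x + y) - y ℓ'(x + y)`. By the Stirling expansion this is
`-α t + (α x + β) log t + (b x + b₀ - α x - β) + o(1)`; the constant is `m`. -/
theorem mellin_cutRemainder_two {x : ℂ} (hx : x ∈ eligible f) :
    mellin (cutRemainder (fun y : ℝ => zeroPowSum f 2 (x + y)) (shiftCoeff α β a x) 2) 2 =
      b * x + b₀ - ℓ x - α - (α * x + β) := by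
  have hφ := hf.continuousOn_zeroPowSum_add hx
  have hconv := mellinConvergent_cutRemainder hφ (hf.isBigO_zeroPowSum_sub hℓ he hex x 2)
    (s := 0) (by simp) (by simp)
  rw [MellinConvergent, sub_zero] at hconv
  have h21 : (2 : ℂ) - 1 = 1 := by norm_num
  simp only [h21, cpow_one, smul_eq_mul] at hconv
  have h1 := integral_Ioi_of_cut (Φ := fun y : ℝ => -(y * deriv ℓ (x + y)) + ℓ (x + y))
    (u := fun y : ℝ => y * zeroPowSum f 2 (x + y))
    (Λ := fun y : ℝ => -α * y + (α * x + β) * (Real.log y : ℂ))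
    (v := fun y : ℝ => -α + (α * x + β) * (y : ℂ)⁻¹) (m := b * x + b₀ - α * x - β) hconv
    (fun y hy => by
      have h2 := hf.hasDerivAt_log_add hℓ he hx hy
      have h3 : HasDerivAt (fun y : ℝ => (y : ℂ)) 1 y := ofRealCLM.hasDerivAt
      refine ((h3.fun_mul h2.2).fun_neg.fun_add h2.1).congr_deriv ?_
      ring)
    (fun y hy => by
      have h3 : HasDerivAt (fun y : ℝ => (y : ℂ)) 1 y := ofRealCLM.hasDerivAt
      have h4 := (Real.hasDerivAt_log (by linarith : y ≠ 0)).ofReal_comp.const_mul (α * x + β)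
      simpa using (h3.const_mul (-α)).fun_add h4)
    (fun y hy => by rw [cutRemainder_of_le _ hy])
    (fun y hy => by
      have hy0 : (y : ℂ) ≠ 0 := ofReal_ne_zero.mpr (by linarith)
      rw [cutRemainder_of_lt _ hy, Finset.sum_Icc_succ_top (by lia), Finset.Icc_self,
        Finset.sum_singleton, shiftCoeff_one, shiftCoeff_two]
      field_simp
      ring)
    (continuous_ofReal.continuousOn.mul (hφ.mono Icc_subset_Ici_self))
    (by
      have h2 := hf.tendsto_mul_deriv_log_remainder hℓ he hex x
      have h3 := hf.tendsto_log_remainder hℓ he hex x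
      have h4 := (tendsto_log_add_sub_log x).const_mul (α * x + β)
      have h5 := (tendsto_ofReal_div_add x).const_mul β
      have h6 := (tendsto_inv_add x).const_mul (a 1)
      have h7 := ((tendsto_ofReal_div_add x).mul (tendsto_inv_add x)).const_mul (a 1)
      have h8 := (((h3.sub h2).add h4).sub h5).add (h6.add h7)
      have h9 := h8.const_add (b * x + b₀ - α * x)
      simp only [mul_zero, add_zero, sub_zero, mul_one, zero_sub] at h9
      rw [← sub_eq_add_neg] at h9
      refine h9.congr' ?_
      filter_upwards [eventually_gt_atTop (1 - x.re)] with t ht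
      have hne : x + t ≠ 0 := by
        intro h0
        have := congrArg re h0
        simp at this
        linarith
      simp only [stirlingSum, Finset.Icc_self, Finset.sum_singleton]
      field_simp
      ring)
  rw [mellin]
  simp only [h21, cpow_one, smul_eq_mul]
  rw [h1]
  simp
  ring

end IsOrderOneLeft
end Values

/-! ### The zeta function over zeros and its special values. -/

section ZetaFunction
open Complex Set Metric MeasureTheory

theorem poleFactor_one_at_one : poleFactor 1 1 = -Real.pi := by
  simp [poleFactor, show (1 : ℂ) + 1 - 2 = 0 by ring, sinQuot_zero]

/-- `sinQuot` vanishes at all integers but `0`, so at `s = -n` a single coefficient of the expansion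
survives. -/
theorem poleFactor_neg_natCast (j n : ℕ) :
    poleFactor j (-(n : ℂ)) = if j = n + 2 then (-1) ^ n * (Real.pi : ℂ) else 0 := by
  split_ifs with h
  · subst h
    rw [poleFactor, show -(n : ℂ) + ((n + 2 : ℕ) : ℂ) - 2 = 0 by push_cast; ring, sinQuot_zero]
    ring
  · have h2 : ((j : ℤ) - n - 2) ≠ 0 := by lia
    have h3 := sinQuot_intCast h2
    push_cast at h3
    rw [poleFactor, show -(n : ℂ) + (j : ℂ) - 2 = (j : ℂ) - n - 2 by ring, h3, mul_zero]

theorem hasDerivAt_poleFactor (j : ℕ) (s : ℂ) :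
    HasDerivAt (poleFactor j) ((-1) ^ j * deriv sinQuot (s + j - 2)) s := by
  have h1 : HasDerivAt (fun s : ℂ => s + j - 2) 1 s :=
    ((hasDerivAt_id s).add_const (j : ℂ)).sub_const 2
  have h2 := (differentiable_sinQuot (s + j - 2)).hasDerivAt.comp s h1
  have h3 := h2.const_mul ((-1 : ℂ) ^ j)
  rw [mul_one] at h3
  exact h3

theorem deriv_sinQuot_neg_one : deriv sinQuot (-1) = Real.pi := by
  have h1 : HasDerivAt (fun u : ℂ => u * sinQuot u)
      (1 * sinQuot (-1) + -1 * deriv sinQuot (-1)) (-1) :=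
    (hasDerivAt_id (-1 : ℂ)).fun_mul (differentiable_sinQuot (-1)).hasDerivAt
  simp only [mul_sinQuot] at h1
  have h2 : HasDerivAt (fun u : ℂ => sin (Real.pi * u)) (-Real.pi) (-1) := by
    have := ((hasDerivAt_id (-1 : ℂ)).const_mul (Real.pi : ℂ)).csin
    simpa using this
  have h3 := h1.unique h2
  have h4 : sinQuot (-1) = 0 := by simpa using sinQuot_intCast (k := -1) (by norm_num)
  rw [h4] at h3
  linear_combination -h3

theorem hasDerivAt_sin_pi_mul (s : ℂ) :
    HasDerivAt (fun s : ℂ => sin (Real.pi * s)) (cos (Real.pi * s) * Real.pi) s := by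
  have := ((hasDerivAt_id s).const_mul (Real.pi : ℂ)).csin
  simpa using this

/-- The finite part of `H s / (s - 1)` at `1`. -/
theorem tendsto_div_sub_one {H : ℂ → ℂ} {d : ℂ} (h : HasDerivAt H d 1) :
    Tendsto (fun s => H s / (s - 1) - H 1 / (s - 1)) (𝓝[≠] 1) (𝓝 d) := by
  refine (hasDerivAt_iff_tendsto_slope.mp h).congr fun s => ?_
  rw [slope_def_field, sub_div]

theorem HasFinitePart.unique {F : ℂ → ℂ} {s₀ c c' : ℂ} (h : HasFinitePart F s₀ c)
    (h' : HasFinitePart F s₀ c') : c = c' := by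
  obtain ⟨r, hr⟩ := h
  obtain ⟨r', hr'⟩ := h'
  have h1 : Tendsto (fun s : ℂ => s - s₀) (𝓝[≠] s₀) (𝓝 0) := by
    have : Tendsto (fun s : ℂ => s - s₀) (𝓝 s₀) (𝓝 (s₀ - s₀)) :=
      (continuous_id.sub continuous_const).tendsto s₀
    rw [sub_self] at this
    exact this.mono_left nhdsWithin_le_nhds
  have h2 := (hr'.sub hr).mul h1
  have h3 : r - r' = 0 := by
    have h4 : Tendsto (fun _ : ℂ => r - r') (𝓝[≠] s₀) (𝓝 ((c' - c) * 0)) := by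
      refine h2.congr' ?_
      filter_upwards [self_mem_nhdsWithin] with s hs
      have : s - s₀ ≠ 0 := sub_ne_zero.mpr hs
      field_simp
      ring
    rw [mul_zero] at h4
    exact tendsto_nhds_unique tendsto_const_nhds h4
  rw [← sub_eq_zero.mp h3] at hr'
  exact tendsto_nhds_unique hr hr'

namespace IsOrderOneLeft

variable {α b β b₀ : ℂ} {a : ℕ → ℂ} {f ℓ : ℂ → ℂ}
  (hf : IsOrderOneLeft f) (hℓ : AnalyticOnNhd ℂ ℓ (eligible f))
  (he : ∀ z ∈ eligible f, exp (ℓ z) = f z) (hex : HasLogExpansion ℓ α b β b₀ a)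
include hf hℓ he hex

/-- `s ↦ (s - 1) ∑ (x - ρ) ^ (-s)` extends to an entire function. -/
theorem exists_entire_zeta {x : ℂ} (hx : x ∈ eligible f) :
    ∃ H : ℂ → ℂ, Differentiable ℂ H ∧
      (∀ s : ℂ, 1 < s.re → H s = (s - 1) * ∑' ρ, zetaTerm f s x ρ) ∧
      ∀ K : ℕ, ∀ s : ℂ, 1 - K < s.re → s.re < 2 →
        H s = -mellinCont (fun y : ℝ => zeroPowSum f 2 (x + y)) (shiftCoeff α β a x) K s
          / Real.pi := by
  have hφ := hf.continuousOn_zeroPowSum_add hx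
  have hc := hf.isBigO_zeroPowSum_sub hℓ he hex x
  have hpi : (Real.pi : ℂ) ≠ 0 := ofReal_ne_zero.mpr Real.pi_ne_zero
  refine exists_entire_of_strips ?_ ?_ ?_
  · exact DifferentiableOn.mul (by fun_prop) (hf.differentiableOn_tsum_zetaTerm hx)
  · intro K s h1 h2
    exact (differentiableAt_mellinCont hφ (hc K) h1 h2).neg.div_const _
  · intro K s h1 h2
    rw [mellinCont_eq hφ hc K h1 h2, hf.mellin_zeroPowSum hx h1 h2, ← mul_assoc,
      Gamma_two_sub_mul_Gamma h1 h2]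
    field_simp
    ring

/-- The zeta function over the zeros of `f`, with its special values. -/
theorem exists_zeta_at {x : ℂ} (hx : x ∈ eligible f) :
    ∃ H : ℂ → ℂ, Differentiable ℂ H ∧
      (∀ s : ℂ, 1 < s.re → H s = (s - 1) * ∑' ρ, zetaTerm f s x ρ) ∧
      H 1 = -α ∧
      (∀ n : ℕ, H (-(n : ℂ)) = (n + 1) * shadowPoly α β a n x) ∧
      HasDerivAt H (deriv ℓ x - b) 1 ∧
      HasDerivAt H (-(b * x + b₀ - ℓ x) + (α * x + β)) 0 := by
  have hφ := hf.continuousOn_zeroPowSum_add hx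
  have hc := hf.isBigO_zeroPowSum_sub hℓ he hex x
  have hpi : (Real.pi : ℂ) ≠ 0 := ofReal_ne_zero.mpr Real.pi_ne_zero
  obtain ⟨H, hH, hH1, hHK⟩ := hf.exists_entire_zeta hℓ he hex hx
  set φ : ℝ → ℂ := fun y : ℝ => zeroPowSum f 2 (x + y) with hφdef
  set c := shiftCoeff α β a x with hcdef
  have hopen : ∀ a : ℝ, IsOpen {s : ℂ | a < s.re ∧ s.re < 2} := fun a =>
    (isOpen_lt continuous_const continuous_re).inter (isOpen_lt continuous_re continuous_const)
  have hderiv : ∀ K : ℕ, ∀ s : ℂ, 1 - K < s.re → s.re < 2 → ∀ d : ℂ,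
      HasDerivAt (mellinCont φ c K) d s → HasDerivAt H (-d / Real.pi) s := by
    intro K s h1 h2 d hd
    refine (hd.fun_neg.div_const (Real.pi : ℂ)).congr_of_eventuallyEq ?_
    filter_upwards [(hopen (1 - K)).mem_nhds ⟨h1, h2⟩] with z hz using hHK K z hz.1 hz.2
  -- At a zero of the sine the derivative of the transform drops out of the product rule, so only
  -- its value is needed.
  have hd : ∀ K : ℕ, ∀ s : ℂ, 1 - K < s.re → s.re < 2 → sin (Real.pi * s) = 0 →
      HasDerivAt (mellinCont φ c K) (cos (Real.pi * s) * Real.pi * mellin (cutRemainder φ c K) (2 - s)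
        + ∑ j ∈ Finset.Icc 1 K, c j * ((-1) ^ j * deriv sinQuot (s + j - 2))) s := by
    intro K s h1 h2 h0
    have h3 := (hasDerivAt_sin_pi_mul s).fun_mul
      (differentiableAt_mellin_cutRemainder hφ (hc K) h1 h2).hasDerivAt
    rw [h0, zero_mul, add_zero] at h3
    exact h3.fun_add (HasDerivAt.fun_sum fun j _ => (hasDerivAt_poleFactor j s).const_mul (c j))
  refine ⟨H, hH, hH1, ?_, ?_, ?_, ?_⟩
  · rw [hHK 1 1 (by norm_num) (by norm_num), mellinCont]
    simp only [mul_one, sin_pi, zero_mul, zero_add, Finset.Icc_self, Finset.sum_singleton,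
      poleFactor_one_at_one, hcdef, shiftCoeff_one]
    field_simp
  · intro n
    have hn : (n : ℂ) + 1 ≠ 0 := by exact_mod_cast n.succ_ne_zero
    -- The truncation `K = n + 2` is the smallest whose strip contains `-n`, and it just includes
    -- the surviving index.
    rw [hHK (n + 2) (-(n : ℂ)) (by simp; linarith) (by simp; linarith [n.cast_nonneg (α := ℝ)]),
      mellinCont, show (Real.pi : ℂ) * -(n : ℂ) = -((n : ℂ) * Real.pi) by ring, sin_neg,
      sin_nat_mul_pi]
    simp only [poleFactor_neg_natCast, mul_ite, mul_zero, Finset.sum_ite_eq', Finset.mem_Icc]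
    rw [if_pos (by lia)]
    have := shiftCoeff_eq_shadowPoly (α := α) (β := β) (a := a) x n
    rw [div_eq_iff hn] at this
    rw [← hcdef] at this
    field_simp
    linear_combination -(Real.pi : ℂ) * this
  · have h1 := hderiv 1 1 (by norm_num) (by norm_num) _
      (hd 1 1 (by norm_num) (by norm_num) (by simp))
    refine h1.congr_deriv ?_
    have h2 := hf.mellin_cutRemainder_one hℓ he hex hx
    rw [show (2 : ℂ) - 1 = 1 by norm_num, h2]
    simp only [mul_one, cos_pi, Finset.Icc_self, Finset.sum_singleton, Nat.cast_one,
      show (1 : ℂ) + 1 - 2 = 0 by norm_num, deriv_sinQuot_zero]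
    field_simp
    ring
  · have h1 := hderiv 2 0 (by norm_num) (by norm_num) _
      (hd 2 0 (by norm_num) (by norm_num) (by simp))
    refine h1.congr_deriv ?_
    have h2 := hf.mellin_cutRemainder_two hℓ he hex hx
    -- Besides the integral, the index `j = 1` contributes through `sinQuot'(-1) = π`, which cancels
    -- the `-α` in the regularized integral; `j = 2` contributes `sinQuot'(0) = 0`.
    rw [sub_zero, h2, Finset.sum_Icc_succ_top (by lia), Finset.Icc_self, Finset.sum_singleton]
    simp only [one_add_one_eq_two, mul_zero, cos_zero, Nat.cast_one, Nat.cast_ofNat, hcdef, shiftCoeff_one,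
      shiftCoeff_two, show (0 : ℂ) + 1 - 2 = -1 by norm_num, show (0 : ℂ) + 2 - 2 = 0 by norm_num,
      deriv_sinQuot_zero, deriv_sinQuot_neg_one]
    field_simp
    ring

/-- `Z = H / (s - 1)` with the entire `H` of `exists_zeta_at`: the residue is `H 1`, the finite part
at `1` is `H' 1`, and the derivative at `0` is `-H' 0 - H 0`, in which the terms `α x + β` cancel.
-/
theorem exists_zeta :
    ∃ Z : ℂ → ℂ → ℂ, IsZetaOverZeros f Z (-α) ∧ ∀ x ∈ eligible f,
      (∀ n : ℕ, Z (-(n : ℂ)) x = -shadowPoly α β a n x) ∧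
      HasDerivAt (fun s => Z s x) (b * x + b₀ - ℓ x) 0 ∧
      HasFinitePart (fun s => Z s x) 1 (-b + deriv ℓ x) ∧
      ∀ n : ℕ, 2 ≤ n →
        Z n x = (-1) ^ (n - 1) / ((n - 1).factorial : ℂ) * iteratedDeriv n ℓ x := by
  classical
  choose! H hH hH1 hHα hHn hHd1 hHd0 using fun (x : ℂ) (hx : x ∈ eligible f) =>
    hf.exists_zeta_at hℓ he hex hx
  have hsum : ∀ x ∈ eligible f, ∀ s : ℂ, 1 < s.re →
      H x s / (s - 1) = ∑' ρ, zetaTerm f s x ρ := by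
    intro x hx s hs
    have hs1 : s - 1 ≠ 0 := by
      intro h0
      have := congrArg re h0
      simp at this
      linarith
    rw [hH1 x hx s hs, mul_div_cancel_left₀ _ hs1]
  refine ⟨fun s x => H x s / (s - 1), ⟨fun x hx s hs => hf.summable_zetaTerm hx hs, hsum,
    fun x hx => ?_, fun x hx => ?_⟩, fun x hx => ⟨fun n => ?_, ?_, ?_, fun n hn => ?_⟩⟩
  · exact (hH x hx).differentiableOn.div (by fun_prop) fun s hs => sub_ne_zero.mpr hs
  · have h1 := ((hH x hx).continuous.tendsto 1).mono_left (nhdsWithin_le_nhds (s := {1}ᶜ))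
    rw [hHα x hx] at h1
    refine h1.congr' ?_
    filter_upwards [self_mem_nhdsWithin] with s hs
    rw [mul_div_cancel₀ _ (sub_ne_zero.mpr hs)]
  · have hn : (n : ℂ) + 1 ≠ 0 := by exact_mod_cast n.succ_ne_zero
    simp only
    rw [hHn x hx, div_eq_iff (by rw [← neg_add', neg_ne_zero]; exact hn)]
    ring
  · have h0 := hHn x hx 0
    simp only [shadowPoly, Nat.cast_zero, neg_zero, zero_add, pow_one, pow_zero, zero_mul, div_one,
      one_mul, mul_one, add_zero] at h0
    refine ((hHd0 x hx).fun_div ((hasDerivAt_id (0 : ℂ)).sub_const 1) (by norm_num)).congr_deriv ?_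
    simp only [id, h0]
    norm_num
    ring
  · refine ⟨-α, ?_⟩
    rw [neg_add_eq_sub, ← hHα x hx]
    exact tendsto_div_sub_one (hHd1 x hx)
  · simp only
    rw [hsum x hx n (by rw [natCast_re]; exact_mod_cast hn)]
    exact hf.tsum_zetaTerm_natCast hℓ he hn hx

end IsOrderOneLeft
end ZetaFunction

/-! ### The branches of `log G` and `log Ξ` and the expansion of `log Ξ`. -/

section Branches
open Complex Set Metric

/-- Analytic functions that agree on the real axis near a real point agree near that point. -/
theorem eventuallyEq_of_eq_ofReal {f g : ℂ → ℂ} {x : ℝ} (hf : AnalyticAt ℂ f x)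
    (hg : AnalyticAt ℂ g x) (h : ∀ᶠ u : ℝ in 𝓝[≠] x, f u = g u) : f =ᶠ[𝓝 (x : ℂ)] g := by
  refine (hf.frequently_eq_iff_eventually_eq hg).mp ?_
  have ht : Tendsto (fun u : ℝ => (u : ℂ)) (𝓝[≠] x) (𝓝[≠] (x : ℂ)) :=
    continuous_ofReal.continuousWithinAt.tendsto_nhdsWithin fun u hu => by simpa using hu
  exact ht.frequently h.frequently

/-- Some logarithm exists on the simply connected eligible set. On the connected `S` it differs from
`u` by a constant period, which is then added everywhere. -/
theorem IsOrderOneLeft.exists_log_eqOn {f u : ℂ → ℂ} (hf : IsOrderOneLeft f) {S : Set ℂ}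
    (hS : IsPreconnected S) (hSf : S ⊆ eligible f) (hu : ContinuousOn u S)
    (hue : ∀ z ∈ S, exp (u z) = f z) :
    ∃ ℓ : ℂ → ℂ, AnalyticOnNhd ℂ ℓ (eligible f) ∧ (∀ z ∈ eligible f, exp (ℓ z) = f z) ∧
      EqOn ℓ u S := by
  obtain ⟨ℓ, hℓ, he⟩ := exists_analytic_log hf.isSimplyConnected_eligible hf.isOpen_eligible
    (f := f) (fun z _ => hf.differentiable.analyticAt z) fun z hz => ne_zero_of_mem_eligible hz
  obtain ⟨k, hk, h⟩ := exists_eq_add_of_exp_eq hS hu (hℓ.continuousOn.mono hSf)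
    fun z hz => by rw [hue z hz, he z (hSf hz)]
  refine ⟨fun z => ℓ z + k, fun z hz => (hℓ z hz).add analyticAt_const, fun z hz => ?_,
    fun z hz => (h z hz).symm⟩
  rw [exp_add, he z hz, hk, mul_one]

theorem one_sub_inv_mem_slitPlane {z : ℂ} (hz : 2 ≤ ‖z‖) : 1 - z⁻¹ ∈ slitPlane := by
  rw [sub_eq_add_neg]
  refine mem_slitPlane_of_norm_lt_one ?_
  rw [norm_neg, norm_inv]
  exact inv_lt_one_of_one_lt₀ (by linarith)

/-- The remainder of the expansion of `log (1 - 1 / z)` at infinity. -/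
noncomputable def logRemainder (N : ℕ) (z : ℂ) : ℂ :=
  log (1 - z⁻¹) + ∑ k ∈ Finset.Icc 1 N, (k : ℂ)⁻¹ * (z ^ k)⁻¹

theorem analyticAt_logRemainder (N : ℕ) {z : ℂ} (hz : 2 ≤ ‖z‖) :
    AnalyticAt ℂ (logRemainder N) z := by
  have hz0 : z ≠ 0 := norm_pos_iff.mp (by linarith)
  have h1 : AnalyticAt ℂ (fun z : ℂ => log (1 - z⁻¹)) z :=
    (analyticAt_const.sub (analyticAt_inv hz0)).clog (one_sub_inv_mem_slitPlane hz)
  have h2 : AnalyticAt ℂ (fun z : ℂ => ∑ k ∈ Finset.Icc 1 N, (k : ℂ)⁻¹ * (z ^ k)⁻¹) z :=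
    Finset.analyticAt_fun_sum _ fun k _ =>
      analyticAt_const.mul ((analyticAt_id.pow k).inv (pow_ne_zero k hz0))
  exact h1.add h2

theorem norm_logRemainder_le (N : ℕ) {z : ℂ} (hz : 2 ≤ ‖z‖) :
    ‖logRemainder N z‖ ≤ 2 * ‖z‖⁻¹ ^ (N + 1) := by
  have h0 : ‖z‖⁻¹ ≤ 1 / 2 := by rw [one_div]; exact inv_anti₀ two_pos hz
  have h1 := norm_log_sub_logTaylor_le N (z := -z⁻¹) (by rw [norm_neg, norm_inv]; linarith)
  have h2 : log (1 + -z⁻¹) - logTaylor (N + 1) (-z⁻¹) = logRemainder N z := by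
    rw [logRemainder, ← sub_eq_add_neg, sub_eq_add_neg (log _), logTaylor, Finset.sum_range_succ',
      sum_Icc_one_eq_sum_range, Nat.cast_zero, div_zero, add_zero, ← Finset.sum_neg_distrib]
    congr 1
    refine Finset.sum_congr rfl fun j _ => ?_
    rw [neg_pow z⁻¹, inv_pow]
    have : (-1 : ℂ) ^ (j + 1) * (-1) ^ (j + 1) = 1 := by rw [← mul_pow]; simp
    rw [pow_succ (-1 : ℂ) (j + 1)]
    linear_combination (((j + 1 : ℕ) : ℂ)⁻¹ * (z ^ (j + 1))⁻¹) * this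
  rw [h2, norm_neg, norm_inv] at h1
  refine h1.trans ?_
  have h3 : (1 - ‖z‖⁻¹)⁻¹ ≤ 2 := by
    rw [inv_le_comm₀ (by linarith) two_pos]; linarith
  have hN : (1 : ℝ) ≤ N + 1 := by linarith [N.cast_nonneg (α := ℝ)]
  calc ‖z‖⁻¹ ^ (N + 1) * (1 - ‖z‖⁻¹)⁻¹ / (N + 1)
      ≤ ‖z‖⁻¹ ^ (N + 1) * (1 - ‖z‖⁻¹)⁻¹ :=
        div_le_self (mul_nonneg (by positivity) (inv_nonneg.mpr (by linarith))) hN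
    _ ≤ ‖z‖⁻¹ ^ (N + 1) * 2 := by gcongr
    _ = _ := mul_comm _ _

/-- Cauchy's estimate on discs of radius `t / 2` gains a factor `1 / t` for each derivative of the
Taylor remainder. -/
theorem isBigO_iteratedDeriv_logRemainder (m N : ℕ) :
    (fun x : ℝ => iteratedDeriv m (logRemainder N) (x : ℂ)) =O[atTop]
      fun x : ℝ => (x ^ (N + 1 + m))⁻¹ := by
  refine IsBigO.of_bound (m.factorial * 2 * 2 ^ (N + 1 + m)) ?_
  filter_upwards [eventually_ge_atTop 4] with t ht
  have ht0 : 0 < t := by linarith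
  have hball : ∀ z ∈ closedBall (t : ℂ) (t / 2), t / 2 ≤ ‖z‖ := by
    intro z hz
    rw [mem_closedBall, dist_eq_norm] at hz
    have h1 : ‖(t : ℂ)‖ ≤ ‖z - t‖ + ‖z‖ := by
      rw [norm_sub_rev]
      simpa using norm_add_le ((t : ℂ) - z) z
    rw [norm_real, Real.norm_of_nonneg ht0.le] at h1
    linarith
  have h1 := norm_iteratedDeriv_le_of_forall_mem_sphere_norm_le (f := logRemainder N) (c := (t : ℂ))
    (R := t / 2) (C := 2 * (t / 2)⁻¹ ^ (N + 1)) m (by positivity)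
    (DifferentiableOn.diffContOnCl (by
      rw [closure_ball _ (by positivity)]
      exact fun z hz => (analyticAt_logRemainder N
        (by linarith [hball z hz])).differentiableAt.differentiableWithinAt))
    (fun z hz => by
      have h2 := hball z (sphere_subset_closedBall hz)
      refine (norm_logRemainder_le N (by linarith)).trans ?_
      gcongr)
  refine h1.trans (le_of_eq ?_)
  rw [norm_inv, norm_pow, Real.norm_of_nonneg ht0.le, inv_div, div_pow, div_pow, pow_add, pow_add 2]
  field_simp
  ring

variable {L G Ξ : ℂ → ℂ} {q : ℕ} {α₁ b₁ α₀ b₀ : ℂ} {a : ℕ → ℂ}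

theorem HasLogExpansion.tendsto {ℓ : ℂ → ℂ} (h : HasLogExpansion ℓ α₁ b₁ α₀ b₀ a) :
    Tendsto (fun t : ℝ => ℓ (t : ℂ) - (α₁ * t * (Real.log t - 1) + b₁ * t + α₀ * Real.log t + b₀))
      atTop (𝓝 0) := by
  have h1 := h 0 0
  simp only [iteratedDeriv_zero] at h1
  have h2 := h1.trans_tendsto (tendsto_pow_atTop (by norm_num)).inv_tendsto_atTop
  refine h2.congr' ?_
  filter_upwards [eventually_ge_atTop 0] with t ht
  rw [stirlingSum, ofReal_log ht]
  simp

/-- The given branch lives on the right half-plane and extends to all eligible points. Since `-log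
G` is what is expanded, all coefficients change sign. -/
theorem HasStirlingExpansion.exists_log (hG : HasStirlingExpansion G α₁ b₁ α₀ b₀ a)
    (hf : IsOrderOneLeft G) (h0 : ∀ z, G z = 0 → z.re ≤ 0) :
    ∃ ℓ : ℂ → ℂ, AnalyticOnNhd ℂ ℓ (eligible G) ∧ (∀ z ∈ eligible G, exp (ℓ z) = G z) ∧
      HasLogExpansion ℓ (-α₁) (-b₁) (-α₀) (-b₀) (fun n => -a n) := by
  obtain ⟨u, hu, hue, hO⟩ := hG
  obtain ⟨ℓ, hℓ, he, heq⟩ := hf.exists_log_eqOn (S := {z | 0 < z.re})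
    (convex_halfSpace_re_gt 0).isPreconnected
    (fun z hz ρ hρ => mem_slitPlane_iff.mpr (Or.inl (by
      have : 0 < z.re := hz
      rw [sub_re]
      linarith [h0 ρ hρ]))) hu.continuousOn hue
  refine ⟨ℓ, hℓ, he, fun m N => ?_⟩
  refine (hO m N).neg_left.congr' ?_ EventuallyEq.rfl
  filter_upwards [eventually_gt_atTop 0] with t ht
  have ho : IsOpen {z : ℂ | 0 < z.re} := isOpen_lt continuous_const continuous_re
  rw [← iteratedDeriv_fun_neg]
  refine Filter.EventuallyEq.iteratedDeriv_eq m ?_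
  filter_upwards [ho.mem_nhds (show 0 < (t : ℂ).re by simpa using ht)] with z hz
  rw [heq hz, stirlingSum]
  simp only [neg_mul, Finset.sum_neg_distrib]
  ring

namespace IsPrimary

variable (hL : IsPrimary L G Ξ q)
include hL

theorem isOrderOneLeft_G : IsOrderOneLeft G :=
  ⟨hL.G_entire, hL.G_order.growthLE hL.G_entire 2, fun ρ hρ => (hL.G_zeros ρ hρ).trans zero_le_one⟩

theorem isOrderOneLeft_Xi : IsOrderOneLeft Ξ :=
  ⟨hL.Xi_entire, hL.Xi_order.growthLE hL.Xi_entire 2, fun ρ hρ => (hL.Xi_zeros ρ hρ).2.1.le⟩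

theorem analyticAt_of_ne_one {z : ℂ} (hz : z ≠ 1) : AnalyticAt ℂ L z := by
  rw [analyticAt_iff_eventually_differentiableAt]
  filter_upwards [isOpen_ne.mem_nhds hz] with w hw using hL.differentiableAt w (Or.inl hw)

theorem tendsto_log : Tendsto (fun t : ℝ => log (L t)) atTop (𝓝 0) := by
  have h := hL.log_decay 0 1
  simp only [iteratedDeriv_zero] at h
  exact h.trans_tendsto (tendsto_pow_atTop (by norm_num)).inv_tendsto_atTop

theorem tendsto_one : Tendsto (fun t : ℝ => L t) atTop (𝓝 1) := by
  have h := (continuous_exp.tendsto 0).comp hL.tendsto_log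
  rw [exp_zero] at h
  refine h.congr' ?_
  filter_upwards [eventually_gt_atTop 1] with t ht
  exact exp_log (hL.ne_zero t (by simpa using ht))

theorem ofReal_mem_eligible_Xi (x : ℝ) : (x : ℂ) ∈ eligible Ξ := fun ρ hρ =>
  mem_slitPlane_iff.mpr (Or.inr (by simpa using (hL.Xi_zeros ρ hρ).2.2))

/-- The branch of `log Ξ` determined by that of `log G`. -/
theorem exists_log_Xi {logG : ℂ → ℂ} (hℓ : AnalyticOnNhd ℂ logG (eligible G))
    (he : ∀ z ∈ eligible G, exp (logG z) = G z)
    (hex : HasLogExpansion logG (-α₁) (-b₁) (-α₀) (-b₀) (fun n => -a n)) :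
    ∃ ℓ : ℂ → ℂ, AnalyticOnNhd ℂ ℓ (eligible Ξ) ∧ (∀ z ∈ eligible Ξ, exp (ℓ z) = Ξ z) ∧
      HasLogExpansion ℓ α₁ b₁ (α₀ + q) b₀ (fun n => a n - q * (n : ℂ)⁻¹) ∧
      Tendsto (fun t : ℝ => ℓ t + logG t - q * Real.log (t - 1)) atTop (𝓝 0) := by
  -- Beyond `T` the values of `L` are close to `1`, so the principal `log L` is holomorphic there.
  obtain ⟨T, hT⟩ : ∃ T : ℝ, ∀ t : ℝ, T < t → 2 < t ∧ L t ∈ slitPlane := by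
    have h1 := hL.tendsto_one.eventually (isOpen_slitPlane.mem_nhds one_mem_slitPlane)
    obtain ⟨T, hT⟩ := eventually_atTop.mp (h1.and (eventually_gt_atTop 2))
    exact ⟨T, fun t ht => ⟨(hT t ht.le).2, (hT t ht.le).1⟩⟩
  -- `log (z - 1)` is split as `log z + log (1 - 1/z)`: the first part raises the coefficient of
  -- `log z` by `q`, the second contributes `-q / n` to that of `z⁻ⁿ`.
  set u : ℂ → ℂ := fun z => -logG z + q * (log z + log (1 - z⁻¹)) + log (L z) with hu
  have hGe : ∀ t : ℝ, 2 < t → (t : ℂ) ∈ eligible G := fun t ht =>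
    hL.isOrderOneLeft_G.mem_eligible (by rw [ofReal_re]; linarith)
  have hnorm : ∀ t : ℝ, 2 < t → 2 ≤ ‖(t : ℂ)‖ := fun t ht => by
    rw [norm_real]; exact ht.le.trans (le_abs_self t)
  have huan : ∀ t : ℝ, T < t → AnalyticAt ℂ u t := by
    intro t ht
    obtain ⟨ht2, hts⟩ := hT t ht
    have ht0 : (t : ℂ) ≠ 0 := ofReal_ne_zero.mpr (by linarith)
    have h1 : AnalyticAt ℂ (fun z : ℂ => log (1 - z⁻¹)) t :=
      (analyticAt_const.sub (analyticAt_inv ht0)).clog (one_sub_inv_mem_slitPlane (hnorm t ht2))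
    have h2 : AnalyticAt ℂ (fun z : ℂ => log z) t :=
      analyticAt_id.clog (ofReal_mem_slitPlane.mpr (by linarith))
    have h3 : AnalyticAt ℂ (fun z => log (L z)) t :=
      (hL.analyticAt_of_ne_one (by rw [Ne, ofReal_eq_one]; linarith)).clog hts
    exact (((hℓ t (hGe t ht2)).neg).add (analyticAt_const.mul (h2.add h1))).add h3
  -- The branch is fixed along a real ray, which is eligible because the zeros of `Ξ` are not real.
  obtain ⟨ℓ, hℓ', he', heq⟩ := hL.isOrderOneLeft_Xi.exists_log_eqOn (u := u)
    (S := (fun t : ℝ => (t : ℂ)) '' Ioi T)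
    (isPreconnected_Ioi.image _ continuous_ofReal.continuousOn)
    (by rintro _ ⟨t, -, rfl⟩; exact hL.ofReal_mem_eligible_Xi t)
    (by rintro _ ⟨t, ht, rfl⟩; exact (huan t ht).continuousAt.continuousWithinAt)
    (by
      rintro _ ⟨t, ht, rfl⟩
      obtain ⟨ht2, hts⟩ := hT t ht
      have ht0 : (t : ℂ) ≠ 0 := ofReal_ne_zero.mpr (by linarith)
      have h1 : (1 : ℂ) - (t : ℂ)⁻¹ ≠ 0 := slitPlane_ne_zero (one_sub_inv_mem_slitPlane (hnorm t ht2))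
      have h2 := hL.factorization t (by rw [Ne, ofReal_eq_one]; linarith)
      have h3 := ne_zero_of_mem_eligible (hGe t ht2)
      simp only [hu]
      rw [exp_add, exp_add, exp_neg, he _ (hGe t ht2), exp_nat_mul, exp_add, exp_log ht0, exp_log h1,
        exp_log (slitPlane_ne_zero hts), mul_sub, mul_one, mul_inv_cancel₀ ht0, mul_assoc, ← h2,
        inv_mul_cancel_left₀ h3])
  -- Agreement on the ray spreads to complex neighbourhoods, so complex derivatives of all orders
  -- agree on it.
  have hloc : ∀ t : ℝ, T < t → ℓ =ᶠ[𝓝 (t : ℂ)] u := fun t ht =>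
    eventuallyEq_of_eq_ofReal (hℓ' t (hL.ofReal_mem_eligible_Xi t)) (huan t ht)
      (nhdsWithin_le_nhds (by
        filter_upwards [Ioi_mem_nhds ht] with s hs using heq ⟨s, hs, rfl⟩))
  refine ⟨ℓ, hℓ', he', fun m N => ?_, ?_⟩
  · have h1 := ((hex m N).neg_left.add
      ((isBigO_iteratedDeriv_logRemainder m N).const_mul_left (q : ℂ))).add
        (hL.log_decay m (N + 1 + m))
    refine h1.congr' ?_ EventuallyEq.rfl
    filter_upwards [eventually_gt_atTop T] with t ht
    obtain ⟨ht2, hts⟩ := hT t ht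
    have hslit : (t : ℂ) ∈ slitPlane := ofReal_mem_slitPlane.mpr (by linarith)
    have a1 : AnalyticAt ℂ (fun z => logG z - stirlingSum (-α₁) (-b₁) (-α₀) (-b₀)
        (fun n => -a n) N z) t := (hℓ t (hGe t ht2)).sub (analyticAt_stirlingSum N hslit)
    have a2 := analyticAt_logRemainder N (hnorm t ht2)
    have a3 : AnalyticAt ℂ (fun z => log (L z)) t :=
      (hL.analyticAt_of_ne_one (by rw [Ne, ofReal_eq_one]; linarith)).clog hts
    have e1 : (fun z => ℓ z - stirlingSum α₁ b₁ (α₀ + q) b₀ (fun n => a n - q * (n : ℂ)⁻¹) N z)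
        =ᶠ[𝓝 (t : ℂ)] fun z => (-(logG z - stirlingSum (-α₁) (-b₁) (-α₀) (-b₀)
          (fun n => -a n) N z) + q * logRemainder N z) + log (L z) := by
      filter_upwards [hloc t ht] with z hz
      rw [hz]
      simp only [hu, stirlingSum, logRemainder, sub_mul, neg_mul, Finset.sum_sub_distrib,
        Finset.sum_neg_distrib, mul_assoc, ← Finset.mul_sum]
      ring
    have a4 : AnalyticAt ℂ (fun z => -(logG z - stirlingSum (-α₁) (-b₁) (-α₀) (-b₀)
        (fun n => -a n) N z)) t := a1.neg
    have a5 : AnalyticAt ℂ (fun z => (q : ℂ) * logRemainder N z) t := analyticAt_const.mul a2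
    have a6 : AnalyticAt ℂ (fun z => -(logG z - stirlingSum (-α₁) (-b₁) (-α₀) (-b₀)
        (fun n => -a n) N z) + q * logRemainder N z) t := a4.add a5
    rw [e1.iteratedDeriv_eq, iteratedDeriv_fun_add a6.contDiffAt a3.contDiffAt,
      iteratedDeriv_fun_add a4.contDiffAt a5.contDiffAt, iteratedDeriv_fun_neg,
      iteratedDeriv_const_mul_field]
  · have h1 := (tendsto_log_add_sub_log (-1)).const_mul (q : ℂ)
    have h2 : Tendsto (fun t : ℝ => log (1 - (t : ℂ)⁻¹)) atTop (𝓝 0) := by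
      have h3 : Tendsto (fun t : ℝ => 1 - ((t⁻¹ : ℝ) : ℂ)) atTop (𝓝 (1 - ((0 : ℝ) : ℂ))) :=
        ((continuous_ofReal.tendsto 0).comp tendsto_inv_atTop_zero).const_sub 1
      rw [ofReal_zero, sub_zero] at h3
      have h4 := (continuousAt_clog one_mem_slitPlane).tendsto.comp h3
      rw [log_one] at h4
      simpa [Function.comp_def] using h4
    have h3 := ((h2.const_mul (q : ℂ)).add hL.tendsto_log).sub h1
    simp only [mul_zero, add_zero, sub_zero] at h3
    refine h3.congr' ?_
    filter_upwards [eventually_gt_atTop T] with t ht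
    obtain ⟨ht2, hts⟩ := hT t ht
    rw [heq ⟨t, ht, rfl⟩]
    simp only [hu]
    rw [ofReal_log (by linarith : (0 : ℝ) ≤ t), ofReal_log (by linarith : (0 : ℝ) ≤ t - 1)]
    push_cast
    rw [neg_add_eq_sub]
    ring

end IsPrimary

theorem shadowPoly_neg (n : ℕ) (x : ℂ) :
    shadowPoly (-α₁) (-α₀) (fun k => -a k) n x = -shadowPoly α₁ α₀ a n x := by
  simp only [shadowPoly, mul_neg, neg_mul, Finset.sum_neg_distrib]
  ring

/-- Since `n C(n - 1, j - 1) / j = C(n, j)`, the corrections `q / j` together with the monomial `q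
xⁿ` assemble to the binomial expansion of `q (x - 1)ⁿ`. -/
theorem shadowPoly_add (q : ℂ) (n : ℕ) (x : ℂ) :
    shadowPoly α₁ (α₀ + q) (fun k => a k - q * (k : ℂ)⁻¹) n x =
      shadowPoly α₁ α₀ a n x - q * (x - 1) ^ n := by
  have h1 : (x - 1) ^ n = x ^ n +
      (n : ℂ) * ∑ j ∈ Finset.Icc 1 n,
        (-1 : ℂ) ^ j * ((n - 1).choose (j - 1) : ℂ) * (j : ℂ)⁻¹ * x ^ (n - j) := by
    rw [sub_eq_add_neg, add_comm, add_pow, Finset.sum_range_succ', sum_Icc_one_eq_sum_range,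
      Finset.mul_sum, add_comm]
    congr 1
    · simp
    · refine Finset.sum_congr rfl fun j hj => ?_
      obtain ⟨m, rfl⟩ : ∃ m, n = m + 1 := ⟨n - 1, by have := Finset.mem_range.mp hj; lia⟩
      have h2 : ((m : ℂ) + 1) * (m.choose j : ℂ) = ((m + 1).choose (j + 1) : ℂ) * (j + 1) := by
        exact_mod_cast Nat.add_one_mul_choose_eq m j
      have hj0 : (j : ℂ) + 1 ≠ 0 := by exact_mod_cast j.succ_ne_zero
      simp only [Nat.add_sub_cancel]
      push_cast
      field_simp
      linear_combination -x ^ (m - j) * h2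
  rw [h1]
  simp only [shadowPoly, mul_sub, sub_mul, Finset.sum_sub_distrib, mul_add, Finset.mul_sum, add_mul]
  have h2 : ∀ j, (n : ℂ) * ((-1 : ℂ) ^ j * ((n - 1).choose (j - 1) : ℂ) * (q * (j : ℂ)⁻¹)
      * x ^ (n - j)) = q * ((n : ℂ) * ((-1 : ℂ) ^ j * ((n - 1).choose (j - 1) : ℂ) * (j : ℂ)⁻¹
      * x ^ (n - j))) := fun j => by ring
  simp only [h2]
  ring

end Branches

/-! ### The paired sum at `s = 1`. -/

section Pairs
open Complex Set Metric

variable {L G Ξ : ℂ → ℂ} {q : ℕ}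

theorem one_add_norm_sub_two_le (ρ : ℂ) : 1 + ‖ρ - 2‖ ≤ 4 * (1 + ‖1 - ρ - 2‖) := by
  have h : ‖ρ - 2‖ ≤ ‖1 - ρ - 2‖ + 3 := by
    calc ‖ρ - 2‖ = ‖-(1 - ρ - 2) + (-3)‖ := by congr 1; ring
      _ ≤ ‖-(1 - ρ - 2)‖ + ‖(-3 : ℂ)‖ := norm_add_le _ _
      _ = _ := by rw [norm_neg, norm_neg]; norm_num
  linarith [norm_nonneg (1 - ρ - 2)]

namespace IsPrimary

variable (hL : IsPrimary L G Ξ q)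
include hL

theorem Xi_one_sub {ρ : ℂ} (hρ : Ξ ρ = 0) : Ξ (1 - ρ) = 0 := by
  rw [← hL.functional_equation, hρ]

theorem analyticOrderNatAt_one_sub (ρ : ℂ) :
    analyticOrderNatAt Ξ (1 - ρ) = analyticOrderNatAt Ξ ρ := by
  have h1 : (fun z => Ξ (1 - z)) = Ξ := funext fun z => (hL.functional_equation z).symm
  have hg : HasDerivAt (fun z : ℂ => 1 - z) (-1) ρ := (hasDerivAt_id ρ).const_sub 1
  have h2 := analyticOrderAt_comp_of_deriv_ne_zero (f := Ξ) (g := fun z : ℂ => 1 - z) (z₀ := ρ)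
    (analyticAt_const.sub analyticAt_id) (by rw [hg.deriv]; norm_num)
  rw [Function.comp_def, h1] at h2
  rw [analyticOrderNatAt, analyticOrderNatAt, h2]

/-- The reflection `ρ ↦ 1 - ρ` of the zeros of `Ξ`. -/
def reflect : {ρ : ℂ // Ξ ρ = 0} ≃ {ρ : ℂ // Ξ ρ = 0} where
  toFun ρ := ⟨1 - ρ, hL.Xi_one_sub ρ.2⟩
  invFun ρ := ⟨1 - ρ, hL.Xi_one_sub ρ.2⟩
  left_inv ρ := by ext; simp
  right_inv ρ := by ext; simp

/-- Every zero of `Ξ` is one of `ρ`, `1 - ρ` for a zero `ρ` in the upper half-plane. -/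
noncomputable def pairEquiv :
    {ρ : ℂ // Ξ ρ = 0 ∧ 0 < ρ.im} ⊕ {ρ : ℂ // Ξ ρ = 0 ∧ 0 < ρ.im} ≃ {ρ : ℂ // Ξ ρ = 0} :=
  Equiv.ofBijective
    (Sum.elim (fun ρ => ⟨ρ, ρ.2.1⟩) fun ρ => ⟨1 - ρ, hL.Xi_one_sub ρ.2.1⟩) (by
    constructor
    · rintro (ρ | ρ) (τ | τ) h <;> simp only [Sum.elim_inl, Sum.elim_inr, Subtype.mk.injEq] at h
      · rw [Subtype.ext h]
      · have := congrArg im h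
        rw [sub_im, one_im] at this
        linarith [ρ.2.2, τ.2.2]
      · have := congrArg im h
        rw [sub_im, one_im] at this
        linarith [ρ.2.2, τ.2.2]
      · rw [Subtype.ext (sub_right_injective h)]
    · rintro ⟨ρ, hρ⟩
      rcases lt_or_gt_of_ne (hL.Xi_zeros ρ hρ).2.2 with h | h
      · exact ⟨Sum.inr ⟨1 - ρ, hL.Xi_one_sub hρ, by rw [sub_im, one_im]; linarith⟩, by simp⟩
      · exact ⟨Sum.inl ⟨ρ, hρ, h⟩, by simp⟩)

theorem pairEquiv_inr (ρ : {ρ : ℂ // Ξ ρ = 0 ∧ 0 < ρ.im}) :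
    (hL.pairEquiv (Sum.inr ρ) : ℂ) = 1 - ρ := rfl

theorem exists_separation_pair {x : ℂ} (hx : x ∈ eligible Ξ) :
    ∃ c : ℝ, 0 < c ∧ ∀ z ∈ ball x c, ∀ ρ : {ρ : ℂ // Ξ ρ = 0},
      c * (1 + ‖(ρ : ℂ) - 2‖ + 0) ≤ ‖z - ρ‖ ∧ c * (1 + ‖(ρ : ℂ) - 2‖ + 0) ≤ ‖z - (1 - ρ)‖ := by
  obtain ⟨c, hc, h⟩ := hL.isOrderOneLeft_Xi.exists_separation_ball hx
  refine ⟨c / 4, by positivity, fun z hz ρ => ?_⟩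
  have hz' : z ∈ ball x c := ball_subset_ball (by linarith) hz
  have h1 := h z hz' ρ ρ.2 0 le_rfl
  have h2 := h z hz' (1 - ρ) (hL.Xi_one_sub ρ.2) 0 le_rfl
  have h3 := mul_le_mul_of_nonneg_left (one_add_norm_sub_two_le ρ) hc.le
  have h4 : 0 ≤ c * ‖(ρ : ℂ) - 2‖ := by positivity
  simp only [ofReal_zero, add_zero] at h1 h2 ⊢
  constructor <;> linarith

/-- Pairing gives `(2x - 1) / ((x - ρ)(x - 1 + ρ))`, of quadratic decay in the zeros. -/
theorem summable_pair {x : ℂ} (hx : x ∈ eligible Ξ) :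
    Summable fun ρ : {ρ : ℂ // Ξ ρ = 0} =>
      (analyticOrderNatAt Ξ ρ : ℂ) * ((x - ρ)⁻¹ + (x - (1 - ρ))⁻¹) := by
  obtain ⟨c, hc, h⟩ := hL.exists_separation_pair hx
  refine hL.isOrderOneLeft_Xi.summable_of_norm_le (σ := 2) (by norm_num)
    (C := ‖2 * x - 1‖ * (c⁻¹ * c⁻¹)) fun ρ => ?_
  obtain ⟨h1, h2⟩ := h x (mem_ball_self hc) ρ
  have e1 := slitPlane_ne_zero (hx ρ ρ.2)
  have e2 := slitPlane_ne_zero (hx (1 - ρ) (hL.Xi_one_sub ρ.2))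
  have h3 : (x - ρ)⁻¹ + (x - (1 - ρ))⁻¹ = (2 * x - 1) * (((x - ρ) ^ 1)⁻¹ * ((x - (1 - ρ)) ^ 1)⁻¹) := by
    field_simp
    ring
  have h4 := IsOrderOneLeft.norm_inv_pow_le hc (norm_nonneg _) le_rfl h1 1
  have h5 := IsOrderOneLeft.norm_inv_pow_le hc (norm_nonneg _) le_rfl h2 1
  rw [h3, norm_mul, norm_mul]
  have h6 : (1 + ‖(ρ : ℂ) - 2‖) ^ (-(2 : ℝ)) =
      (1 + ‖(ρ : ℂ) - 2‖) ^ (-((1 : ℕ) : ℝ)) * (1 + ‖(ρ : ℂ) - 2‖) ^ (-((1 : ℕ) : ℝ)) := by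
    rw [← Real.rpow_add (by positivity)]
    norm_num
  rw [h6]
  calc _ ≤ ‖2 * x - 1‖ * ((c⁻¹ ^ 1 * (1 + ‖(ρ : ℂ) - 2‖) ^ (-((1 : ℕ) : ℝ))) *
        (c⁻¹ ^ 1 * (1 + ‖(ρ : ℂ) - 2‖) ^ (-((1 : ℕ) : ℝ)))) := by gcongr
    _ = _ := by ring

/-- The sum runs over all zeros, so by the reflection each one is met both as `ρ` and as `1 - ρ`;
this is the factor `2`. -/
theorem hasDerivAt_tsum_pair {x : ℂ} (hx : x ∈ eligible Ξ) :
    HasDerivAt (fun z => ∑' ρ : {ρ : ℂ // Ξ ρ = 0},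
      (analyticOrderNatAt Ξ ρ : ℂ) * ((z - (ρ : ℂ))⁻¹ + (z - (1 - (ρ : ℂ)))⁻¹))
      (-2 * zeroPowSum Ξ 2 x) x := by
  have hf := hL.isOrderOneLeft_Xi
  obtain ⟨c, hc, h⟩ := hL.exists_separation_pair hx
  have hs := (hf.summable_weight (σ := (2 : ℕ)) (by norm_num)).mul_left (2 * c⁻¹ ^ 2)
  have hne : ∀ (z w : ℂ) (r : ℝ), 0 ≤ r → c * (1 + r + 0) ≤ ‖z - w‖ → z - w ≠ 0 := by
    intro z w r hr hzw h0
    rw [h0, norm_zero] at hzw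
    have : 0 < c * (1 + r + 0) := by positivity
    linarith
  have hinv : ∀ z w : ℂ, z - w ≠ 0 →
      HasDerivAt (fun z => (z - w)⁻¹) (-((z - w) ^ 2)⁻¹) z := fun z w hzw => by
    simpa using IsOrderOneLeft.hasDerivAt_inv_pow 1 hzw
  have hd : ∀ ρ : {ρ : ℂ // Ξ ρ = 0}, ∀ z ∈ ball x c,
      HasDerivAt (fun z : ℂ => (analyticOrderNatAt Ξ ρ : ℂ) * ((z - (ρ : ℂ))⁻¹ + (z - (1 - (ρ : ℂ)))⁻¹))
        ((analyticOrderNatAt Ξ ρ : ℂ) * (-((z - (ρ : ℂ)) ^ 2)⁻¹ + -((z - (1 - (ρ : ℂ))) ^ 2)⁻¹)) z :=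
    fun ρ z hz => ((hinv z ρ (hne _ _ _ (norm_nonneg _) (h z hz ρ).1)).fun_add
      (hinv z (1 - ρ) (hne _ _ _ (norm_nonneg _) (h z hz ρ).2))).const_mul _
  have hb : ∀ ρ : {ρ : ℂ // Ξ ρ = 0}, ∀ z ∈ ball x c,
      ‖(analyticOrderNatAt Ξ ρ : ℂ) * (-((z - (ρ : ℂ)) ^ 2)⁻¹ + -((z - (1 - (ρ : ℂ))) ^ 2)⁻¹)‖ ≤
        2 * c⁻¹ ^ 2 * ((analyticOrderNatAt Ξ ρ : ℝ) *
          (1 + ‖(ρ : ℂ) - 2‖) ^ (-((2 : ℕ) : ℝ))) := by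
    intro ρ z hz
    have h1 := IsOrderOneLeft.norm_inv_pow_le hc (norm_nonneg _) le_rfl (h z hz ρ).1 2
    have h2 := IsOrderOneLeft.norm_inv_pow_le hc (norm_nonneg _) le_rfl (h z hz ρ).2 2
    have h3 : ‖-((z - (ρ : ℂ)) ^ 2)⁻¹ + -((z - (1 - (ρ : ℂ))) ^ 2)⁻¹‖ ≤
        2 * (c⁻¹ ^ 2 * (1 + ‖(ρ : ℂ) - 2‖) ^ (-((2 : ℕ) : ℝ))) := by
      refine (norm_add_le _ _).trans ?_
      rw [norm_neg, norm_neg]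
      linarith
    rw [norm_mul, norm_natCast]
    calc _ ≤ (analyticOrderNatAt Ξ ρ : ℝ) *
          (2 * (c⁻¹ ^ 2 * (1 + ‖(ρ : ℂ) - 2‖) ^ (-((2 : ℕ) : ℝ)))) :=
          mul_le_mul_of_nonneg_left h3 (Nat.cast_nonneg _)
      _ = _ := by ring
  have h1 := hasDerivAt_tsum_of_isPreconnected hs isOpen_ball (convex_ball x c).isPreconnected hd hb
    (mem_ball_self hc) (hL.summable_pair hx) (mem_ball_self hc)
  refine h1.congr_deriv ?_
  have h2 := (hf.summable_zeroPowSum le_rfl hx).hasSum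
  have h3 := (hL.reflect.hasSum_iff
    (f := fun ρ : {ρ : ℂ // Ξ ρ = 0} => (analyticOrderNatAt Ξ ρ : ℂ) * ((x - ρ) ^ 2)⁻¹)).mpr h2
  have h4 := (h2.add h3).neg
  rw [← zeroPowSum] at h4
  rw [show -2 * zeroPowSum Ξ 2 x = -(zeroPowSum Ξ 2 x + zeroPowSum Ξ 2 x) by ring, ← h4.tsum_eq]
  refine tsum_congr fun ρ => ?_
  simp only [Function.comp_apply, reflect, Equiv.coe_fn_mk, hL.analyticOrderNatAt_one_sub]
  ring

theorem summable_pairTerm {x : ℂ} (hx : x ∈ eligible Ξ) : Summable (pairTerm Ξ x) := by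
  have h := (hL.summable_pair hx).comp_injective
    (hL.pairEquiv.injective.comp Sum.inl_injective)
  exact h

/-- There are no real zeros, so each pair has exactly one member in the upper half-plane, and the
sum over all zeros counts it twice. -/
theorem tsum_pair {x : ℂ} (hx : x ∈ eligible Ξ) :
    ∑' ρ : {ρ : ℂ // Ξ ρ = 0}, (analyticOrderNatAt Ξ ρ : ℂ) * ((x - ρ)⁻¹ + (x - (1 - ρ))⁻¹) =
      2 * zetaAtOne Ξ x := by
  set T : {ρ : ℂ // Ξ ρ = 0} → ℂ := fun ρ =>
    (analyticOrderNatAt Ξ ρ : ℂ) * ((x - ρ)⁻¹ + (x - (1 - ρ))⁻¹) with hT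
  have h1 := (hL.summable_pairTerm hx).hasSum
  have e : (T ∘ hL.pairEquiv) ∘ Sum.inr = pairTerm Ξ x := by
    funext ρ
    simp only [hT, Function.comp_apply, hL.pairEquiv_inr, pairTerm,
      hL.analyticOrderNatAt_one_sub, sub_sub_cancel]
    ring
  have h2 : HasSum ((T ∘ hL.pairEquiv) ∘ Sum.inr) (zetaAtOne Ξ x) := by rw [e]; exact h1
  have h3 := (hL.pairEquiv.hasSum_iff (f := T)).mp (HasSum.sum h1 h2)
  rw [h3.tsum_eq, two_mul, zetaAtOne]

/-- Twice the paired sum and `2 ℓ'` have the same derivative on a connected open set. At `1/2` both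
vanish: the terms of a pair cancel, and `Ξ'(1/2) = 0` by the functional equation. -/
theorem zetaAtOne_eq {ℓ : ℂ → ℂ} (hℓ : AnalyticOnNhd ℂ ℓ (eligible Ξ))
    (he : ∀ z ∈ eligible Ξ, exp (ℓ z) = Ξ z) {x : ℂ} (hx : x ∈ eligible Ξ) :
    zetaAtOne Ξ x = deriv ℓ x := by
  have hf := hL.isOrderOneLeft_Xi
  set F : ℂ → ℂ := fun z => ∑' ρ : {ρ : ℂ // Ξ ρ = 0},
      (analyticOrderNatAt Ξ ρ : ℂ) * ((z - (ρ : ℂ))⁻¹ + (z - (1 - (ρ : ℂ)))⁻¹) with hF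
  have hd : ∀ z ∈ eligible Ξ, HasDerivAt (fun z => F z - 2 * deriv ℓ z) 0 z := by
    intro z hz
    have h2 := (hℓ z hz).deriv.differentiableAt.hasDerivAt
    have h3 := hf.iteratedDeriv_two_log hℓ he hz
    rw [iteratedDeriv_succ, iteratedDeriv_one] at h3
    rw [h3] at h2
    refine ((hL.hasDerivAt_tsum_pair hz).fun_sub (h2.const_mul 2)).congr_deriv ?_
    ring
  have hhalf : (1 / 2 : ℂ) ∈ eligible Ξ := by
    simpa using hL.ofReal_mem_eligible_Xi (1 / 2)
  obtain ⟨k, hk⟩ := hf.isOpen_eligible.exists_is_const_of_deriv_eq_zero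
    hf.isPreconnected_eligible
    (fun z hz => (hd z hz).differentiableAt.differentiableWithinAt)
    (fun z hz => (hd z hz).deriv)
  have h0 : F (1 / 2) = 0 := by
    simp only [hF]
    refine (tsum_congr fun ρ => ?_).trans tsum_zero
    rw [show (1 / 2 : ℂ) - (1 - ρ) = -(1 / 2 - ρ) by ring, inv_neg, add_neg_cancel, mul_zero]
  have h1 : deriv ℓ (1 / 2) = 0 := by
    have h2 : (fun z => Ξ (1 - z)) = Ξ := funext fun z => (hL.functional_equation z).symm
    have h3 : deriv (fun z => Ξ (1 - z)) (1 / 2) = -deriv Ξ (1 - 1 / 2) :=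
      deriv_comp_const_sub _ _ _
    rw [h2, show (1 : ℂ) - 1 / 2 = 1 / 2 by norm_num] at h3
    have h4 : deriv Ξ (1 / 2) = 0 := by linear_combination h3 / 2
    rw [hf.deriv_log_eq hℓ he hhalf, logDeriv_apply, h4, zero_div]
  have hk0 := hk _ hhalf
  have hkx := hk _ hx
  simp only [h0, h1] at hk0
  simp only [hF] at hkx
  rw [hL.tsum_pair hx] at hkx
  linear_combination hkx / 2 - hk0 / 2

end IsPrimary
end Pairs

/-! ### Logarithmic derivatives of `L`, complex and real. -/

section Logarithms
open Complex Set Metric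

/-- Iterated real derivatives of a real function that extends holomorphically. -/
theorem ofReal_iteratedDeriv {g : ℂ → ℂ} {φ : ℝ → ℝ} {x : ℝ} (hg : AnalyticAt ℂ g x)
    (h : ∀ᶠ u : ℝ in 𝓝 x, (φ u : ℂ) = g u) (n : ℕ) :
    ((iteratedDeriv n φ x : ℝ) : ℂ) = iteratedDeriv n g x := by
  have ha : ∀ᶠ u : ℝ in 𝓝 x, AnalyticAt ℂ g u :=
    continuous_ofReal.continuousAt.eventually hg.eventually_analyticAt
  have key : ∀ n : ℕ, ∀ᶠ u : ℝ in 𝓝 x, ((iteratedDeriv n φ u : ℝ) : ℂ) = iteratedDeriv n g u := by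
    intro n
    induction n with
    | zero => simpa using h
    | succ n ih =>
      filter_upwards [ha, ih.eventually_nhds] with u hu hn
      have h1 : HasDerivAt (iteratedDeriv n g) (iteratedDeriv (n + 1) g u) u := by
        rw [iteratedDeriv_succ, iteratedDeriv_eq_iterate]
        exact (hu.iterated_deriv n).differentiableAt.hasDerivAt
      have h2 : HasDerivAt (iteratedDeriv n φ) (iteratedDeriv (n + 1) g u).re u := by
        refine h1.real_of_complex.congr_of_eventuallyEq ?_
        filter_upwards [hn] with v hv
        rw [← hv, ofReal_re]
      have h3 := h1.comp_ofReal.congr_of_eventuallyEq hn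
      rw [iteratedDeriv_succ, h2.deriv, h2.ofReal_comp.unique h3]
  exact (key n).self_of_nhds

/-- Where `L` is real and positive, `log |L|` is the restriction of the holomorphic principal `log
L`, whose derivative is `L' / L`. -/
theorem iteratedDeriv_logDeriv_of_re_pos {L : ℂ → ℂ} {x : ℝ} (hL : AnalyticAt ℂ L x)
    (hr : ∀ᶠ u : ℝ in 𝓝 x, (L u).im = 0) (h0 : 0 < (L x).re) (m : ℕ) :
    iteratedDeriv m (fun z => deriv L z / L z) x =
      ((iteratedDeriv (m + 1) (fun u : ℝ => Real.log ‖L u‖) x : ℝ) : ℂ) := by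
  have hs : L x ∈ slitPlane := mem_slitPlane_iff.mpr (Or.inl h0)
  have hev := hL.continuousAt.eventually (isOpen_slitPlane.mem_nhds hs)
  have hre : ∀ᶠ u : ℝ in 𝓝 x, 0 < (L u).re := by
    have h1 : ContinuousAt (fun u : ℝ => (L u).re) x :=
      continuous_re.continuousAt.comp
        (ContinuousAt.comp (f := fun u : ℝ => (u : ℂ)) hL.continuousAt continuous_ofReal.continuousAt)
    exact h1.eventually (lt_mem_nhds h0)
  rw [ofReal_iteratedDeriv (g := fun z => log (L z)) (hL.clog hs) _ (m + 1), iteratedDeriv_succ']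
  · refine (EventuallyEq.iteratedDeriv_eq m ?_).symm
    filter_upwards [hev, hL.eventually_analyticAt] with z hz hza
    exact (hza.differentiableAt.hasDerivAt.clog hz).deriv
  · filter_upwards [hr, hre] with u hu hu'
    have h1 : L u = ((L u).re : ℂ) := Complex.ext rfl (by simpa using hu)
    rw [h1, norm_real, Real.norm_of_nonneg hu'.le, ofReal_log hu'.le]

/-- If `L x < 0`, passing to `-L` changes neither `L' / L` nor `|L|`. -/
theorem iteratedDeriv_logDeriv_of_real {L : ℂ → ℂ} {x : ℝ} (hL : AnalyticAt ℂ L x)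
    (hr : ∀ᶠ u : ℝ in 𝓝 x, (L u).im = 0) (h0 : L x ≠ 0) (m : ℕ) :
    iteratedDeriv m (fun z => deriv L z / L z) x =
      ((iteratedDeriv (m + 1) (fun u : ℝ => Real.log ‖L u‖) x : ℝ) : ℂ) := by
  have h1 : (L x).re ≠ 0 := fun h => h0 (Complex.ext h hr.self_of_nhds)
  rcases lt_or_gt_of_ne h1 with h2 | h2
  · have h3 := iteratedDeriv_logDeriv_of_re_pos (L := fun z => -L z) hL.neg (by simpa using hr)
      (by simpa using h2) m
    simpa [neg_div_neg_eq] using h3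
  · exact iteratedDeriv_logDeriv_of_re_pos hL hr h2 m

theorem iteratedDeriv_inv_sub {c : ℂ} (m : ℕ) : ∀ x : ℂ, x ≠ c →
    iteratedDeriv m (fun z => (z - c)⁻¹) x = (-1) ^ m * (m.factorial : ℂ) * ((x - c) ^ (m + 1))⁻¹ := by
  induction m with
  | zero => intro x _; simp
  | succ m ih =>
    intro x hx
    have h1 : iteratedDeriv m (fun z => (z - c)⁻¹) =ᶠ[𝓝 x]
        fun z => (-1) ^ m * (m.factorial : ℂ) * ((z - c) ^ (m + 1))⁻¹ := by
      filter_upwards [isOpen_ne.mem_nhds hx] with z hz using ih z hz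
    rw [iteratedDeriv_succ, h1.deriv_eq, ((IsOrderOneLeft.hasDerivAt_inv_pow (m + 1)
      (sub_ne_zero.mpr hx)).const_mul _).deriv, Nat.factorial_succ, pow_succ (-1 : ℂ)]
    push_cast
    ring

namespace IsPrimary

variable {L G Ξ : ℂ → ℂ} {q : ℕ} (hL : IsPrimary L G Ξ q)
include hL

theorem ne_zero_of_mem {x : ℂ} (hX : x ∈ eligible Ξ) (hG : x ∈ eligible G) (hx : x ≠ 1) :
    L x ≠ 0 := by
  intro h0
  have h1 := hL.factorization x hx
  rw [h0, mul_zero] at h1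
  exact mul_ne_zero (ne_zero_of_mem_eligible hG) (ne_zero_of_mem_eligible hX) h1

theorem deriv_log_eq {ℓ : ℂ → ℂ} {x : ℂ} (hx : x ≠ 1) (hLx : L x ≠ 0) (hℓ : AnalyticAt ℂ ℓ x)
    (he : ∀ᶠ z in 𝓝 x, exp (ℓ z) = (z - 1) ^ q * L z) :
    deriv ℓ x = q / (x - 1) + deriv L x / L x := by
  have hx1 : x - 1 ≠ 0 := sub_ne_zero.mpr hx
  have h1 := (hℓ.differentiableAt.hasDerivAt.cexp).congr_of_eventuallyEq
    (f₁ := fun z => (z - 1) ^ q * L z) (by filter_upwards [he] with z hz using hz.symm)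
  have h2 := (((hasDerivAt_id x).sub_const 1).fun_pow q).fun_mul
    (hL.analyticAt_of_ne_one hx).differentiableAt.hasDerivAt
  have h3 := h1.unique h2
  rw [he.self_of_nhds] at h3
  have hq := hL.q_le_one
  -- The power rule produces the exponent `q - 1` with truncated subtraction, so `q = 0` and `q = 1`
  -- are treated separately.
  interval_cases q
  · simp at h3 ⊢
    field_simp
    linear_combination h3
  · simp at h3 ⊢
    field_simp
    linear_combination h3

theorem iteratedDeriv_log_eq {ℓ : ℂ → ℂ} {x : ℂ} (hx : x ≠ 1) (hLx : L x ≠ 0)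
    (hℓ : AnalyticAt ℂ ℓ x) (he : ∀ᶠ z in 𝓝 x, exp (ℓ z) = (z - 1) ^ q * L z) {n : ℕ}
    (hn : 1 ≤ n) :
    (-1) ^ (n - 1) / ((n - 1).factorial : ℂ) * iteratedDeriv n ℓ x =
      q / (x - 1) ^ n + (-1) ^ (n - 1) / ((n - 1).factorial : ℂ) *
        iteratedDeriv (n - 1) (fun z => deriv L z / L z) x := by
  obtain ⟨m, rfl⟩ : ∃ m, n = m + 1 := ⟨n - 1, by lia⟩
  have hLa := hL.analyticAt_of_ne_one hx
  have h1 : deriv ℓ =ᶠ[𝓝 x] fun z => q * (z - 1)⁻¹ + deriv L z / L z := by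
    filter_upwards [isOpen_ne.mem_nhds hx, hLa.continuousAt.eventually_ne hLx,
      hℓ.eventually_analyticAt, he.eventually_nhds] with z h1 h2 h3 h4
    rw [hL.deriv_log_eq h1 h2 h3 h4, div_eq_mul_inv (q : ℂ)]
  have a1 : AnalyticAt ℂ (fun z : ℂ => (q : ℂ) * (z - 1)⁻¹) x :=
    analyticAt_const.mul ((analyticAt_id.sub analyticAt_const).inv (sub_ne_zero.mpr hx))
  have a2 : AnalyticAt ℂ (fun z => deriv L z / L z) x := hLa.deriv.div hLa hLx
  have hm : (m.factorial : ℂ) ≠ 0 := by exact_mod_cast m.factorial_ne_zero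
  have h2 : (-1 : ℂ) ^ m * (-1) ^ m = 1 := by rw [← mul_pow]; simp
  rw [iteratedDeriv_succ', h1.iteratedDeriv_eq, iteratedDeriv_fun_add a1.contDiffAt a2.contDiffAt,
    iteratedDeriv_const_mul_field, iteratedDeriv_inv_sub m x hx, Nat.add_sub_cancel, mul_add]
  congr 1
  rw [div_mul_eq_mul_div, div_eq_iff hm, div_eq_mul_inv]
  linear_combination (q : ℂ) * (m.factorial : ℂ) * ((x - 1) ^ (m + 1))⁻¹ * h2

end IsPrimary
end Logarithms

/-! ### Assembly for the trivial and the nontrivial zeros. -/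

theorem mainTheorem3 (L G Ξ : ℂ → ℂ) (q : ℕ) (hL : IsPrimary L G Ξ q)
    (α₁ b₁ α₀ b₀ : ℂ) (a : ℕ → ℂ) (hG : HasStirlingExpansion G α₁ b₁ α₀ b₀ a) :
    ∃ (Z S : ℂ → ℂ → ℂ) (logXi logG logM : ℂ → ℂ),
      -- the zeta functions over the nontrivial and over the trivial zeros
      IsZetaOverZeros Ξ Z (-α₁) ∧ IsZetaOverZeros G S α₁ ∧
      -- the branches of `log Ξ`, `log G` and `log [(x - 1) ^ q L(x)]`
      IsLogBranch Ξ (eligible Ξ)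
        (fun t => α₁ * t * (Real.log t - 1) + b₁ * t + (α₀ + q) * Real.log t + b₀) logXi ∧
      IsLogBranch G (eligible G)
        (fun t => -(α₁ * t * (Real.log t - 1) + b₁ * t + α₀ * Real.log t + b₀)) logG ∧
      AnalyticOnNhd ℂ logM (eligible Ξ ∩ eligible G) ∧
      IsLogBranch (fun z => (z - 1) ^ q * L z) ((eligible Ξ ∩ eligible G) \ {1})
        (fun t => q * Real.log (t - 1)) logM ∧
      -- nonpositive integers, trivial zeros
      (∀ x ∈ eligible G,
        (∀ n : ℕ, S (-(n : ℂ)) x = shadowPoly α₁ α₀ a n x) ∧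
        S 0 x = -α₁ * x - α₀) ∧
      (∀ x ∈ eligible Ξ,
        -- nonpositive integers
        (∀ n : ℕ, Z (-(n : ℂ)) x = -shadowPoly α₁ α₀ a n x + q * (x - 1) ^ n) ∧
        Z 0 x = α₁ * x + α₀ + q ∧
        -- derivative at `0` and finite part at `1`
        HasDerivAt (fun s => Z s x) (b₁ * x + b₀ - logXi x) 0 ∧
        HasFinitePart (fun s => Z s x) 1 (-b₁ + deriv logXi x) ∧
        -- positive integers
        Summable (pairTerm Ξ x) ∧
        zetaAtOne Ξ x = deriv logXi x ∧
        (∀ n : ℕ, 2 ≤ n →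
          Z n x = (-1) ^ (n - 1) / ((n - 1).factorial : ℂ) * iteratedDeriv n logXi x) ∧
        -- the anomaly at `1`
        (∀ c : ℂ, HasFinitePart (fun s => Z s x) 1 c → zetaAtOne Ξ x - c = b₁) ∧
        logDeriv (fun w => Ξ w / Complex.exp (-deriv (fun s => Z s w) 0)) x = b₁) ∧
      (∀ x ∈ eligible Ξ ∩ eligible G,
        (∀ n : ℕ, Z (-(n : ℂ)) x = -S (-(n : ℂ)) x + q * (x - 1) ^ n) ∧
        HasDerivAt (fun s => Z s x) (b₁ * x + b₀ + logG x - logM x) 0 ∧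
        HasFinitePart (fun s => Z s x) 1 (-b₁ - deriv logG x + deriv logM x) ∧
        (∀ n : ℕ, 2 ≤ n →
          Z n x = -S n x
            + (-1) ^ (n - 1) / ((n - 1).factorial : ℂ) * iteratedDeriv n logM x) ∧
        (x ≠ 1 →
          HasFinitePart (fun s => Z s x) 1
            (-b₁ - deriv logG x + (q / (x - 1) + deriv L x / L x)) ∧
          ∀ n : ℕ, 2 ≤ n →
            Z n x = -S n x + (q / (x - 1) ^ n
              + (-1) ^ (n - 1) / ((n - 1).factorial : ℂ)
                * iteratedDeriv (n - 1) (fun z => deriv L z / L z) x))) ∧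
      -- the same with `log |L|`, for real `x` and `L` real on the real axis
      ((∀ u : ℝ, u ≠ 1 → (L u).im = 0) →
        ∀ x : ℝ, x ≠ 1 → (x : ℂ) ∈ eligible G → ∀ n : ℕ, 2 ≤ n →
          Z n x = -S n x + (q / ((x : ℂ) - 1) ^ n
            + (-1) ^ (n - 1) / ((n - 1).factorial : ℂ)
              * ((iteratedDeriv n (fun u : ℝ => Real.log ‖L u‖) x : ℝ) : ℂ))) := by
  have hGo := hL.isOrderOneLeft_G
  have hXo := hL.isOrderOneLeft_Xi
  obtain ⟨logG, hGa, hGe, hGx⟩ := hG.exists_log hGo hL.G_zeros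
  obtain ⟨logXi, hXa, hXe, hXx, hlim⟩ := hL.exists_log_Xi hGa hGe hGx
  obtain ⟨S, hS, hS'⟩ := hGo.exists_zeta hGa hGe hGx
  obtain ⟨Z, hZ, hZ'⟩ := hXo.exists_zeta hXa hXe hXx
  rw [neg_neg] at hS
  have sp0 : ∀ x, shadowPoly α₁ α₀ a 0 x = -α₁ * x - α₀ := fun x => by simp [shadowPoly]
  have hSn : ∀ x ∈ eligible G, ∀ n : ℕ, S (-(n : ℂ)) x = shadowPoly α₁ α₀ a n x := fun x hx n => by
    rw [(hS' x hx).1 n, shadowPoly_neg, neg_neg]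
  have hZn : ∀ x ∈ eligible Ξ, ∀ n : ℕ,
      Z (-(n : ℂ)) x = -shadowPoly α₁ α₀ a n x + q * (x - 1) ^ n := fun x hx n => by
    rw [(hZ' x hx).1 n, shadowPoly_add, neg_sub, neg_add_eq_sub]
  have hone : ∀ x ∈ eligible Ξ, zetaAtOne Ξ x = deriv logXi x := fun x hx =>
    hL.zetaAtOne_eq hXa hXe hx
  have hopen : IsOpen (eligible Ξ ∩ eligible G) := hXo.isOpen_eligible.inter hGo.isOpen_eligible
  -- The sum is holomorphic also at `1`, where the factorization is not assumed and the assigned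
  -- value of `L` carries no meaning when there is a pole; only the exponential identity has to
  -- leave out `1`.
  set logM : ℂ → ℂ := fun z => logXi z + logG z with hlogM
  have hMa : AnalyticOnNhd ℂ logM (eligible Ξ ∩ eligible G) := fun z hz =>
    (hXa z hz.1).add (hGa z hz.2)
  have hMe : ∀ z ∈ eligible Ξ ∩ eligible G, z ≠ 1 → Complex.exp (logM z) = (z - 1) ^ q * L z :=
    fun z hz hz1 => by
      rw [← hL.factorization z hz1, hlogM, Complex.exp_add, hXe z hz.1, hGe z hz.2, mul_comm]
  have hMev : ∀ x ∈ eligible Ξ ∩ eligible G, x ≠ 1 →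
      ∀ᶠ z in 𝓝 x, Complex.exp (logM z) = (z - 1) ^ q * L z := fun x hx hx1 => by
    filter_upwards [hopen.mem_nhds hx, isOpen_ne.mem_nhds hx1] with z hz hz1 using hMe z hz hz1
  have hM1 : ∀ x ∈ eligible Ξ ∩ eligible G, deriv logM x = deriv logXi x + deriv logG x :=
    fun x hx => deriv_fun_add (hXa x hx.1).differentiableAt (hGa x hx.2).differentiableAt
  have hMn : ∀ x ∈ eligible Ξ ∩ eligible G, ∀ n : ℕ,
      iteratedDeriv n logM x = iteratedDeriv n logXi x + iteratedDeriv n logG x :=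
    fun x hx n => iteratedDeriv_fun_add (hXa x hx.1).contDiffAt (hGa x hx.2).contDiffAt
  have hZS : ∀ x ∈ eligible Ξ ∩ eligible G, ∀ n : ℕ, 2 ≤ n → Z n x = -S n x
      + (-1) ^ (n - 1) / ((n - 1).factorial : ℂ) * iteratedDeriv n logM x := fun x hx n hn => by
    rw [(hZ' x hx.1).2.2.2 n hn, (hS' x hx.2).2.2.2 n hn, hMn x hx n]
    ring
  have hZL : ∀ x ∈ eligible Ξ ∩ eligible G, x ≠ 1 → ∀ n : ℕ, 2 ≤ n → Z n x = -S n x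
      + (q / (x - 1) ^ n + (-1) ^ (n - 1) / ((n - 1).factorial : ℂ)
        * iteratedDeriv (n - 1) (fun z => deriv L z / L z) x) := fun x hx hx1 n hn => by
    rw [hZS x hx n hn, hL.iteratedDeriv_log_eq hx1 (hL.ne_zero_of_mem hx.1 hx.2 hx1) (hMa x hx)
      (hMev x hx hx1) (one_le_two.trans hn)]
  refine ⟨Z, S, logXi, logG, logM, hZ, hS, ⟨hXa, hXe, hXx.tendsto⟩, ⟨hGa, hGe, ?_⟩, hMa,
    ⟨hMa.mono Set.sdiff_subset, fun z hz => hMe z hz.1 hz.2, hlim⟩,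
    fun x hx => ⟨hSn x hx, ?_⟩,
    fun x hx => ⟨hZn x hx, ?_, (hZ' x hx).2.1, (hZ' x hx).2.2.1, hL.summable_pairTerm hx,
      hone x hx, (hZ' x hx).2.2.2, ?_, ?_⟩,
    fun x hx => ⟨fun n => ?_, ?_, ?_, hZS x hx, fun hx1 => ⟨?_, hZL x hx hx1⟩⟩, ?_⟩
  · refine hGx.tendsto.congr fun t => ?_
    ring
  · simpa [sp0] using hSn x hx 0
  · have := hZn x hx 0
    rw [sp0] at this
    simp only [Nat.cast_zero, neg_zero, pow_zero, mul_one] at this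
    rw [this]
    ring
  · intro c hc
    rw [hone x hx, hc.unique (hZ' x hx).2.2.1]
    ring
  -- By the value of `Z'(0, w)`, `𝒟(w) = Ξ(w) exp(-b₁ w - b₀)`, so the quotient is the exponential
  -- of an affine function.
  · have h1 : (fun w => Ξ w / Complex.exp (-deriv (fun s => Z s w) 0)) =ᶠ[𝓝 x]
        fun w => Complex.exp (b₁ * w + b₀) := by
      filter_upwards [hXo.isOpen_eligible.mem_nhds hx] with w hw
      rw [(hZ' w hw).2.1.deriv, ← hXe w hw, ← Complex.exp_sub]
      ring_nf
    have h2 : HasDerivAt (fun w => Complex.exp (b₁ * w + b₀))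
        (Complex.exp (b₁ * x + b₀) * b₁) x := by
      simpa using (((hasDerivAt_id x).const_mul b₁).add_const b₀).cexp
    rw [logDeriv_apply, h1.deriv_eq, h1.eq_of_nhds, h2.deriv,
      mul_div_cancel_left₀ _ (Complex.exp_ne_zero _)]
  · rw [hZn x hx.1, hSn x hx.2]
  · refine (hZ' x hx.1).2.1.congr_deriv ?_
    simp only [hlogM]
    ring
  · have := (hZ' x hx.1).2.2.1
    rwa [show -b₁ - deriv logG x + deriv logM x = -b₁ + deriv logXi x by rw [hM1 x hx]; ring]
  · have := (hZ' x hx.1).2.2.1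
    rw [← hL.deriv_log_eq hx1 (hL.ne_zero_of_mem hx.1 hx.2 hx1) (hMa x hx) (hMev x hx hx1)]
    rwa [show -b₁ - deriv logG x + deriv logM x = -b₁ + deriv logXi x by rw [hM1 x hx]; ring]
  · intro hreal x hx hxG n hn
    have hx1 : (x : ℂ) ≠ 1 := by rwa [Ne, Complex.ofReal_eq_one]
    have hxX := hL.ofReal_mem_eligible_Xi x
    have h1 := iteratedDeriv_logDeriv_of_real (hL.analyticAt_of_ne_one hx1)
      (by filter_upwards [isOpen_ne.mem_nhds hx] with u hu using hreal u hu)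
      (hL.ne_zero_of_mem hxX hxG hx1) (n - 1)
    rw [Nat.sub_add_cancel (one_le_two.trans hn)] at h1
    rw [hZL x ⟨hxX, hxG⟩ hx1 n hn, h1]
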